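/- **Setting.** For $N\ge 1$, vectors of $\mathbb C^N$ are encoded in $\lceil\log_2 N\rceil$ qubits (the $i$-th basis state, $0\le i<N$, is given by the binary digits of $i$; amplitudes outside this range are zero). A quantum circuit of depth $d$ consists of $d$ layers, each made of arbitrary one- and two-qubit unitary gates acting on pairwise disjoint sets of qubits. A *factorized linear system* consists of $N,M,R$, circuits preparing unit vectors $|u_1\rangle,\dots,|u_R\rangle,|b\rangle\in\mathbb C^N$ and $|v_1\rangle,\dots,|v_R\rangle\in\mathbb C^M$ from $|0\cdots0\rangle$, and classically known norms $\|u_j\|,\|v_j\|\ge 0$, $\|\boldsymbol b\|>0$. It defines $$A_1=\sum_{j=1}^R\|u_j\|\,|u_j\rangle\langle j|\in\mathbb C^{N\times R},\qquad A_2=\sum_{j=1}^R\|v_j\|\,|j\rangle\langle v_j|\in\mathbb C^{R\times M},\qquad A=A_1A_2,\qquad \boldsymbol b=\|\boldsymbol b\|\,|b\rangle ,$$ and $\Gamma=\max_{1\le j\le R}\{\|u_j\|^2,\ \|u_j\|\|\boldsymbol b\|,\ \|v_j\|^2\}$. All norms of vectors are Euclidean, norms of matrices are spectral norms, and $\kappa$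 is the ratio of the largest to the smallest singular value. A *hybrid algorithm* is a fixed program for a classical random access machine (natural-number variables and arrays of complex numbers with exact $+,-,\times,\div$, conjugation and comparison of real parts) that controls a quantum device with one ancilla qubit and the data qubits. The device can apply a Hadamard, phase or NOT gate to the ancilla, apply an elementary gate of one of the given circuits to the data qubits controlled by the ancilla, and measure the ancilla (after which all qubits are reset to $|0\rangle$). Each instruction and each test takes one unit of time. The input consists of $N,M,R$, the given circuits (accessed only through the device, apart from their numbers of gates), the norms $\|u_j\|,\|v_j\|,\|\boldsymbol b\|$ and $\varepsilon$. **Theorem.** For every $\delta\in(0,1)$ there is a hybrid algorithm with the following property. Let $p$ be a polynomial bounding circuit depth, and let $c,\varepsilon_0>0$. Then there are an exponent $k$, depending only on $\delta$ and $p$, and a constant $C>0$, depending only on $\delta,p,c,\varepsilon_0$, such that for every factorized linear system whose circuits have depth at most $p(\lceil\log_2N\rceil)$ (those of $|u_j\rangle$ and $|b\rangle$) and at most $p(\lceil\log_2M\rceil)$ (those of $|v_j\rangle$), with $\operatorname{rank}A_1=\operatorname{rank}A_2=R$ and $\|A\|\ge c$, and for every $0<\varepsilon\le\varepsilon_0$,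 with probability at least $1-\delta$ the algorithm halts within time $$C\cdot\frac{R^3\,\Gamma^2\,\bigl(\kappa(A_1)\kappa(A_2)\bigr)^8\,\bigl(1+\log M+\log N+\|\boldsymbol b\|\bigr)^k}{\varepsilon^2}$$ and outputs $s=(s_1,\dots,s_R)\in\mathbb C^R$ such that $\hat x=\sum_{j=1}^R s_j|v_j\rangle$ satisfies $$\|A\hat x-\boldsymbol b\|-\min_{x\in\mathbb C^M}\|Ax-\boldsymbol b\|\le\varepsilon .$$ -/

import Mathlib

open scoped Matrix Matrix.Norms.L2Operator

noncomputable section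

namespace HybridLS

/-! ### Quantum circuits -/

/-- Amplitudes, in the computational basis, of a state of qubits labelled by `W`. -/
abbrev QState (W : Type) : Type := (W → Bool) → ℂ

/-- The state in which every qubit is `|0⟩`. -/
def zeroState (W : Type) [Fintype W] : QState W :=
  fun z => if z = (fun _ => false) then 1 else 0

/-- An arbitrary unitary gate on one qubit or on two distinct qubits. -/
inductive Gate (W : Type) : Type
  | one (w : W) (u : Matrix.unitaryGroup Bool ℂ) : Gate W
  | two (w₁ w₂ : W) (hne : w₁ ≠ w₂) (u : Matrix.unitaryGroup (Bool × Bool) ℂ) : Gate W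

namespace Gate

/-- The set of qubits a gate acts on. -/
def wires {W : Type} : Gate W → Set W
  | one w _ => {w}
  | two w₁ w₂ _ _ => {w₁, w₂}

/-- Relabelling of the qubits. -/
def map {W W' : Type} (f : W ↪ W') : Gate W → Gate W'
  | one w u => one (f w) u
  | two w₁ w₂ hne u => two (f w₁) (f w₂) (fun h => hne (f.injective h)) u

/-- The action of a gate on a state vector: the gate matrix, tensored with the identity on the
remaining qubits. -/
def apply {W : Type} [DecidableEq W] : Gate W → QState W → QState W
  | one w u, ψ => fun z => ∑ a : Bool, u.1 (z w) a * ψ (Function.update z w a)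
  | two w₁ w₂ _ u, ψ => fun z =>
      ∑ a : Bool × Bool, u.1 (z w₁, z w₂) a *
        ψ (Function.update (Function.update z w₁ a.1) w₂ a.2)

end Gate

/-- One layer of a circuit: gates acting on pairwise disjoint sets of qubits. -/
structure Layer (W : Type) : Type where
  gates : List (Gate W)
  disjoint : gates.Pairwise fun g h => Disjoint g.wires h.wires

/-- A circuit is a list of layers, the first layer of the list being applied first. -/
abbrev Circuit (W : Type) : Type := List (Layer W)

namespace Circuit

/-- The depth of a circuit is its number of layers. -/
def depth {W : Type} (c : Circuit W) : ℕ := c.length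

/-- The elementary gates of a circuit in the order of their application. -/
def gates {W : Type} (c : Circuit W) : List (Gate W) := c.flatMap Layer.gates

/-- The state that the circuit prepares from `|0…0⟩`. -/
def output {W : Type} [Fintype W] [DecidableEq W] (c : Circuit W) : QState W :=
  c.gates.foldl (fun ψ g => g.apply ψ) (zeroState W)

end Circuit

/-- The number `⌈log₂ N⌉` of qubits used for vectors in `ℂ^N`. -/
def qubits (N : ℕ) : ℕ := Nat.clog 2 N

/-- The computational basis state of `⌈log₂ N⌉` qubits that stands for the index `i < N`:
its bits are the binary digits of `i`. -/
def basisState {N : ℕ} (i : Fin N) : Fin (qubits N) → Bool := fun q => Nat.testBit i q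

/-- The circuit prepares a state of `ℂ^N`, that is, the basis states that do not stand for an index
below `N` have amplitude zero (no condition if `N` is a power of two). -/
def Prepares (N : ℕ) (c : Circuit (Fin (qubits N))) : Prop :=
  ∀ z, z ∉ Set.range (basisState (N := N)) → c.output z = 0

/-- The vector of `ℂ^N` prepared by a circuit. -/
def prepared {N : ℕ} (c : Circuit (Fin (qubits N))) : Fin N → ℂ := fun i => c.output (basisState i)

/-! ### Factorized linear systems given by circuits and norms -/

/-- The data of a factorized linear system: a circuit and a norm for each of the `R` columns of
`A₁ ∈ ℂ^{N×R}`, for each of the `R` rows of `A₂ ∈ ℂ^{R×M}`, and for the vector `b ∈ ℂ^N`. -/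
structure FactorizedSystem : Type where
  N : ℕ
  M : ℕ
  R : ℕ
  colCircuit : Fin R → Circuit (Fin (qubits N))
  rowCircuit : Fin R → Circuit (Fin (qubits M))
  rhsCircuit : Circuit (Fin (qubits N))
  colNorm : Fin R → ℝ
  rowNorm : Fin R → ℝ
  rhsNorm : ℝ
  prepares_col : ∀ j, Prepares N (colCircuit j)
  prepares_row : ∀ j, Prepares M (rowCircuit j)
  prepares_rhs : Prepares N rhsCircuit
  colNorm_nonneg : ∀ j, 0 ≤ colNorm j
  rowNorm_nonneg : ∀ j, 0 ≤ rowNorm j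
  rhsNorm_pos : 0 < rhsNorm

namespace FactorizedSystem

variable (S : FactorizedSystem)

/-- The state `|u_j⟩`. -/
def u (j : Fin S.R) : Fin S.N → ℂ := prepared (S.colCircuit j)

/-- The state `|v_j⟩`. -/
def v (j : Fin S.R) : Fin S.M → ℂ := prepared (S.rowCircuit j)

/-- `A₁ = ∑ j, ‖u_j‖ |u_j⟩⟨j|`. -/
def A₁ : Matrix (Fin S.N) (Fin S.R) ℂ := Matrix.of fun i j => (S.colNorm j : ℂ) * S.u j i

/-- `A₂ = ∑ j, ‖v_j‖ |j⟩⟨v_j|`. -/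
def A₂ : Matrix (Fin S.R) (Fin S.M) ℂ := Matrix.of fun j i => (S.rowNorm j : ℂ) * star (S.v j i)

/-- `A = A₁ A₂`. -/
def A : Matrix (Fin S.N) (Fin S.M) ℂ := S.A₁ * S.A₂

/-- `b = ‖b‖ |b⟩`. -/
def b : Fin S.N → ℂ := fun i => (S.rhsNorm : ℂ) * prepared S.rhsCircuit i

/-- `Γ = max_j {‖u_j‖², ‖u_j‖‖b‖, ‖v_j‖²}`. -/
def Γ : ℝ :=
  ⨆ j : Fin S.R, max (max (S.colNorm j ^ 2) (S.colNorm j * S.rhsNorm)) (S.rowNorm j ^ 2)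

/-- The Euclidean norm `‖A x - b‖`. -/
def residual (x : Fin S.M → ℂ) : ℝ := ‖WithLp.toLp 2 (S.A *ᵥ x - S.b)‖

/-- The vector `x̂ = ∑ j, s_j |v_j⟩`. -/
def combination (s : Fin S.R → ℂ) : Fin S.M → ℂ := ∑ j, s j • S.v j

/-- `x̂ = ∑ j, s_j |v_j⟩` solves the least squares problem up to `ε`. -/
def IsSolution (ε : ℝ) (s : Fin S.R → ℂ) : Prop :=
  S.residual (S.combination s) - (⨅ x : Fin S.M → ℂ, S.residual x) ≤ ε

/-- All circuits have depth at most `p(⌈log₂ N⌉)`, respectively `p(⌈log₂ M⌉)`. -/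
def DepthAtMost (p : Polynomial ℕ) : Prop :=
  (∀ j, (S.colCircuit j).depth ≤ p.eval (qubits S.N)) ∧
  (∀ j, (S.rowCircuit j).depth ≤ p.eval (qubits S.M)) ∧
  S.rhsCircuit.depth ≤ p.eval (qubits S.N)

/-- The data qubits of the quantum device: a register for `ℂ^N` and a register for `ℂ^M`. -/
abbrev Wire : Type := Fin (qubits S.N) ⊕ Fin (qubits S.M)

/-- The input circuits, numbered `0, …, R-1` for the columns of `A₁`, `R, …, 2R-1` for the rows of
`A₂`, and `2R` for `b`, as lists of elementary gates on the data qubits. Other numbers stand for the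
empty circuit. -/
def inputGates (c : ℕ) : List (Gate S.Wire) :=
  if h₁ : c < S.R then (S.colCircuit ⟨c, h₁⟩).gates.map (Gate.map Function.Embedding.inl)
  else if h₂ : c - S.R < S.R then
    (S.rowCircuit ⟨c - S.R, h₂⟩).gates.map (Gate.map Function.Embedding.inr)
  else if c = 2 * S.R then S.rhsCircuit.gates.map (Gate.map Function.Embedding.inl)
  else []

end FactorizedSystem

/-- The condition number: the ratio of the largest to the smallest nonzero singular value, which is
`‖A‖ ‖A⁻¹‖` for the pseudo-inverse `A⁻¹`. For matrices of full rank no singular value is zero. -/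
def condNumber {m n : ℕ} (A : Matrix (Fin m) (Fin n) ℂ) : ℝ :=
  (Matrix.toEuclideanLin A).singularValues 0 /
    (Matrix.toEuclideanLin A).singularValues (A.rank - 1)

/-! ### Hybrid quantum-classical machine

A classical random access machine with natural-number variables and two-dimensional arrays of
complex numbers, coupled to a quantum device with one ancilla qubit and the data qubits. Every
instruction and every test takes one unit of time; in particular, each elementary gate, each
measurement and each arithmetic operation does. -/

/-- The array entry `array[row, col]`; `row` and `col` are names of natural-number variables. -/
structure Ref : Type where
  array : ℕ
  row : ℕ
  col : ℕ

/-- The arithmetic operations of the machine (division by zero gives zero). -/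
inductive Op : Type
  | add | sub | mul | div

/-- Elementary instructions; `x`, `y`, `z` are names of natural-number variables. -/
inductive Instr : Type
  /-- `x := k` -/
  | natConst (x k : ℕ)
  /-- `x := y + z` -/
  | natAdd (x y z : ℕ)
  /-- `x := y - z`, truncated at zero -/
  | natSub (x y z : ℕ)
  /-- `d := k` for an integer constant `k` -/
  | intConst (d : Ref) (k : ℤ)
  /-- `d := i`, the imaginary unit -/
  | imagUnit (d : Ref)
  /-- `d := x` -/
  | ofNat (d : Ref) (x : ℕ)
  /-- `d := s₁ op s₂` -/
  | arith (op : Op) (d s₁ s₂ : Ref)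
  /-- `d := ` the complex conjugate of `s` -/
  | conj (d s : Ref)
  /-- `x := ` the number of elementary gates of the input circuit with number `y` -/
  | size (x y : ℕ)
  /-- Hadamard gate on the ancilla -/
  | hadamard
  /-- phase gate `diag(1, i)` on the ancilla -/
  | phase
  /-- NOT gate on the ancilla -/
  | flip
  /-- the `y`-th elementary gate (counted from zero) of the input circuit with number `x`, applied
  to the data qubits and controlled by the ancilla; nothing if there is no such gate -/
  | ctrl (x y : ℕ)
  /-- measure the ancilla in the computational basis, store the outcome in `x`, and reset all
  qubits to `|0⟩` -/
  | measure (x : ℕ)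

/-- Tests for branching and looping. -/
inductive Test : Type
  /-- `x < y` for natural-number variables -/
  | natLt (x y : ℕ)
  /-- `Re s₁ ≤ Re s₂` -/
  | reLe (s₁ s₂ : Ref)

/-- Programs. -/
inductive Program : Type
  | instr (i : Instr)
  | seq (P Q : Program)
  | branch (t : Test) (P Q : Program)
  | loop (t : Test) (P : Program)

/-- The memory contents of the machine together with the state of its quantum device;
`q a z` is the amplitude at ancilla value `a` and data value `z`. -/
structure Store (W : Type) : Type where
  nat : ℕ → ℕ
  num : ℕ → ℕ → ℕ → ℂ
  q : Bool → QState W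

namespace Store

variable {W : Type}

/-- Value of an array entry. -/
def get (σ : Store W) (r : Ref) : ℂ := σ.num r.array (σ.nat r.row) (σ.nat r.col)

/-- Assignment to a natural-number variable. -/
def setNat (σ : Store W) (x k : ℕ) : Store W := { σ with nat := Function.update σ.nat x k }

/-- Assignment to an array entry. -/
def set (σ : Store W) (r : Ref) (c : ℂ) : Store W :=
  { σ with num := fun a i j =>
      if a = r.array ∧ i = σ.nat r.row ∧ j = σ.nat r.col then c else σ.num a i j }

end Store

/-- All qubits of the device, including the ancilla, in state `|0⟩`. -/
def deviceZero (W : Type) [Fintype W] : Bool → QState W :=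
  fun a => if a then 0 else zeroState W

/-- Born probability of the outcome `1` when the ancilla is measured. (The state is a unit vector at
all times, since it starts as one and changes by unitary gates and resets; the minimum is only
there to make the definition total.) -/
def probOne {W : Type} [Fintype W] [DecidableEq W] (q : Bool → QState W) : ENNReal :=
  min 1 (ENNReal.ofReal (∑ z : W → Bool, ‖q true z‖ ^ 2))

/-- The distribution of the outcome when the ancilla is measured. -/
def outcome {W : Type} [Fintype W] [DecidableEq W] (q : Bool → QState W) : PMF Bool :=
  PMF.ofFintype (fun a => if a then probOne q else 1 - probOne q) (by
    have h : probOne q ≤ 1 := min_le_left _ _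
    simp [add_tsub_cancel_of_le h])

/-- Result of an arithmetic operation. -/
def Op.eval : Op → ℂ → ℂ → ℂ
  | .add, a, c => a + c
  | .sub, a, c => a - c
  | .mul, a, c => a * c
  | .div, a, c => a / c

/-- Truth value of a test. -/
def Test.Holds {W : Type} (σ : Store W) : Test → Prop
  | .natLt x y => σ.nat x < σ.nat y
  | .reLe s₁ s₂ => (σ.get s₁).re ≤ (σ.get s₂).re

/-- Execution of an elementary instruction on a machine that holds the input circuits of `S`. -/
def exec (S : FactorizedSystem) (σ : Store S.Wire) : Instr → PMF (Store S.Wire)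
  | .natConst x k => PMF.pure (σ.setNat x k)
  | .natAdd x y z => PMF.pure (σ.setNat x (σ.nat y + σ.nat z))
  | .natSub x y z => PMF.pure (σ.setNat x (σ.nat y - σ.nat z))
  | .intConst d k => PMF.pure (σ.set d (k : ℂ))
  | .imagUnit d => PMF.pure (σ.set d Complex.I)
  | .ofNat d x => PMF.pure (σ.set d (σ.nat x : ℂ))
  | .arith op d s₁ s₂ => PMF.pure (σ.set d (op.eval (σ.get s₁) (σ.get s₂)))
  | .conj d s => PMF.pure (σ.set d (star (σ.get s)))
  | .size x y => PMF.pure (σ.setNat x (S.inputGates (σ.nat y)).length)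
  | .hadamard => PMF.pure { σ with q := fun a z =>
      (σ.q false z + (if a then -1 else 1) * σ.q true z) / (Real.sqrt 2 : ℂ) }
  | .phase => PMF.pure { σ with q := fun a z => (if a then Complex.I else 1) * σ.q a z }
  | .flip => PMF.pure { σ with q := fun a => σ.q (!a) }
  | .ctrl x y => PMF.pure { σ with q := fun a =>
      match a, (S.inputGates (σ.nat x))[σ.nat y]? with
      | true, some g => g.apply (σ.q true)
      | _, _ => σ.q a }
  | .measure x => (outcome σ.q).map fun a =>
      { σ.setNat x (if a then 1 else 0) with q := deviceZero S.Wire }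

/-- A configuration: the programs still to be executed, in order, and the store. -/
structure Config (W : Type) : Type where
  todo : List Program
  store : Store W

open scoped Classical in
/-- One time step. A configuration with nothing left to execute has halted. -/
def step (S : FactorizedSystem) : Config S.Wire → PMF (Config S.Wire)
  | ⟨[], σ⟩ => PMF.pure ⟨[], σ⟩
  | ⟨.instr i :: K, σ⟩ => (exec S σ i).map fun σ' => ⟨K, σ'⟩
  | ⟨.seq P Q :: K, σ⟩ => PMF.pure ⟨P :: Q :: K, σ⟩
  | ⟨.branch t P Q :: K, σ⟩ => PMF.pure ⟨(if t.Holds σ then P else Q) :: K, σ⟩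
  | ⟨.loop t P :: K, σ⟩ => PMF.pure ⟨if t.Holds σ then P :: .loop t P :: K else K, σ⟩

/-- The distribution of the configuration after `T` time steps. -/
def run (S : FactorizedSystem) : ℕ → Config S.Wire → PMF (Config S.Wire)
  | 0, c => PMF.pure c
  | T + 1, c => (step S c).bind (run S T)

/-- The initial memory: the natural-number variables `0`, `1`, `2` hold `R`, `N`, `M`; array `0` holds
the norms `‖u_j‖`, array `1` the norms `‖v_j‖`, array `2` the norm `‖b‖`, and array `3` the accuracy
`ε` (in column `0`, from row `0` on). Everything else is zero. -/
def startStore (S : FactorizedSystem) (ε : ℝ) : Store S.Wire where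
  nat := fun x => if x = 0 then S.R else if x = 1 then S.N else if x = 2 then S.M else 0
  num := fun a i j =>
    if j ≠ 0 then 0
    else if a = 0 then (if h : i < S.R then (S.colNorm ⟨i, h⟩ : ℂ) else 0)
    else if a = 1 then (if h : i < S.R then (S.rowNorm ⟨i, h⟩ : ℂ) else 0)
    else if a = 2 then (if i = 0 then (S.rhsNorm : ℂ) else 0)
    else if a = 3 then (if i = 0 then (ε : ℂ) else 0)
    else 0
  q := deviceZero S.Wire

/-- The output `(s_1, …, s_R)` is read off column `0` of array `4`. -/
def readOutput (S : FactorizedSystem) (σ : Store S.Wire) : Fin S.R → ℂ := fun j => σ.num 4 j 0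

/-- The probability that the program, started on the input `S`, `ε`, halts within `T` time steps with
an output `s` for which `∑ j, s_j |v_j⟩` solves the least squares problem up to `ε`. -/
def successProb (P : Program) (S : FactorizedSystem) (ε : ℝ) (T : ℕ) : ENNReal :=
  (run S T ⟨[P], startStore S ε⟩).toOuterMeasure
    {c | c.todo = [] ∧ S.IsSolution ε (readOutput S c.store)}

end HybridLS

end

noncomputable section

namespace HybridLS

/-! ### A program logic for failure probabilities. -/

section

/-! ### Failure probabilities -/

/-! Let U and V be the matrices with columns |u_j⟩ and |v_j⟩, and d_j = ‖u_j‖‖v_j‖. For x̂ = V s one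
has A x̂ = U diag(d) V*V s. If w solves the normal equations U*U w = U*b, then U w is the projection
of b onto the range of U, which contains the range of A. So any s for which V*V s is close enough to
diag(d)⁻¹ w has a nearly minimal residual (`isSolution_of_close`). The quantum device only has to
supply U*U, V*V and U*b/‖b‖. Their entries are overlaps of input states, and a Hadamard test gives a
±1 sample whose mean is the real part, or up to sign the imaginary part, of one overlap.

Sampling. The estimates must be accurate in spectral norm. About R/t² samples per entry suffice for
the error t: a net of at most 25^R vectors on each side detects the norm (`l2_opNorm_le_of_net`),
for each pair of net vectors the deviation is a sum of centred bounded terms, and exponential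
moments beat the union bound (`tri_estimate`). R² entries with R/t² samples each account for R³. No
independence is formalized. Instead, a sum of exponentials, corrected by a budget for the samples
still to be drawn, is a supermartingale along the program (`pot_step`, `wp_estimate`), and the logic
`WP` carries it as an upper bound for the failure probability.

Calibration. The required t depends on the conditioning, which the program does not know. It doubles
a guess k, estimates the Gram matrix up to 1/(4k) and tests the positivity of E − 1/k and k − E. The
test is an inversion by conjugate directions, which needs field operations only: the pivots of a
positive definite matrix are positive, and positive pivots exhibit a positive semidefinite inverse
(`pivots_pos`, `qform_nonneg_of_pivots`). With about K R k³ samples per entry the round for k fails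
with probability at most δ/k, which is summable, while the costs grow geometrically. Normalizing the
columns of a matrix of condition number κ gives a Gram matrix with spectrum in [κ⁻², κ²]
(`normalized_columns`), so k stays below 4κ².

Accuracy. By `isSolution_of_estimates`, t = 1/(16y) suffices for y = ku kv D E (‖b‖+ε)/ε, where ku,
kv are the calibrated numbers and D, E the maxima of d_j and 1/d_j. Since D E ≤ κ₁κ₂ =: κ, the
number of samples is of order R κ⁶ ((‖b‖+ε)/ε)². Finally c ≤ ‖A‖ ≤ κΓ (`norm_A_le`) trades κ⁶ for
Γ²κ⁸/c², and the cost of a single sample is polynomial in the numbers of qubits. -/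

/-- The set of configurations that have not halted with a store in `Good`. -/
def badSet {W : Type} (Good : Set (Store W)) : Set (Config W) :=
  {c | ¬ (c.todo = [] ∧ c.store ∈ Good)}

/-- The probability of not having halted in `Good` after `T` steps, as an extended real. -/
def failENN (S : FactorizedSystem) (Good : Set (Store S.Wire)) (T : ℕ) (c : Config S.Wire) :
    ENNReal :=
  (run S T c).toOuterMeasure (badSet Good)

/-- The probability of not having halted in `Good` after `T` steps. -/
def failProb (S : FactorizedSystem) (Good : Set (Store S.Wire)) (T : ℕ) (c : Config S.Wire) : ℝ :=
  (failENN S Good T c).toReal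

variable {S : FactorizedSystem} {Good : Set (Store S.Wire)}

lemma toOuterMeasure_le_one {α : Type*} (p : PMF α) (s : Set α) : p.toOuterMeasure s ≤ 1 := by
  rw [PMF.toOuterMeasure_apply, ← p.tsum_coe]
  exact ENNReal.tsum_le_tsum fun a => Set.indicator_le_self' (fun _ _ => zero_le) a

lemma failENN_le_one (T : ℕ) (c : Config S.Wire) : failENN S Good T c ≤ 1 :=
  toOuterMeasure_le_one _ _

lemma failENN_ne_top (T : ℕ) (c : Config S.Wire) : failENN S Good T c ≠ ⊤ :=
  ne_top_of_le_ne_top ENNReal.one_ne_top (failENN_le_one T c)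

lemma failProb_le_one (T : ℕ) (c : Config S.Wire) : failProb S Good T c ≤ 1 :=
  ENNReal.toReal_le_of_le_ofReal zero_le_one (by simpa using failENN_le_one T c)

lemma failENN_succ (T : ℕ) (c : Config S.Wire) :
    failENN S Good (T + 1) c = ∑' a, step S c a * failENN S Good T a := by
  simp [failENN, run, PMF.toOuterMeasure_bind_apply]

/-- A halted configuration is a fixed point of `step`, so success persists once reached; the general
case follows by conditioning on the first step. -/
lemma failENN_succ_le (T : ℕ) (c : Config S.Wire) :
    failENN S Good (T + 1) c ≤ failENN S Good T c := by
  induction T generalizing c with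
  | zero =>
    by_cases h : c ∈ badSet Good
    · have : failENN S Good 0 c = 1 := by
        simp [failENN, run, PMF.toOuterMeasure_pure_apply, h]
      rw [this]; exact failENN_le_one _ _
    · obtain ⟨K, σ⟩ := c
      obtain ⟨h1, -⟩ := not_not.1 h
      obtain rfl : K = [] := h1
      simp [failENN, run, step]
  | succ T ih =>
    rw [failENN_succ, failENN_succ]
    exact ENNReal.tsum_le_tsum fun a => mul_le_mul_right (ih a) _

/-- This is what allows all time bounds below to be mere upper bounds, rounded up at will. -/
lemma failProb_antitone (c : Config S.Wire) : Antitone fun T => failProb S Good T c :=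
  antitone_nat_of_succ_le fun T =>
    ENNReal.toReal_mono (failENN_ne_top _ _) (failENN_succ_le T c)

lemma failProb_of_step_pure {c c' : Config S.Wire} (h : step S c = PMF.pure c') (T : ℕ) :
    failProb S Good (T + 1) c = failProb S Good T c' := by
  simp [failProb, failENN, run, h, PMF.pure_bind]

/-- The store after a measurement with outcome `a` stored in `x`. -/
def afterMeasure (σ : Store S.Wire) (x : ℕ) (a : Bool) : Store S.Wire :=
  { σ.setNat x (if a then 1 else 0) with q := deviceZero S.Wire }

/-- Measurements are the only random instructions, so this convex combination is the only way in
which probabilities enter the logic. -/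
lemma failProb_measure (σ : Store S.Wire) (x : ℕ) (K : List Program) (T : ℕ) :
    failProb S Good (T + 1) ⟨.instr (.measure x) :: K, σ⟩ =
      (1 - (probOne σ.q).toReal) * failProb S Good T ⟨K, afterMeasure σ x false⟩ +
        (probOne σ.q).toReal * failProb S Good T ⟨K, afterMeasure σ x true⟩ := by
  have h1 : probOne σ.q ≤ 1 := min_le_left _ _
  have h2 : probOne σ.q ≠ ⊤ := ne_top_of_le_ne_top ENNReal.one_ne_top h1
  have key : failENN S Good (T + 1) ⟨.instr (.measure x) :: K, σ⟩ =
      (1 - probOne σ.q) * failENN S Good T ⟨K, afterMeasure σ x false⟩ +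
        probOne σ.q * failENN S Good T ⟨K, afterMeasure σ x true⟩ := by
    have hs : step S ⟨.instr (.measure x) :: K, σ⟩ =
        (outcome σ.q).bind fun a => PMF.pure ⟨K, afterMeasure σ x a⟩ := by
      simp only [step, exec, PMF.map_comp]
      rfl
    simp only [failENN, run, hs, PMF.bind_bind, PMF.pure_bind]
    rw [PMF.toOuterMeasure_bind_apply, tsum_fintype, Fintype.sum_bool]
    simp [outcome, PMF.ofFintype_apply, add_comm]
  have ht : ∀ T (c : Config S.Wire), failENN S Good T c ≠ ⊤ := failENN_ne_top
  simp only [failProb]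
  rw [key, ENNReal.toReal_add (ENNReal.mul_ne_top (by simp) (ht _ _))
    (ENNReal.mul_ne_top h2 (ht _ _)), ENNReal.toReal_mul, ENNReal.toReal_mul,
    ENNReal.toReal_sub_of_le h1 ENNReal.one_ne_top, ENNReal.toReal_one]

/-! ### Deterministic runs -/

/-- `P` started in `σ` takes at most `t` steps and ends in `σ'`. -/
def Runs (P : Program) (σ : Store S.Wire) (t : ℕ) (σ' : Store S.Wire) : Prop :=
  ∀ (Good : Set (Store S.Wire)) (K : List Program) (T : ℕ),
    failProb S Good (T + t) ⟨P :: K, σ⟩ ≤ failProb S Good T ⟨K, σ'⟩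

lemma Runs.mono {P : Program} {σ σ' : Store S.Wire} {t t' : ℕ} (h : Runs P σ t σ') (ht : t ≤ t') :
    Runs P σ t' σ' := fun Good K T =>
  (failProb_antitone _ (by omega : T + t ≤ T + t')).trans (h Good K T)

lemma Runs.of_step {P : Program} {σ σ' : Store S.Wire}
    (h : ∀ K, step S ⟨P :: K, σ⟩ = PMF.pure ⟨K, σ'⟩) : Runs P σ 1 σ' := fun _ K T =>
  (failProb_of_step_pure (h K) T).le

/-- The effect of the instructions other than measurements. -/
def execDet (S : FactorizedSystem) (σ : Store S.Wire) : Instr → Store S.Wire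
  | .natConst x k => σ.setNat x k
  | .natAdd x y z => σ.setNat x (σ.nat y + σ.nat z)
  | .natSub x y z => σ.setNat x (σ.nat y - σ.nat z)
  | .intConst d k => σ.set d (k : ℂ)
  | .imagUnit d => σ.set d Complex.I
  | .ofNat d x => σ.set d (σ.nat x : ℂ)
  | .arith op d s₁ s₂ => σ.set d (op.eval (σ.get s₁) (σ.get s₂))
  | .conj d s => σ.set d (star (σ.get s))
  | .size x y => σ.setNat x (S.inputGates (σ.nat y)).length
  | .hadamard => { σ with q := fun a z =>
      (σ.q false z + (if a then -1 else 1) * σ.q true z) / (Real.sqrt 2 : ℂ) }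
  | .phase => { σ with q := fun a z => (if a then Complex.I else 1) * σ.q a z }
  | .flip => { σ with q := fun a => σ.q (!a) }
  | .ctrl x y => { σ with q := fun a =>
      match a, (S.inputGates (σ.nat x))[σ.nat y]? with
      | true, some g => g.apply (σ.q true)
      | _, _ => σ.q a }
  | .measure _ => σ

/-- The instruction is not a measurement. -/
def Instr.IsDet : Instr → Prop
  | .measure _ => False
  | _ => True

lemma exec_eq_pure (σ : Store S.Wire) {i : Instr} (h : i.IsDet) :
    exec S σ i = PMF.pure (execDet S σ i) := by
  cases i <;> first | rfl | exact h.elim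

lemma Runs.instr (σ : Store S.Wire) {i : Instr} (h : i.IsDet) :
    Runs (.instr i) σ 1 (execDet S σ i) :=
  Runs.of_step fun K => by simp [step, exec_eq_pure σ h, PMF.pure_map]

lemma Runs.seq {P Q : Program} {σ σ₁ σ₂ : Store S.Wire} {t₁ t₂ : ℕ} (h₁ : Runs P σ t₁ σ₁)
    (h₂ : Runs Q σ₁ t₂ σ₂) : Runs (.seq P Q) σ (t₁ + t₂ + 1) σ₂ := fun Good K T => by
  rw [show T + (t₁ + t₂ + 1) = (T + t₂ + t₁) + 1 by ring, failProb_of_step_pure (by rfl)]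
  exact (h₁ Good _ _).trans (h₂ Good K T)

lemma Runs.branch_pos {t : Test} {P Q : Program} {σ σ' : Store S.Wire} {n : ℕ} (ht : t.Holds σ)
    (h : Runs P σ n σ') : Runs (.branch t P Q) σ (n + 1) σ' := fun Good K T => by
  rw [← add_assoc, failProb_of_step_pure (c' := ⟨P :: K, σ⟩) (by simp [step, ht])]
  exact h Good K T

lemma Runs.branch_neg {t : Test} {P Q : Program} {σ σ' : Store S.Wire} {n : ℕ} (ht : ¬ t.Holds σ)
    (h : Runs Q σ n σ') : Runs (.branch t P Q) σ (n + 1) σ' := fun Good K T => by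
  rw [← add_assoc, failProb_of_step_pure (c' := ⟨Q :: K, σ⟩) (by simp [step, ht])]
  exact h Good K T

lemma Runs.loop_done {t : Test} {P : Program} {σ : Store S.Wire} (ht : ¬ t.Holds σ) :
    Runs (.loop t P) σ 1 σ :=
  Runs.of_step fun K => by simp [step, ht]

lemma failProb_loop {t : Test} {P : Program} {σ : Store S.Wire} (ht : t.Holds σ)
    (K : List Program) (T : ℕ) :
    failProb S Good (T + 1) ⟨.loop t P :: K, σ⟩ = failProb S Good T ⟨P :: .loop t P :: K, σ⟩ :=
  failProb_of_step_pure (by simp [step, ht]) T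

lemma Runs.loop_step {t : Test} {P : Program} {σ σ₁ σ₂ : Store S.Wire} {t₁ t₂ : ℕ}
    (ht : t.Holds σ) (h₁ : Runs P σ t₁ σ₁) (h₂ : Runs (.loop t P) σ₁ t₂ σ₂) :
    Runs (.loop t P) σ (t₁ + t₂ + 1) σ₂ := fun Good K T => by
  rw [show T + (t₁ + t₂ + 1) = (T + t₂ + t₁) + 1 by ring, failProb_loop ht]
  exact (h₁ Good _ _).trans (h₂ Good K T)

/-- Sequential composition of `P` and a list of programs. -/
def seqs : Program → List Program → Program
  | P, [] => P
  | P, Q :: l => .seq P (seqs Q l)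

/-- A block of instructions. -/
def block (i : Instr) (l : List Instr) : Program := seqs (.instr i) (l.map .instr)

lemma Runs.block (σ : Store S.Wire) (i : Instr) (l : List Instr) (h : ∀ j ∈ i :: l, j.IsDet) :
    Runs (block i l) σ (2 * l.length + 1) ((i :: l).foldl (execDet S) σ) := by
  induction l generalizing i σ with
  | nil => exact Runs.instr σ (h i (by simp))
  | cons j l ih =>
    refine (Runs.seq (Runs.instr σ (h i (by simp)))
      (ih (execDet S σ i) j fun j' hj' => h j' (by simp_all))).mono ?_
    simp only [List.length_cons]; omega

/-- `x := 0; while x < y do (body; x := x + 1)`; the variable `4` holds the constant one. -/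
def forLoop (x y : ℕ) (body : Program) : Program :=
  .seq (.instr (.natConst x 0))
    (.loop (.natLt x y) (.seq body (.instr (.natAdd x x 4))))

/-- The invariant at `i` refers to a store whose counter already holds `i`, so the body has to
establish it for the store after the increment. The `3` in each round pays for the test, the
sequencing step and the increment. -/
lemma Runs.forLoop {x y n tb : ℕ} {body : Program} {σ : Store S.Wire} (I : ℕ → Store S.Wire → Prop)
    (h0 : I 0 (σ.setNat x 0))
    (hI : ∀ i τ, I i τ → τ.nat x = i ∧ τ.nat y = n)
    (hstep : ∀ i τ, i < n → I i τ →
      ∃ τ', Runs body τ tb τ' ∧ τ'.nat 4 = 1 ∧ τ'.nat x = i ∧ I (i + 1) (τ'.setNat x (i + 1))) :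
    ∃ σ', Runs (forLoop x y body) σ (n * (tb + 3) + 3) σ' ∧ I n σ' := by
  have key : ∀ m i τ, i + m = n → I i τ →
      ∃ σ', Runs (.loop (.natLt x y) (.seq body (.instr (.natAdd x x 4)))) τ (m * (tb + 3) + 1) σ' ∧
        I n σ' := by
    intro m
    induction m with
    | zero =>
      intro i τ him hi
      obtain ⟨h1, h2⟩ := hI i τ hi
      refine ⟨τ, ?_, by rwa [show n = i by omega]⟩
      simpa using Runs.loop_done (P := .seq body (.instr (.natAdd x x 4)))
        (show ¬ Test.Holds τ (.natLt x y) by simp only [Test.Holds]; omega)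
    | succ m ih =>
      intro i τ him hi
      obtain ⟨h1, h2⟩ := hI i τ hi
      obtain ⟨τ', hr, h4, hx, hi'⟩ := hstep i τ (by omega) hi
      obtain ⟨σ', hr', hn⟩ := ih (i + 1) _ (by omega) hi'
      refine ⟨σ', ?_, hn⟩
      have e : τ'.setNat x (i + 1) = execDet S τ' (.natAdd x x 4) := by
        simp [execDet, hx, h4]
      rw [e] at hr'
      refine (Runs.loop_step (by simp only [Test.Holds]; omega)
        (hr.seq (Runs.instr τ' (i := .natAdd x x 4) trivial)) hr').mono ?_
      ring_nf; omega
  obtain ⟨σ', hr, hn⟩ := key n 0 _ (by omega) h0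
  exact ⟨σ', (Runs.seq (Runs.instr σ (i := .natConst x 0) trivial) hr).mono (by omega), hn⟩

/-! ### Randomized runs -/

/-- If, after `P` ends in a store that satisfies `Post`, the remaining computation fails with
probability at most `Q`, then the computation from `σ` fails with probability at most `φ`. -/
def WP (P : Program) (σ : Store S.Wire) (t : ℕ) (Post : Store S.Wire → Prop)
    (Q : Store S.Wire → ℝ) (φ : ℝ) : Prop :=
  ∀ (Good : Set (Store S.Wire)) (K : List Program) (T : ℕ),
    (∀ σ', Post σ' → failProb S Good T ⟨K, σ'⟩ ≤ Q σ') →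
      failProb S Good (T + t) ⟨P :: K, σ⟩ ≤ φ

lemma WP.mono {P : Program} {σ : Store S.Wire} {t t' : ℕ} {Post Post' : Store S.Wire → Prop}
    {Q Q' : Store S.Wire → ℝ} {φ φ' : ℝ} (h : WP P σ t Post Q φ) (ht : t ≤ t')
    (hP : ∀ σ', Post σ' → Post' σ' ∧ Q' σ' ≤ Q σ') (hφ : φ ≤ φ') : WP P σ t' Post' Q' φ' :=
  fun Good K T hK => (failProb_antitone _ (by omega : T + t ≤ T + t')).trans
    ((h Good K T fun σ' h' => (hK σ' (hP σ' h').1).trans (hP σ' h').2).trans hφ)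

lemma Runs.wp {P : Program} {σ σ' : Store S.Wire} {t : ℕ} {Post : Store S.Wire → Prop}
    {Q : Store S.Wire → ℝ} (h : Runs P σ t σ') (hP : Post σ') : WP P σ t Post Q (Q σ') :=
  fun Good K T hK => (h Good K T).trans (hK σ' hP)

/-- `QM` acts as a bound for the conditional failure probability at the midpoint; the rule is the
tower property without conditional expectations. -/
lemma WP.seq {P₁ P₂ : Program} {σ : Store S.Wire} {t₁ t₂ : ℕ} {Mid Post : Store S.Wire → Prop}
    {QM Q : Store S.Wire → ℝ} {φ : ℝ} (h₁ : WP P₁ σ t₁ Mid QM φ)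
    (h₂ : ∀ σ', Mid σ' → WP P₂ σ' t₂ Post Q (QM σ')) :
    WP (.seq P₁ P₂) σ (t₁ + t₂ + 1) Post Q φ := fun Good K T hK => by
  rw [show T + (t₁ + t₂ + 1) = (T + t₂ + t₁) + 1 by ring, failProb_of_step_pure (by rfl)]
  exact h₁ Good _ _ fun σ' hσ' => h₂ σ' hσ' Good K T hK

lemma WP.seq_runs {P₁ P₂ : Program} {σ σ' : Store S.Wire} {t₁ t₂ : ℕ} {Post : Store S.Wire → Prop}
    {Q : Store S.Wire → ℝ} {φ : ℝ} (h₁ : Runs P₁ σ t₁ σ') (h₂ : WP P₂ σ' t₂ Post Q φ) :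
    WP (.seq P₁ P₂) σ (t₁ + t₂ + 1) Post Q φ := fun Good K T hK => by
  rw [show T + (t₁ + t₂ + 1) = (T + t₂ + t₁) + 1 by ring, failProb_of_step_pure (by rfl)]
  exact (h₁ Good _ _).trans (h₂ Good K T hK)

lemma WP.loop_done {t : Test} {P : Program} {σ : Store S.Wire} {Post : Store S.Wire → Prop}
    {Q : Store S.Wire → ℝ} (ht : ¬ t.Holds σ) (hP : Post σ) : WP (.loop t P) σ 1 Post Q (Q σ) :=
  (Runs.loop_done ht).wp hP

lemma WP.loop_step {t : Test} {P : Program} {σ : Store S.Wire} {t₁ t₂ : ℕ}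
    {Mid Post : Store S.Wire → Prop} {QM Q : Store S.Wire → ℝ} {φ : ℝ} (ht : t.Holds σ)
    (h₁ : WP P σ t₁ Mid QM φ) (h₂ : ∀ σ', Mid σ' → WP (.loop t P) σ' t₂ Post Q (QM σ')) :
    WP (.loop t P) σ (t₁ + t₂ + 1) Post Q φ := fun Good K T hK => by
  rw [show T + (t₁ + t₂ + 1) = (T + t₂ + t₁) + 1 by ring, failProb_loop ht]
  exact h₁ Good _ _ fun σ' hσ' => h₂ σ' hσ' Good K T hK

/-- A loop with an invariant and a potential that is a supermartingale, for `m` rounds. -/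
lemma WP.loop {t : Test} {P : Program} {tb n : ℕ} (I : ℕ → Store S.Wire → Prop)
    (Q : ℕ → Store S.Wire → ℝ) (hI : ∀ i τ, I i τ → (t.Holds τ ↔ i < n))
    (hstep : ∀ i τ, i < n → I i τ → WP P τ tb (I (i + 1)) (Q (i + 1)) (Q i τ)) :
    ∀ m i τ, i + m = n → I i τ → WP (.loop t P) τ (m * (tb + 1) + 1) (I n) (Q n) (Q i τ) := by
  intro m
  induction m with
  | zero =>
    intro i τ him hi
    obtain rfl : i = n := by omega
    simpa using WP.loop_done (P := P) (by rw [hI i τ hi]; omega) hi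
  | succ m ih =>
    intro i τ him hi
    refine (WP.loop_step (by rw [hI i τ hi]; omega) (hstep i τ (by omega) hi)
      fun σ' hσ' => ih (i + 1) σ' (by omega) hσ').mono ?_ (fun σ' h => ⟨h, le_rfl⟩) le_rfl
    ring_nf; omega

lemma WP.forLoop {x y n tb : ℕ} {body : Program} {σ : Store S.Wire} (I : ℕ → Store S.Wire → Prop)
    (Q : ℕ → Store S.Wire → ℝ) (h0 : I 0 (σ.setNat x 0))
    (hI : ∀ i τ, I i τ → τ.nat x = i ∧ τ.nat y = n)
    (hstep : ∀ i τ, i < n → I i τ →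
      WP body τ tb (fun τ' => τ'.nat 4 = 1 ∧ τ'.nat x = i ∧ I (i + 1) (τ'.setNat x (i + 1)))
        (fun τ' => Q (i + 1) (τ'.setNat x (i + 1))) (Q i τ)) :
    WP (forLoop x y body) σ (n * (tb + 3) + 3) (I n) (Q n) (Q 0 (σ.setNat x 0)) := by
  refine (WP.seq_runs (Runs.instr σ (i := .natConst x 0) trivial)
    (WP.loop (t := .natLt x y) (tb := tb + 2) (n := n) I Q (fun i τ hi => ?_) (fun i τ hin hi => ?_)
      n 0 _ (by omega) h0)).mono (by ring_nf; omega) (fun σ' h => ⟨h, le_rfl⟩) le_rfl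
  · obtain ⟨h1, h2⟩ := hI i τ hi
    simp [Test.Holds, h1, h2]
  · refine (WP.seq (hstep i τ hin hi) fun τ' hτ' => ?_).mono (le_refl (tb + 1 + 1))
      (fun σ' h => ⟨h, le_rfl⟩) le_rfl
    obtain ⟨h4, hx, hi'⟩ := hτ'
    have e : τ'.setNat x (i + 1) = execDet S τ' (.natAdd x x 4) := by
      simp [execDet, hx, h4]
    rw [e] at hi' ⊢
    exact (Runs.instr τ' (i := .natAdd x x 4) trivial).wp hi'

/-- `P` started in `σ` ends within `t` steps in a store satisfying `Post`, except with probability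
at most `η`. -/
def Tri (P : Program) (σ : Store S.Wire) (t : ℕ) (η : ℝ) (Post : Store S.Wire → Prop) : Prop :=
  ∀ φ, 0 ≤ φ → WP P σ t Post (fun _ => φ) (φ + η)

lemma Runs.tri {P : Program} {σ σ' : Store S.Wire} {t : ℕ} {Post : Store S.Wire → Prop}
    (h : Runs P σ t σ') (hP : Post σ') : Tri P σ t 0 Post := fun φ _ => by
  simpa using h.wp (Q := fun _ => φ) hP

lemma Tri.seq {P₁ P₂ : Program} {σ : Store S.Wire} {t₁ t₂ : ℕ} {η₁ η₂ : ℝ}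
    {Mid Post : Store S.Wire → Prop} (h₁ : Tri P₁ σ t₁ η₁ Mid) (hη : 0 ≤ η₂)
    (h₂ : ∀ σ', Mid σ' → Tri P₂ σ' t₂ η₂ Post) :
    Tri (.seq P₁ P₂) σ (t₁ + t₂ + 1) (η₁ + η₂) Post := fun φ hφ =>
  (WP.seq (h₁ (φ + η₂) (by positivity)) fun σ' hσ' => h₂ σ' hσ' φ hφ).mono le_rfl
    (fun σ' h => ⟨h, le_rfl⟩) (by linarith)

lemma Tri.mono {P : Program} {σ : Store S.Wire} {t t' : ℕ} {η η' : ℝ}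
    {Post Post' : Store S.Wire → Prop} (h : Tri P σ t η Post) (ht : t ≤ t') (hη : η ≤ η')
    (hP : ∀ σ', Post σ' → Post' σ') : Tri P σ t' η' Post' := fun φ hφ =>
  (h φ hφ).mono ht (fun σ' h' => ⟨hP σ' h', le_rfl⟩) (by linarith)

lemma Tri.seq_runs {P₁ P₂ : Program} {σ σ' : Store S.Wire} {t₁ t₂ : ℕ} {η : ℝ}
    {Post : Store S.Wire → Prop} (h₁ : Runs P₁ σ t₁ σ') (h₂ : Tri P₂ σ' t₂ η Post) :
    Tri (.seq P₁ P₂) σ (t₁ + t₂ + 1) η Post := fun φ hφ => WP.seq_runs h₁ (h₂ φ hφ)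

lemma successProb_of_tri {P : Program} {ε δ : ℝ} {T : ℕ} (hδ0 : 0 ≤ δ)
    (h : Tri P (startStore S ε) T δ fun σ => S.IsSolution ε (readOutput S σ)) :
    ENNReal.ofReal (1 - δ) ≤ successProb P S ε T := by
  -- Empty continuation and no time left: a store satisfying the postcondition has succeeded
  -- already, so the remaining failure is `0`.
  have h1 := h 0 le_rfl {σ | S.IsSolution ε (readOutput S σ)} [] 0 fun σ' hσ' => by
    simp [failProb, failENN, run, badSet, PMF.toOuterMeasure_pure_apply, hσ']
  simp only [zero_add, failProb, failENN] at h1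
  set p := run S T ⟨[P], startStore S ε⟩ with hp
  set B := badSet {σ | S.IsSolution ε (readOutput S σ)} with hB
  have h2 : p.toOuterMeasure B ≤ ENNReal.ofReal δ :=
    (ENNReal.ofReal_toReal (ne_top_of_le_ne_top ENNReal.one_ne_top
      (toOuterMeasure_le_one p B))).symm.le.trans (ENNReal.ofReal_le_ofReal h1)
  have h3 : (1 : ENNReal) ≤ p.toOuterMeasure Bᶜ + p.toOuterMeasure B := by
    have := MeasureTheory.measure_union_le (μ := p.toOuterMeasure) Bᶜ B
    rw [Set.compl_union_self] at this
    refine le_trans (le_of_eq ?_) this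
    rw [PMF.toOuterMeasure_apply]; simp
  have h4 : successProb P S ε T = p.toOuterMeasure Bᶜ := by
    have : Bᶜ = {c | c.todo = [] ∧ S.IsSolution ε (readOutput S c.store)} :=
      Set.ext fun c => not_not
    rw [this]; rfl
  rw [h4, ENNReal.ofReal_sub _ hδ0, ENNReal.ofReal_one]
  exact tsub_le_iff_right.2 (h3.trans (by gcongr))

end

/-! ### Unitary evolution, product states, overlaps and gate counts. -/

section

/-! ### Unitarity of circuits -/

/-- The map `(z, c) ↦ (upd z c, get z)` is an involution of `Z × C`, so each point is counted `card
C` times. -/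
lemma sum_update_sum {Z C : Type*} [Fintype Z] [Fintype C] (get : Z → C) (upd : Z → C → Z)
    (h1 : ∀ z c, get (upd z c) = c) (h2 : ∀ z c c', upd (upd z c) c' = upd z c')
    (h3 : ∀ z, upd z (get z) = z) (f : Z → ℝ) :
    ∑ z, ∑ c, f (upd z c) = Fintype.card C * ∑ z, f z := by
  let e : Z × C ≃ Z × C :=
    { toFun := fun x => (upd x.1 x.2, get x.1)
      invFun := fun x => (upd x.1 x.2, get x.1)
      left_inv := fun x => by simp [h1, h2, h3]
      right_inv := fun x => by simp [h1, h2, h3] }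
  calc ∑ z, ∑ c, f (upd z c) = ∑ x : Z × C, f (e x).1 := by
        rw [Fintype.sum_prod_type]; rfl
    _ = ∑ x : Z × C, f x.1 := Equiv.sum_comp e fun x => f x.1
    _ = _ := by rw [Fintype.sum_prod_type]; simp [Finset.mul_sum]

lemma sum_norm_sq_eq {ι : Type*} [Fintype ι] (x : ι → ℂ) :
    ((∑ a, ‖x a‖ ^ 2 : ℝ) : ℂ) = star x ⬝ᵥ x := by
  simp only [dotProduct, Pi.star_apply, Complex.ofReal_sum]
  exact Finset.sum_congr rfl fun a _ => by
    rw [RCLike.star_def, Complex.conj_mul']; push_cast; rfl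

lemma sum_norm_sq_unitary {C : Type*} [Fintype C] [DecidableEq C]
    (u : Matrix.unitaryGroup C ℂ) (x : C → ℂ) :
    ∑ c, ‖∑ a, u.1 c a * x a‖ ^ 2 = ∑ a, ‖x a‖ ^ 2 := by
  have h : (∑ c, ‖(u.1 *ᵥ x) c‖ ^ 2) = ∑ a, ‖x a‖ ^ 2 := by
    apply Complex.ofReal_injective
    rw [sum_norm_sq_eq, sum_norm_sq_eq, Matrix.star_mulVec, ← Matrix.dotProduct_mulVec,
      Matrix.mulVec_mulVec, ← Matrix.star_eq_conjTranspose, Matrix.UnitaryGroup.star_mul_self,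
      Matrix.one_mulVec]
  exact h

/-- On each orbit `{upd z c | c}` the gate acts as the unitary `u`. Summing over the orbits of all
`z` counts every point `card C` times on both sides, and the factor cancels. One- and two-qubit
gates are both instances. -/
lemma sum_norm_sq_lens {Z C : Type*} [Fintype Z] [Fintype C] [DecidableEq C] [Nonempty C]
    (get : Z → C) (upd : Z → C → Z)
    (h1 : ∀ z c, get (upd z c) = c) (h2 : ∀ z c c', upd (upd z c) c' = upd z c')
    (h3 : ∀ z, upd z (get z) = z) (u : Matrix.unitaryGroup C ℂ) (ψ : Z → ℂ) :
    ∑ z, ‖∑ a, u.1 (get z) a * ψ (upd z a)‖ ^ 2 = ∑ z, ‖ψ z‖ ^ 2 := by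
  have hC : (Fintype.card C : ℝ) ≠ 0 := by simp
  refine mul_left_cancel₀ hC ?_
  rw [← sum_update_sum get upd h1 h2 h3 fun z => ‖∑ a, u.1 (get z) a * ψ (upd z a)‖ ^ 2,
    ← sum_update_sum get upd h1 h2 h3 fun z => ‖ψ z‖ ^ 2]
  refine Finset.sum_congr rfl fun z _ => ?_
  simp only [h1, h2]
  exact sum_norm_sq_unitary u fun a => ψ (upd z a)

lemma Gate.sum_norm_sq_apply {W : Type} [Fintype W] [DecidableEq W] (g : Gate W) (ψ : QState W) :
    ∑ z, ‖g.apply ψ z‖ ^ 2 = ∑ z, ‖ψ z‖ ^ 2 := by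
  cases g with
  | one w u =>
    exact sum_norm_sq_lens (fun z : W → Bool => z w) (fun z a => Function.update z w a)
      (by simp) (by simp) (by simp) u ψ
  | two w₁ w₂ hne u =>
    refine sum_norm_sq_lens (fun z : W → Bool => (z w₁, z w₂))
      (fun z a => Function.update (Function.update z w₁ a.1) w₂ a.2) ?_ ?_ ?_ u ψ
    · rintro z ⟨a, b⟩; simp [hne]
    · rintro z ⟨a, b⟩ ⟨a', b'⟩
      ext w
      by_cases hw2 : w = w₂
      · subst hw2; simp
      · by_cases hw1 : w = w₁
        · subst hw1; simp [hne]
        · simp [Function.update_of_ne, hw1, hw2]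
    · intro z; simp

/-- The state prepared by a list of gates. -/
def gatesOutput {W : Type} [Fintype W] [DecidableEq W] (l : List (Gate W)) : QState W :=
  l.foldl (fun ψ g => g.apply ψ) (zeroState W)

lemma sum_norm_sq_foldl {W : Type} [Fintype W] [DecidableEq W] (l : List (Gate W))
    (ψ : QState W) :
    ∑ z, ‖l.foldl (fun ψ g => g.apply ψ) ψ z‖ ^ 2 = ∑ z, ‖ψ z‖ ^ 2 := by
  induction l generalizing ψ with
  | nil => rfl
  | cons g l ih => rw [List.foldl_cons, ih, g.sum_norm_sq_apply]

lemma sum_norm_sq_gatesOutput {W : Type} [Fintype W] [DecidableEq W] (l : List (Gate W)) :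
    ∑ z, ‖gatesOutput l z‖ ^ 2 = 1 := by
  rw [gatesOutput, sum_norm_sq_foldl]
  simp [zeroState, apply_ite]

/-! ### Circuits on a part of the qubits -/

/-- `χ` is the state of the qubits outside the image of `f`. A relabelled gate does not see them, so
product states remain product states. -/
lemma Gate.map_apply {W W' : Type} [DecidableEq W] [DecidableEq W'] (f : W ↪ W')
    (χ : (W' → Bool) → ℂ) (hχ : ∀ z w a, χ (Function.update z (f w) a) = χ z) (g : Gate W)
    (ψ : QState W) (z : W' → Bool) :
    (g.map f).apply (fun z => ψ (z ∘ f) * χ z) z = g.apply ψ (z ∘ f) * χ z := by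
  cases g with
  | one w u =>
    simp only [Gate.map, Gate.apply, Finset.sum_mul, hχ, Function.comp_apply,
      Function.update_comp_eq_of_injective _ f.injective, mul_assoc]
  | two w₁ w₂ hne u =>
    simp only [Gate.map, Gate.apply, Finset.sum_mul, hχ, Function.comp_apply,
      Function.update_comp_eq_of_injective _ f.injective, mul_assoc]

lemma foldl_map_apply {W W' : Type} [DecidableEq W] [DecidableEq W'] (f : W ↪ W')
    (χ : (W' → Bool) → ℂ) (hχ : ∀ z w a, χ (Function.update z (f w) a) = χ z) (l : List (Gate W))
    (ψ : QState W) :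
    (l.map (Gate.map f)).foldl (fun ψ g => g.apply ψ) (fun z => ψ (z ∘ f) * χ z) =
      fun z => l.foldl (fun ψ g => g.apply ψ) ψ (z ∘ f) * χ z := by
  induction l generalizing ψ with
  | nil => rfl
  | cons g l ih =>
    rw [List.map_cons, List.foldl_cons, List.foldl_cons, ← ih]
    congr 1
    funext z
    exact Gate.map_apply f χ hχ g ψ z

section Sum
variable {A B : Type} [Fintype A] [Fintype B] [DecidableEq A] [DecidableEq B]

/-- A circuit on one register leaves the other in |0…0⟩; that factor disappears from inner products
of two states prepared on the same register. -/
lemma gatesOutput_inl (l : List (Gate A)) :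
    gatesOutput (l.map (Gate.map (Function.Embedding.inl : A ↪ A ⊕ B))) =
      fun z => gatesOutput l (z ∘ Sum.inl) * zeroState B (z ∘ Sum.inr) := by
  have h0 : zeroState (A ⊕ B) = fun z => zeroState A (z ∘ Sum.inl) * zeroState B (z ∘ Sum.inr) := by
    funext z
    have : z = (fun _ => false) ↔ (z ∘ Sum.inl = fun _ => false) ∧ (z ∘ Sum.inr = fun _ => false) := by
      constructor
      · rintro rfl; exact ⟨rfl, rfl⟩
      · rintro ⟨h1, h2⟩; funext w
        rcases w with a | b
        exacts [congrFun h1 a, congrFun h2 b]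
    simp only [zeroState, this, ite_and]
    split_ifs <;> simp
  rw [gatesOutput, h0]
  exact foldl_map_apply Function.Embedding.inl (fun z => zeroState B (z ∘ Sum.inr))
    (fun z w a => by congr 1) l (zeroState A)

lemma gatesOutput_inr (l : List (Gate B)) :
    gatesOutput (l.map (Gate.map (Function.Embedding.inr : B ↪ A ⊕ B))) =
      fun z => gatesOutput l (z ∘ Sum.inr) * zeroState A (z ∘ Sum.inl) := by
  have h0 : zeroState (A ⊕ B) = fun z => zeroState B (z ∘ Sum.inr) * zeroState A (z ∘ Sum.inl) := by
    funext z
    have : z = (fun _ => false) ↔ (z ∘ Sum.inr = fun _ => false) ∧ (z ∘ Sum.inl = fun _ => false) := by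
      constructor
      · rintro rfl; exact ⟨rfl, rfl⟩
      · rintro ⟨h1, h2⟩; funext w
        rcases w with a | b
        exacts [congrFun h2 a, congrFun h1 b]
    simp only [zeroState, this, ite_and]
    split_ifs <;> simp
  rw [gatesOutput, h0]
  exact foldl_map_apply Function.Embedding.inr (fun z => zeroState A (z ∘ Sum.inl))
    (fun z w a => by congr 1) l (zeroState B)

lemma sum_zeroState_mul (f : (B → Bool) → ℂ) : ∑ z, zeroState B z * f z = f fun _ => false := by
  simp [zeroState]

lemma sum_inl (φ ψ : QState A) :
    ∑ z : A ⊕ B → Bool, star (φ (z ∘ Sum.inl) * zeroState B (z ∘ Sum.inr)) *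
      (ψ (z ∘ Sum.inl) * zeroState B (z ∘ Sum.inr)) = ∑ z, star (φ z) * ψ z := by
  rw [← Equiv.sum_comp (Equiv.sumArrowEquivProdArrow A B Bool).symm, Fintype.sum_prod_type]
  refine Finset.sum_congr rfl fun x _ => ?_
  have : ∀ y : B → Bool, star (φ x * zeroState B y) * (ψ x * zeroState B y) =
      zeroState B y * (star (φ x) * ψ x) := by
    intro y; simp only [zeroState]; split_ifs <;> simp
  calc _ = ∑ y : B → Bool, star (φ x * zeroState B y) * (ψ x * zeroState B y) := rfl
    _ = _ := by simp_rw [this]; exact sum_zeroState_mul _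

lemma sum_inr (φ ψ : QState B) :
    ∑ z : A ⊕ B → Bool, star (φ (z ∘ Sum.inr) * zeroState A (z ∘ Sum.inl)) *
      (ψ (z ∘ Sum.inr) * zeroState A (z ∘ Sum.inl)) = ∑ z, star (φ z) * ψ z := by
  rw [← Equiv.sum_comp (Equiv.sumArrowEquivProdArrow A B Bool).symm, Fintype.sum_prod_type_right]
  refine Finset.sum_congr rfl fun x _ => ?_
  have : ∀ y : A → Bool, star (φ x * zeroState A y) * (ψ x * zeroState A y) =
      zeroState A y * (star (φ x) * ψ x) := by
    intro y; simp only [zeroState]; split_ifs <;> simp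
  calc _ = ∑ y : A → Bool, star (φ x * zeroState A y) * (ψ x * zeroState A y) := rfl
    _ = _ := by simp_rw [this]; exact sum_zeroState_mul _

end Sum

/-! ### Overlaps of the input states -/

lemma basisState_injective (N : ℕ) : Function.Injective (basisState (N := N)) := by
  intro i j h
  apply Fin.ext
  apply Nat.eq_of_testBit_eq
  intro q
  by_cases hq : q < qubits N
  · exact congrFun h ⟨q, hq⟩
  · have hN : N ≤ 2 ^ q := (Nat.le_pow_clog one_lt_two N).trans
      (Nat.pow_le_pow_right two_pos (not_lt.1 hq))
    rw [Nat.testBit_lt_two_pow (i.2.trans_le hN), Nat.testBit_lt_two_pow (j.2.trans_le hN)]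

/-- It is enough that one of the two states is supported on the encoded indices. -/
lemma sum_output_eq {N : ℕ} {c c' : Circuit (Fin (qubits N))} (hc : Prepares N c) :
    ∑ z, star (c.output z) * c'.output z = star (prepared c) ⬝ᵥ prepared c' := by
  symm
  refine Fintype.sum_of_injective basisState (basisState_injective N) _ _ (fun z hz => ?_)
    fun i => rfl
  rw [hc z hz]; simp

lemma sum_norm_sq_prepared {N : ℕ} {c : Circuit (Fin (qubits N))} (hc : Prepares N c) :
    ∑ i, ‖prepared c i‖ ^ 2 = 1 := by
  apply Complex.ofReal_injective
  rw [sum_norm_sq_eq, ← sum_output_eq hc, Complex.ofReal_one]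
  have := sum_norm_sq_eq c.output
  rw [show (∑ a, ‖c.output a‖ ^ 2 : ℝ) = 1 from sum_norm_sq_gatesOutput c.gates] at this
  rw [← Complex.ofReal_one, this]; rfl

namespace FactorizedSystem
variable (S : FactorizedSystem)

/-- The state prepared by the input circuit with number `c`. -/
def inputState (c : ℕ) : QState S.Wire := gatesOutput (S.inputGates c)

/-- The inner product of two input states. -/
def overlap (x y : ℕ) : ℂ := ∑ z, star (S.inputState x z) * S.inputState y z

lemma inputState_col (j : Fin S.R) : S.inputState j =
    fun z => (S.colCircuit j).output (z ∘ Sum.inl) * zeroState _ (z ∘ Sum.inr) := by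
  rw [inputState, inputGates, dif_pos j.2]
  exact gatesOutput_inl _

lemma inputState_row (j : Fin S.R) : S.inputState (S.R + j) =
    fun z => (S.rowCircuit j).output (z ∘ Sum.inr) * zeroState _ (z ∘ Sum.inl) := by
  have h : S.R + j - S.R = (j : ℕ) := by omega
  rw [inputState, inputGates, dif_neg (by omega), dif_pos (by omega)]
  simp only [h]
  exact gatesOutput_inr _

lemma inputState_rhs : S.inputState (2 * S.R) =
    fun z => S.rhsCircuit.output (z ∘ Sum.inl) * zeroState _ (z ∘ Sum.inr) := by
  rw [inputState, inputGates]
  split_ifs with h1 h2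
  · omega
  · omega
  · exact gatesOutput_inl _
  · exact absurd rfl ‹_›

lemma overlap_col_col (i j : Fin S.R) : S.overlap i j = star (S.u i) ⬝ᵥ S.u j := by
  rw [overlap, inputState_col, inputState_col, sum_inl]
  exact sum_output_eq (S.prepares_col i)

lemma overlap_row_row (i j : Fin S.R) :
    S.overlap (S.R + i) (S.R + j) = star (S.v i) ⬝ᵥ S.v j := by
  rw [overlap, inputState_row, inputState_row, sum_inr]
  exact sum_output_eq (S.prepares_row i)

lemma overlap_col_rhs (i : Fin S.R) :
    S.overlap i (2 * S.R) = star (S.u i) ⬝ᵥ prepared S.rhsCircuit := by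
  rw [overlap, inputState_col, inputState_rhs, sum_inl]
  exact sum_output_eq (S.prepares_col i)

lemma sum_norm_sq_inputState (c : ℕ) : ∑ z, ‖S.inputState c z‖ ^ 2 = 1 :=
  sum_norm_sq_gatesOutput _

end FactorizedSystem

/-- The outcome probability of the Hadamard test. -/
lemma sum_norm_sq_sub {Z : Type*} [Fintype Z] (φ ψ : Z → ℂ) (hφ : ∑ z, ‖φ z‖ ^ 2 = 1)
    (hψ : ∑ z, ‖ψ z‖ ^ 2 = 1) (ω : ℂ) (hω : ‖ω‖ = 1) :
    ∑ z, ‖(φ z - ω * ψ z) / 2‖ ^ 2 = (1 - (ω * ∑ z, star (φ z) * ψ z).re) / 2 := by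
  have h : ∀ z, ‖(φ z - ω * ψ z) / 2‖ ^ 2 =
      ‖φ z‖ ^ 2 / 4 + ‖ψ z‖ ^ 2 / 4 - (ω * (star (φ z) * ψ z)).re / 2 := by
    intro z
    have h1 : ‖ω * ψ z‖ = ‖ψ z‖ := by rw [norm_mul, hω, one_mul]
    rw [norm_div, div_pow, ← Complex.normSq_eq_norm_sq (φ z - _), Complex.normSq_sub,
      Complex.normSq_eq_norm_sq, Complex.normSq_eq_norm_sq, h1]
    have : (φ z * (starRingEnd ℂ) (ω * ψ z)).re = (ω * (star (φ z) * ψ z)).re := by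
      rw [← Complex.conj_re]
      congr 1
      simp only [map_mul, Complex.conj_conj, RCLike.star_def]; ring
    rw [this]; norm_num; ring
  simp_rw [h, Finset.sum_sub_distrib, Finset.sum_add_distrib, ← Finset.sum_div, hφ, hψ,
    ← Complex.re_sum, ← Finset.mul_sum]
  ring

/-! ### Numbers of gates -/

/-- A qubit on which the gate acts. -/
def Gate.wire {W : Type} : Gate W → W
  | .one w _ => w
  | .two w _ _ _ => w

lemma Gate.wire_mem {W : Type} (g : Gate W) : g.wire ∈ g.wires := by
  cases g <;> simp [Gate.wire, Gate.wires]

/-- Gates of a layer have disjoint supports, so picking one wire from each gate is injective. -/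
lemma Layer.length_le {W : Type} [Fintype W] (l : Layer W) : l.gates.length ≤ Fintype.card W := by
  have h : (l.gates.map Gate.wire).Nodup :=
    List.pairwise_map.2 (l.disjoint.imp fun {g h} hd (he : g.wire = h.wire) =>
      Set.disjoint_left.1 hd g.wire_mem (he ▸ h.wire_mem))
  simpa using h.length_le_card

lemma Circuit.length_gates_le {W : Type} [Fintype W] (c : Circuit W) :
    c.gates.length ≤ c.depth * Fintype.card W := by
  induction c with
  | nil => simp [Circuit.gates]
  | cons l c ih =>
    simp only [Circuit.gates, Circuit.depth, List.flatMap_cons, List.length_append,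
      List.length_cons] at ih ⊢
    have := l.length_le
    linarith

lemma FactorizedSystem.length_inputGates_le (S : FactorizedSystem) {p : Polynomial ℕ}
    (h : S.DepthAtMost p) (c : ℕ) :
    (S.inputGates c).length ≤
      p.eval (qubits S.N) * qubits S.N + p.eval (qubits S.M) * qubits S.M := by
  obtain ⟨h1, h2, h3⟩ := h
  have aux : ∀ {n q} (C : Circuit (Fin n)), C.depth ≤ q → C.gates.length ≤ q * n := fun C hC =>
    (Circuit.length_gates_le C).trans (by simpa using Nat.mul_le_mul_right _ hC)
  rw [FactorizedSystem.inputGates]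
  split_ifs
  · simpa using (aux _ (h1 _)).trans (Nat.le_add_right _ _)
  · simpa using (aux _ (h2 _)).trans (Nat.le_add_left _ _)
  · simpa using (aux _ h3).trans (Nat.le_add_right _ _)
  · simp

end

/-! ### Memory frames, matrix loops and the Hadamard test. -/

section

/-! ### Memory frames -/

section Frames
variable {W : Type}

@[simp] lemma Store.setNat_nat (σ : Store W) (x k : ℕ) :
    (σ.setNat x k).nat = Function.update σ.nat x k := rfl
@[simp] lemma Store.setNat_num (σ : Store W) (x k : ℕ) : (σ.setNat x k).num = σ.num := rfl
@[simp] lemma Store.setNat_q (σ : Store W) (x k : ℕ) : (σ.setNat x k).q = σ.q := rfl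
@[simp] lemma Store.set_nat (σ : Store W) (r : Ref) (c : ℂ) : (σ.set r c).nat = σ.nat := rfl
@[simp] lemma Store.set_q (σ : Store W) (r : Ref) (c : ℂ) : (σ.set r c).q = σ.q := rfl
lemma Store.set_num (σ : Store W) (r : Ref) (c : ℂ) (a i j : ℕ) :
    (σ.set r c).num a i j =
      if a = r.array ∧ i = σ.nat r.row ∧ j = σ.nat r.col then c else σ.num a i j := rfl

lemma Store.set_num_of_ne (σ : Store W) (r : Ref) (c : ℂ) {a : ℕ} (h : a ≠ r.array) :
    (σ.set r c).num a = σ.num a := by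
  funext i j; simp [Store.set_num, h]

/-- The stores agree except on the variables in `V` and the arrays in `A`. -/
structure Agree (V A : List ℕ) (σ τ : Store W) : Prop where
  nat : ∀ x, x ∉ V → τ.nat x = σ.nat x
  num : ∀ a, a ∉ A → τ.num a = σ.num a
  q : τ.q = σ.q

variable {V A V' A' : List ℕ} {σ τ υ : Store W}

lemma Agree.refl (σ : Store W) : Agree V A σ σ := ⟨fun _ _ => rfl, fun _ _ => rfl, rfl⟩

lemma Agree.trans (h : Agree V A σ τ) (h' : Agree V A τ υ) : Agree V A σ υ :=
  ⟨fun x hx => (h'.nat x hx).trans (h.nat x hx), fun a ha => (h'.num a ha).trans (h.num a ha),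
    h'.q.trans h.q⟩

lemma Agree.mono (h : Agree V A σ τ) (hV : V ⊆ V' := by decide) (hA : A ⊆ A' := by decide) :
    Agree V' A' σ τ :=
  ⟨fun x hx => h.nat x fun h' => hx (hV h'), fun a ha => h.num a fun h' => ha (hA h'), h.q⟩

lemma Agree.setNat (h : Agree V A σ τ) {x : ℕ} (hx : x ∈ V) (k : ℕ) :
    Agree V A σ (τ.setNat x k) :=
  ⟨fun y hy => by
      rw [Store.setNat_nat, Function.update_of_ne (by rintro rfl; exact hy hx), h.nat y hy],
    h.num, h.q⟩

lemma Agree.set (h : Agree V A σ τ) {r : Ref} (hr : r.array ∈ A) (c : ℂ) :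
    Agree V A σ (τ.set r c) :=
  ⟨h.nat, fun a ha => by
      rw [Store.set_num_of_ne _ _ _ (by rintro rfl; exact ha hr), h.num a ha], h.q⟩

end Frames

/-- A scalar stored in the array `a`; the variable `3` holds zero. -/
def sc (a : ℕ) : Ref := ⟨a, 3, 3⟩

@[simp] lemma sc_array (a : ℕ) : (sc a).array = a := rfl
@[simp] lemma sc_row (a : ℕ) : (sc a).row = 3 := rfl
@[simp] lemma sc_col (a : ℕ) : (sc a).col = 3 := rfl

variable {S : FactorizedSystem}

/-! ### Loops over matrix entries, and sums of products -/

/-- Execute `body` for all `i < R`, `j < m`, where `i`, `j` are the variables `5`, `6` and `m` is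
the value of `y`. -/
def forEach (y : ℕ) (body : Program) : Program := forLoop 5 0 (forLoop 6 y body)

/-- No iteration other than `(i, j)` writes the entry `(i, j)` of `a`, so the body may rely on its
initial value there, and the result is a function of the starting store. -/
lemma Runs.forEach {y R m tb a : ℕ} {V A : List ℕ} {body : Program} {σ : Store S.Wire}
    (f : ℕ → ℕ → ℂ) (hR : σ.nat 0 = R) (hm : σ.nat y = m) (h4 : σ.nat 4 = 1)
    (hV : ∀ x ∈ V, x ≠ 0 ∧ x ≠ 4 ∧ x ≠ 5 ∧ x ≠ 6 ∧ x ≠ y) (hy : y ≠ 5 ∧ y ≠ 6)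
    (hbody : ∀ τ i j, i < R → j < m → Agree (5 :: 6 :: V) (a :: A) σ τ → τ.nat 5 = i →
      τ.nat 6 = j → τ.num a i j = σ.num a i j →
      ∃ τ', Runs body τ tb τ' ∧ Agree V (a :: A) τ τ' ∧
        ∀ i' j', τ'.num a i' j' = if i' = i ∧ j' = j then f i j else τ.num a i' j') :
    ∃ σ', Runs (forEach y body) σ (R * (m * (tb + 3) + 3 + 3) + 3) σ' ∧
      Agree (5 :: 6 :: V) (a :: A) σ σ' ∧
      ∀ i j, σ'.num a i j = if i < R ∧ j < m then f i j else σ.num a i j := by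
  have nV : ∀ {x}, (x = 0 ∨ x = 4 ∨ x = y) → x ∉ 5 :: 6 :: V := by
    intro x hx hmem
    simp only [List.mem_cons] at hmem
    rcases hmem with h | h | h
    · rcases hx with h' | h' | h' <;> omega
    · rcases hx with h' | h' | h' <;> omega
    · have := hV x h; rcases hx with h' | h' | h' <;> omega
  have n56 : 5 ∉ V ∧ 6 ∉ V ∧ 4 ∉ V := ⟨fun h => (hV 5 h).2.2.1 rfl, fun h => (hV 6 h).2.2.2.1 rfl,
    fun h => (hV 4 h).2.1 rfl⟩
  obtain ⟨σ', hr, hI⟩ := Runs.forLoop (S := S) (x := 5) (y := 0) (n := R)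
    (tb := m * (tb + 3) + 3) (body := HybridLS.forLoop 6 y body) (σ := σ)
    (fun i τ => Agree (5 :: 6 :: V) (a :: A) σ τ ∧ τ.nat 5 = i ∧
      ∀ i' j', τ.num a i' j' = if i' < i ∧ j' < m then f i' j' else σ.num a i' j')
    ⟨(Agree.refl σ).setNat (by simp) _, by simp, by simp⟩
    (fun i τ h => ⟨h.2.1, by rw [h.1.nat 0 (nV (by simp)), hR]⟩) (by
      rintro i τ hi ⟨hA, h5, hnum⟩
      obtain ⟨τ', hr, hA', h6', h5', hnum'⟩ := Runs.forLoop (S := S) (x := 6) (y := y) (n := m)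
        (tb := tb) (body := body) (σ := τ)
        (fun j υ => Agree (5 :: 6 :: V) (a :: A) σ υ ∧ υ.nat 6 = j ∧ υ.nat 5 = i ∧
          ∀ i' j', υ.num a i' j' =
            if (i' < i ∧ j' < m) ∨ (i' = i ∧ j' < j) then f i' j' else σ.num a i' j')
        ⟨hA.setNat (by simp) _, by simp, by simp [h5], by simp [hnum]⟩
        (fun j υ h => ⟨h.2.1, by rw [h.1.nat y (nV (by simp)), hm]⟩) (by
          rintro j υ hj ⟨hAυ, h6, h5, hnumυ⟩
          obtain ⟨υ', hr, hA', hn⟩ := hbody υ i j hi hj hAυ h5 h6 (by rw [hnumυ]; simp)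
          refine ⟨υ', hr, ?_, ?_, ?_, ?_, ?_, ?_⟩
          · rw [hA'.nat 4 n56.2.2, hAυ.nat 4 (nV (by simp)), h4]
          · rw [hA'.nat 6 n56.2.1, h6]
          · exact (hAυ.trans (hA'.mono (fun x hx => by simp [hx]) (fun x hx => hx))).setNat (by simp) _
          · simp
          · simp [hA'.nat 5 n56.1, h5]
          · intro i' j'
            simp only [Store.setNat_num, hn, hnumυ]
            by_cases h1 : i' = i
            · subst h1
              by_cases h2 : j' = j
              · subst h2; simp
              · have : j' < j + 1 ↔ j' < j := by omega
                simp [h2, this]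
            · simp [h1])
      refine ⟨τ', hr, ?_, h5', hA'.setNat (by simp) _, by simp, ?_⟩
      · rw [hA'.nat 4 (nV (by simp)), h4]
      · intro i' j'
        simp only [Store.setNat_num, hnum']
        have : i' < i + 1 ∧ j' < m ↔ (i' < i ∧ j' < m) ∨ (i' = i ∧ j' < m) := by
          constructor
          · rintro ⟨h1, h2⟩; rcases Nat.lt_succ_iff_lt_or_eq.1 h1 with h | h
            exacts [Or.inl ⟨h, h2⟩, Or.inr ⟨h, h2⟩]
          · rintro (h | h) <;> exact ⟨by omega, h.2⟩
        simp only [this])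
  exact ⟨σ', hr, hI.1, hI.2.2⟩

/-- The value of the array entry `r` if the variable `7` has the value `l`. -/
def Ref.at {W : Type} (r : Ref) (σ : Store W) (l : ℕ) : ℂ :=
  σ.num r.array (if r.row = 7 then l else σ.nat r.row) (if r.col = 7 then l else σ.nat r.col)

lemma Ref.at_congr {W : Type} {r : Ref} {σ τ : Store W} {V A : List ℕ} (h : Agree V A σ τ)
    (hV : ∀ x ∈ V, x = 7 ∨ (x ≠ r.row ∧ x ≠ r.col)) (hr : r.array ∉ A) (l : ℕ) :
    r.at τ l = r.at σ l := by
  have aux : ∀ x, x = r.row ∨ x = r.col → (if x = 7 then l else τ.nat x) =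
      if x = 7 then l else σ.nat x := by
    intro x hx
    split_ifs with h7
    · rfl
    · refine h.nat x fun hmem => ?_
      rcases hV x hmem with h' | h'
      · exact h7 h'
      · rcases hx with h'' | h''
        exacts [h'.1 h'', h'.2 h'']
  rw [Ref.at, Ref.at, h.num _ hr, aux _ (Or.inl rfl), aux _ (Or.inr rfl)]

lemma Ref.get_eq_at {W : Type} (r : Ref) (σ : Store W) : σ.get r = r.at σ (σ.nat 7) := by
  simp only [Store.get, Ref.at]
  split_ifs <;> simp_all

/-- Scalar `5` becomes the sum of the products of `ra` and `rb` over the values `l < R` of the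
variable `7`. -/
def dot (ra rb : Ref) : Program :=
  .seq (.instr (.intConst (sc 5) 0))
    (forLoop 7 0 (block (.arith .mul (sc 6) ra rb) [.arith .add (sc 5) (sc 5) (sc 6)]))

lemma Runs.dot {R : ℕ} {ra rb : Ref} {σ : Store S.Wire} (hR : σ.nat 0 = R) (h3 : σ.nat 3 = 0)
    (h4 : σ.nat 4 = 1) (ha : ra.array ∉ [5, 6]) (hb : rb.array ∉ [5, 6]) :
    ∃ σ', Runs (dot ra rb) σ (6 * R + 5) σ' ∧ Agree [7] [5, 6] σ σ' ∧
      σ'.num 5 0 0 = ∑ l ∈ Finset.range R, ra.at σ l * rb.at σ l := by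
  obtain ⟨σ', hr, hA, -, hs⟩ := Runs.forLoop (S := S) (x := 7) (y := 0) (n := R) (tb := 3)
    (body := HybridLS.block (.arith .mul (sc 6) ra rb) [.arith .add (sc 5) (sc 5) (sc 6)])
    (σ := σ.set (sc 5) 0)
    (fun i τ => Agree [7] [5, 6] σ τ ∧ τ.nat 7 = i ∧
      τ.num 5 0 0 = ∑ l ∈ Finset.range i, ra.at σ l * rb.at σ l)
    ⟨((Agree.refl σ).set (by simp) _).setNat (by simp) _, by simp, by simp [Store.set_num, h3]⟩
    (fun i τ h => ⟨h.2.1, by rw [h.1.nat 0 (by decide), hR]⟩) (by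
      rintro i τ hi ⟨hA, h7, hs⟩
      have t3 : τ.nat 3 = 0 := by rw [hA.nat 3 (by decide), h3]
      have t4 : τ.nat 4 = 1 := by rw [hA.nat 4 (by decide), h4]
      have ea : τ.get ra = ra.at σ i := by
        rw [Ref.get_eq_at, h7]; exact Ref.at_congr hA (by simp) ha _
      have eb : τ.get rb = rb.at σ i := by
        rw [Ref.get_eq_at, h7]; exact Ref.at_congr hA (by simp) hb _
      refine ⟨_, Runs.block τ _ _ (by simp [Instr.IsDet]), ?_, ?_, ?_, ?_, ?_⟩
      · simp [execDet, t4]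
      · simp [execDet, h7]
      · exact ((hA.set (by simp) _).set (by simp) _).setNat (by simp) _
      · simp
      · simp [execDet, Store.get, Store.set_num, t3, Op.eval, hs, Finset.sum_range_succ] at ea eb ⊢
        rw [ea, eb])
  have e : σ.set (sc 5) 0 = execDet S σ (.intConst (sc 5) 0) := by simp [execDet]
  rw [e] at hr
  exact ⟨σ', (Runs.seq (Runs.instr σ (i := .intConst (sc 5) 0) trivial) hr).mono
    (by omega), hA, hs⟩

/-! ### The Hadamard test -/

/-- Needed because the first Hadamard gate puts the factor 1/√2 in front of |0…0⟩ before the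
circuits run. -/
lemma Gate.apply_smul {W : Type} [DecidableEq W] (g : Gate W) (c : ℂ) (ψ : QState W) :
    g.apply (c • ψ) = c • g.apply ψ := by
  funext z
  cases g <;> simp only [Gate.apply, Pi.smul_apply, smul_eq_mul, Finset.mul_sum, mul_left_comm]

lemma foldl_apply_smul {W : Type} [DecidableEq W] (l : List (Gate W)) (c : ℂ) (ψ : QState W) :
    l.foldl (fun ψ g => g.apply ψ) (c • ψ) = c • l.foldl (fun ψ g => g.apply ψ) ψ := by
  induction l generalizing ψ with
  | nil => rfl
  | cons g l ih => rw [List.foldl_cons, List.foldl_cons, Gate.apply_smul, ih]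

/-- Apply the input circuit with number `x`, controlled by the ancilla. -/
def applyCircuit (x : ℕ) : Program :=
  .seq (.instr (.size 9 x)) (forLoop 8 9 (.instr (.ctrl x 8)))

lemma Runs.applyCircuit {x L : ℕ} {σ : Store S.Wire} (hx : x ∉ [8, 9]) (h4 : σ.nat 4 = 1)
    (hL : (S.inputGates (σ.nat x)).length ≤ L) :
    ∃ σ', Runs (applyCircuit x) σ (4 * L + 5) σ' ∧ (∀ y, y ∉ [8, 9] → σ'.nat y = σ.nat y) ∧
      σ'.num = σ.num ∧ σ'.q false = σ.q false ∧
      σ'.q true = (S.inputGates (σ.nat x)).foldl (fun ψ g => g.apply ψ) (σ.q true) := by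
  set l := S.inputGates (σ.nat x) with hl
  obtain ⟨σ', hr, -, -, hnat, hnum, hf, ht⟩ := Runs.forLoop (S := S) (x := 8) (y := 9)
    (n := l.length) (tb := 1) (body := .instr (.ctrl x 8)) (σ := execDet S σ (.size 9 x))
    (fun i τ => τ.nat 8 = i ∧ τ.nat 9 = l.length ∧ (∀ y, y ∉ [8, 9] → τ.nat y = σ.nat y) ∧
      τ.num = σ.num ∧ τ.q false = σ.q false ∧
      τ.q true = (l.take i).foldl (fun ψ g => g.apply ψ) (σ.q true))
    ⟨by simp, by simp [execDet, hl], fun y hy => by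
      simp only [List.mem_cons, not_or] at hy; simp [execDet, hy.1, hy.2.1], rfl, rfl, rfl⟩
    (fun i τ h => ⟨h.1, h.2.1⟩) (by
      rintro i τ hi ⟨h8, h9, hnat, hnum, hf, ht⟩
      refine ⟨_, Runs.instr τ trivial, ?_, ?_, ?_, ?_, ?_, ?_, ?_, ?_⟩
      · simp [execDet, hnat 4 (by decide), h4]
      · simp [execDet, h8]
      · simp
      · simp [execDet, h9]
      · intro y hy
        have := hnat y hy
        simp only [List.mem_cons, not_or] at hy
        simp [execDet, hy.1, this]
      · simp [execDet, hnum]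
      · simp [execDet, hf]
      · have hg : (S.inputGates (τ.nat x))[τ.nat 8]? = some (l[i]) := by
          rw [hnat x hx, h8, ← hl]; exact List.getElem?_eq_getElem hi
        simp only [execDet, Store.setNat_q, hg, ht]
        rw [List.take_add_one, List.getElem?_eq_getElem hi, List.foldl_append]
        rfl)
  refine ⟨σ', (Runs.seq (Runs.instr σ (i := .size 9 x) trivial) hr).mono ?_, hnat, hnum, hf, ?_⟩
  · omega
  · rw [ht, List.take_length]

/-- The circuit of the Hadamard test for the input circuits whose numbers are in the variables `14`
and `15`, for the real part or, with an additional phase, for the imaginary part. -/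
def hadamardTest (ph : Bool) : Program :=
  seqs (.instr .hadamard) [applyCircuit 14, .instr .flip, applyCircuit 15,
    -- `natConst 8 0` is an idle instruction, which makes both variants equally long.
    .instr (if ph then .phase else .natConst 8 0), .instr .hadamard]

/-- The phase in the Hadamard test. -/
def testPhase (ph : Bool) : ℂ := if ph then Complex.I else 1

lemma norm_testPhase (ph : Bool) : ‖testPhase ph‖ = 1 := by cases ph <;> simp [testPhase]

/-- After the first Hadamard both branches hold |0…0⟩/√2. The first circuit acts on branch `1`,
which NOT turns into branch `0`; the second circuit acts on the new branch `1`. The last Hadamard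
leaves half of the difference on branch `1`. -/
lemma Runs.hadamardTest {L : ℕ} (ph : Bool) {σ : Store S.Wire} (h4 : σ.nat 4 = 1)
    (hq : σ.q = deviceZero S.Wire) (hL : ∀ c, (S.inputGates c).length ≤ L) :
    ∃ σ', Runs (hadamardTest ph) σ (8 * L + 19) σ' ∧ (∀ y, y ∉ [8, 9] → σ'.nat y = σ.nat y) ∧
      σ'.num = σ.num ∧ ∀ z, σ'.q true z =
        (S.inputState (σ.nat 14) z - testPhase ph * S.inputState (σ.nat 15) z) / 2 := by
  have r1 := Runs.instr (S := S) σ (i := .hadamard) trivial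
  obtain ⟨σ2, r2, n2, m2, f2, t2⟩ := Runs.applyCircuit (S := S) (x := 14)
    (σ := execDet S σ .hadamard) (by decide) h4 (hL _)
  have r3 := Runs.instr (S := S) σ2 (i := .flip) trivial
  obtain ⟨σ4, r4, n4, m4, f4, t4⟩ := Runs.applyCircuit (S := S) (x := 15)
    (σ := execDet S σ2 .flip) (by decide) (by rw [← h4]; exact n2 4 (by decide)) (hL _)
  have r5 := Runs.instr (S := S) σ4 (i := if ph then .phase else .natConst 8 0)
    (by cases ph <;> trivial)
  have r6 := Runs.instr (S := S) (execDet S σ4 (if ph then .phase else .natConst 8 0))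
    (i := .hadamard) trivial
  refine ⟨_, (r1.seq (r2.seq (r3.seq (r4.seq (r5.seq r6))))).mono (by omega), ?_, ?_, ?_⟩
  · intro y hy
    have e2 : σ2.nat y = σ.nat y := n2 y hy
    have e4 : σ4.nat y = σ2.nat y := n4 y hy
    simp only [List.mem_cons, not_or] at hy
    cases ph <;> simp [execDet, e2, e4, hy.1]
  · have e2 : σ2.num = σ.num := m2
    have e4 : σ4.num = σ2.num := m4
    cases ph <;> simp [execDet, e2, e4]
  · intro z
    have s2 : ((Real.sqrt 2 : ℝ) : ℂ) * (Real.sqrt 2 : ℝ) = 2 := by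
      rw [← Complex.ofReal_mul]; norm_num
    have s0 : ((Real.sqrt 2 : ℝ) : ℂ) ≠ 0 := by
      intro h; rw [h] at s2; norm_num at s2
    have hH : ∀ a, (execDet S σ .hadamard).q a = ((Real.sqrt 2 : ℝ) : ℂ)⁻¹ • zeroState S.Wire := by
      intro a; funext z
      cases a <;> simp [execDet, hq, deviceZero, div_eq_inv_mul]
    have e2 : σ2.q true = ((Real.sqrt 2 : ℝ) : ℂ)⁻¹ • S.inputState (σ.nat 14) := by
      rw [t2, hH, foldl_apply_smul]; rfl
    have e4 : σ4.q true = ((Real.sqrt 2 : ℝ) : ℂ)⁻¹ • S.inputState (σ.nat 15) := by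
      rw [t4]
      change List.foldl _ (σ2.q false) _ = _
      rw [f2, hH, foldl_apply_smul]
      have : (execDet S σ2 .flip).nat 15 = σ.nat 15 := n2 15 (by decide)
      rw [this]; rfl
    have e4f : σ4.q false = ((Real.sqrt 2 : ℝ) : ℂ)⁻¹ • S.inputState (σ.nat 14) := by
      rw [f4, ← e2]; rfl
    have fin : ∀ ph, (execDet S (execDet S σ4 (if ph = true then .phase else .natConst 8 0))
        .hadamard).q true z = (σ4.q false z - testPhase ph * σ4.q true z) / (Real.sqrt 2 : ℝ) := by
      intro ph
      cases ph <;> simp [execDet, testPhase, sub_eq_add_neg]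
    rw [fin, e4, e4f, ← s2]
    simp only [Pi.smul_apply, smul_eq_mul]
    field_simp

/-- Cauchy–Schwarz, read off from the nonnegativity of the outcome probabilities for the phases `ω`
and `-ω`. -/
lemma abs_re_overlap_le (S : FactorizedSystem) (x y : ℕ) (ω : ℂ) (hω : ‖ω‖ = 1) :
    |(ω * S.overlap x y).re| ≤ 1 := by
  have h1 := sum_norm_sq_sub _ _ (S.sum_norm_sq_inputState x) (S.sum_norm_sq_inputState y) ω hω
  have h2 := sum_norm_sq_sub _ _ (S.sum_norm_sq_inputState x) (S.sum_norm_sq_inputState y) (-ω)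
    (by simpa using hω)
  have p1 : 0 ≤ ∑ z, ‖(S.inputState x z - ω * S.inputState y z) / 2‖ ^ 2 := by positivity
  have p2 : 0 ≤ ∑ z, ‖(S.inputState x z - -ω * S.inputState y z) / 2‖ ^ 2 := by positivity
  rw [h1] at p1
  rw [h2, neg_mul, Complex.neg_re] at p2
  rw [FactorizedSystem.overlap, abs_le]
  constructor <;> linarith

/-- The truncation at `1` in `probOne` is inactive because the real part is at least `-1`. -/
lemma probOne_hadamardTest (ph : Bool) (x y : ℕ) (q : Bool → QState S.Wire)
    (h : ∀ z, q true z = (S.inputState x z - testPhase ph * S.inputState y z) / 2) :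
    (probOne q).toReal = (1 - (testPhase ph * S.overlap x y).re) / 2 := by
  have h1 := sum_norm_sq_sub _ _ (S.sum_norm_sq_inputState x) (S.sum_norm_sq_inputState y) _
    (norm_testPhase ph)
  have h2 := abs_le.1 (abs_re_overlap_le S x y _ (norm_testPhase ph))
  simp only [probOne, h, h1]
  rw [← FactorizedSystem.overlap, min_eq_right, ENNReal.toReal_ofReal (by linarith)]
  simp only [ENNReal.ofReal_le_one]; linarith

/-- The increment of the estimate for the two outcomes of a Hadamard test is this unit, stored as
scalar `13` or `14`, or its negative. -/
def testUnit (ph : Bool) : ℂ := if ph then -Complex.I else 1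

/-- One Hadamard test, whose result is added to the entry `20[i,j]`. -/
def sample (ph : Bool) : Program :=
  seqs (hadamardTest ph) [.instr (.measure 10),
    .branch (.natLt 3 10)
      (.instr (.arith .sub ⟨20, 5, 6⟩ ⟨20, 5, 6⟩ (sc (if ph then 14 else 13))))
      (.instr (.arith .add ⟨20, 5, 6⟩ ⟨20, 5, 6⟩ (sc (if ph then 14 else 13))))]

/-- The constants in the memory of the machine. -/
structure Base (σ : Store S.Wire) : Prop where
  size : σ.nat 0 = S.R
  zero : σ.nat 3 = 0
  one : σ.nat 4 = 1
  unit : ∀ ph : Bool, σ.num (if ph then 14 else 13) 0 0 = testUnit ph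
  q : σ.q = deviceZero S.Wire

lemma Base.agree {V A : List ℕ} {σ τ : Store S.Wire} (h : Base σ) (h' : Agree V A σ τ)
    (hV : 0 ∉ V ∧ 3 ∉ V ∧ 4 ∉ V := by decide) (hA : 13 ∉ A ∧ 14 ∉ A := by decide) : Base τ where
  size := by rw [h'.nat 0 hV.1, h.size]
  zero := by rw [h'.nat 3 hV.2.1, h.zero]
  one := by rw [h'.nat 4 hV.2.2, h.one]
  unit := by
    intro ph
    rw [h'.num _ (by cases ph; exacts [hA.1, hA.2]), h.unit]
  q := h'.q.trans h.q

/-- The matrix `G` with `c` added to the entry `i`, `j`. -/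
def addAt (G : ℕ → ℕ → ℂ) (i j : ℕ) (c : ℂ) : ℕ → ℕ → ℂ :=
  fun i' j' => if i' = i ∧ j' = j then G i' j' + c else G i' j'

/-- Outcome `0` adds the unit and outcome `1` subtracts it, so the mean increment is the unit times
the real part of phase times overlap `z`. For the phase `1` this is Re z. For the phase i, Re(iz) =
−Im z and the unit −i give i·Im z. -/
lemma wp_sample {L : ℕ} (ph : Bool) {σ : Store S.Wire} (hB : Base σ)
    (hL : ∀ c, (S.inputGates c).length ≤ L) {Post : Store S.Wire → Prop} {Q : Store S.Wire → ℝ}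
    {φ₀ φ₁ : ℝ}
    (h0 : ∀ σ', Agree [8, 9, 10] [20] σ σ' →
      σ'.num 20 = addAt (σ.num 20) (σ.nat 5) (σ.nat 6) (testUnit ph) → Post σ' ∧ Q σ' ≤ φ₀)
    (h1 : ∀ σ', Agree [8, 9, 10] [20] σ σ' →
      σ'.num 20 = addAt (σ.num 20) (σ.nat 5) (σ.nat 6) (-testUnit ph) → Post σ' ∧ Q σ' ≤ φ₁) :
    WP (sample ph) σ (8 * L + 24) Post Q
      ((1 + (testPhase ph * S.overlap (σ.nat 14) (σ.nat 15)).re) / 2 * φ₀ +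
        (1 - (testPhase ph * S.overlap (σ.nat 14) (σ.nat 15)).re) / 2 * φ₁) := by
  obtain ⟨σ', hr, hnat, hnum, hq⟩ := Runs.hadamardTest ph hB.one hB.q hL
  have hp := probOne_hadamardTest ph _ _ _ hq
  refine (WP.seq_runs (t₂ := 4) hr ?_).mono (by omega) (fun σ' h => ⟨h, le_rfl⟩) le_rfl
  intro Good K T hK
  have hab := abs_le.1 (abs_re_overlap_le S (σ.nat 14) (σ.nat 15) _ (norm_testPhase ph))
  -- The four steps are the sequencing, the measurement, the test and the update of the entry.
  rw [show T + 4 = (T + 2) + 1 + 1 by ring, failProb_of_step_pure (by rfl), failProb_measure, hp]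
  have u := hB.unit ph
  have key : ∀ a : Bool, Agree [8, 9, 10] [20] σ (afterMeasure σ' 10 a) := by
    intro a
    refine ⟨fun y hy => ?_, fun b _ => ?_, ?_⟩
    · simp only [List.mem_cons, not_or] at hy
      simp [afterMeasure, hy, hnat y (by simp [hy])]
    · simp [afterMeasure, hnum]
    · simp [afterMeasure, hB.q]
  have hz : ∀ a, (afterMeasure σ' 10 a).nat 3 = 0 := fun a => by
    rw [(key a).nat 3 (by decide), hB.zero]
  have hu : ∀ a, (afterMeasure σ' 10 a).get (sc (if ph then 14 else 13)) = testUnit ph := by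
    intro a
    simp only [Store.get, sc_array, sc_row, sc_col, hz]
    rw [(key a).num _ (by cases ph <;> decide), u]
  have hnum20 : ∀ a, (afterMeasure σ' 10 a).num 20 = σ.num 20 := by
    intro a; simp [afterMeasure, hnum]
  have hg : ∀ a, (afterMeasure σ' 10 a).get ⟨20, 5, 6⟩ = σ.num 20 (σ.nat 5) (σ.nat 6) := by
    intro a
    simp only [Store.get, hnum20, (key a).nat 5 (by decide), (key a).nat 6 (by decide)]
  have hset : ∀ a c, ((afterMeasure σ' 10 a).set ⟨20, 5, 6⟩ (σ.num 20 (σ.nat 5) (σ.nat 6) + c)).num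
      20 = addAt (σ.num 20) (σ.nat 5) (σ.nat 6) c := by
    intro a c
    funext i j
    simp only [Store.set_num, hnum20, addAt, (key a).nat 5 (by decide), (key a).nat 6 (by decide),
      true_and]
    by_cases hij : i = σ.nat 5 ∧ j = σ.nat 6
    · rw [if_pos hij, if_pos hij, hij.1, hij.2]
    · rw [if_neg hij, if_neg hij]
  set x := (testPhase ph * S.overlap (σ.nat 14) (σ.nat 15)).re
  rw [show 1 - (1 - x) / 2 = (1 + x) / 2 by ring]
  refine add_le_add (mul_le_mul_of_nonneg_left ?_ (by linarith))
    (mul_le_mul_of_nonneg_left ?_ (by linarith))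
  · have h := h0 ((afterMeasure σ' 10 false).set ⟨20, 5, 6⟩
      (σ.num 20 (σ.nat 5) (σ.nat 6) + testUnit ph)) ((key _).set (by simp) _) (hset _ _)
    have h3 : ¬ Test.Holds (afterMeasure σ' 10 false) (.natLt 3 10) := by
      simp only [Test.Holds, hz]; simp [afterMeasure]
    have hr := Runs.instr (S := S) (afterMeasure σ' 10 false)
      (i := .arith .add ⟨20, 5, 6⟩ ⟨20, 5, 6⟩ (sc (if ph then 14 else 13))) trivial
    simp only [execDet, Op.eval, hg, hu] at hr
    exact ((Runs.branch_neg h3 hr) Good K T).trans ((hK _ h.1).trans h.2)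
  · have h := h1 ((afterMeasure σ' 10 true).set ⟨20, 5, 6⟩
      (σ.num 20 (σ.nat 5) (σ.nat 6) + -testUnit ph)) ((key _).set (by simp) _) (hset _ _)
    have h3 : Test.Holds (afterMeasure σ' 10 true) (.natLt 3 10) := by
      simp only [Test.Holds, hz]; simp [afterMeasure]
    have hr := Runs.instr (S := S) (afterMeasure σ' 10 true)
      (i := .arith .sub ⟨20, 5, 6⟩ ⟨20, 5, 6⟩ (sc (if ph then 14 else 13))) trivial
    simp only [execDet, Op.eval, hg, hu, sub_eq_add_neg] at hr
    exact ((Runs.branch_pos h3 hr) Good K T).trans ((hK _ h.1).trans h.2)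

end

/-! ### Exponential supermartingales and the sampling loop. -/

section

/-! ### Exponential potentials -/

/-- Averaging over a centred variable removes the linear term and leaves a pure exponential, which
can be multiplied from sample to sample. -/
lemma exp_le_add_exp_sq (x : ℝ) : Real.exp x ≤ x + Real.exp (x ^ 2) := by
  have h1 : 1 + x ^ 2 ≤ Real.exp (x ^ 2) := by linarith [Real.add_one_le_exp (x ^ 2)]
  rcases le_total x (-1) with h | h
  · have : Real.exp x ≤ 1 := Real.exp_le_one_iff.2 (by linarith)
    nlinarith
  rcases le_total x 1 with h' | h'
  · have := (abs_le.1 (Real.abs_exp_sub_one_sub_id_le (abs_le.2 ⟨h, h'⟩))).2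
    linarith
  · have : Real.exp x ≤ Real.exp (x ^ 2) := Real.exp_le_exp.2 (by nlinarith)
    linarith

/-- The values 1 − m and −1 − m with these weights have mean zero, so the linear terms cancel; both
are at most 2 in modulus, whence the 4. -/
lemma two_point_exp_le {m : ℝ} (hm : |m| ≤ 1) (x : ℝ) :
    (1 + m) / 2 * Real.exp (x * (1 - m)) + (1 - m) / 2 * Real.exp (x * (-1 - m)) ≤
      Real.exp (4 * x ^ 2) := by
  obtain ⟨h1, h2⟩ := abs_le.1 hm
  have aux : ∀ y : ℝ, |y| ≤ 2 → Real.exp (x * y) ≤ x * y + Real.exp (4 * x ^ 2) := fun y hy => by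
    refine (exp_le_add_exp_sq _).trans (add_le_add_right (Real.exp_le_exp.2 ?_) _)
    have := abs_le.1 hy
    have hy2 : y ^ 2 ≤ 4 := by nlinarith
    nlinarith [sq_nonneg x]
  have a1 := mul_le_mul_of_nonneg_left (aux (1 - m) (abs_le.2 ⟨by linarith, by linarith⟩))
    (by linarith : 0 ≤ (1 + m) / 2)
  have a2 := mul_le_mul_of_nonneg_left (aux (-1 - m) (abs_le.2 ⟨by linarith, by linarith⟩))
    (by linarith : 0 ≤ (1 - m) / 2)
  calc _ ≤ _ := add_le_add a1 a2
    _ = _ := by ring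

/-- The matrix `G` with `c` added to the entry `i`, `j`, restricted to a sum against `C`. -/
lemma sum_mul_addAt {R m i j : ℕ} (hi : i < R) (hj : j < m) (C G a : ℕ → ℕ → ℂ) (c d : ℂ) :
    ∑ i' ∈ Finset.range R, ∑ j' ∈ Finset.range m,
        (C i' j' * (addAt G i j c i' j' - addAt a i j d i' j')).re =
      ∑ i' ∈ Finset.range R, ∑ j' ∈ Finset.range m, (C i' j' * (G i' j' - a i' j')).re +
        (C i j * (c - d)).re := by
  have h : ∀ i' j', (C i' j' * (addAt G i j c i' j' - addAt a i j d i' j')).re =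
      (C i' j' * (G i' j' - a i' j')).re +
        if i' = i then (if j' = j then (C i j * (c - d)).re else 0) else 0 := by
    intro i' j'
    unfold addAt
    by_cases h1 : i' = i
    · by_cases h2 : j' = j
      · subst h1 h2
        simp only [and_self, if_true, ← Complex.add_re]
        congr 1; ring
      · simp [h1, h2]
    · simp [h1]
  simp_rw [h, Finset.sum_add_distrib]
  congr 1
  simp [Finset.sum_ite_irrel, hi, hj]

section Potential
variable {T : Type*}

/-- The budget for the samples that remain to be drawn when `N i j` of `n` have been drawn. -/
def budget (R m n : ℕ) (κ : ℝ) (C : T → ℕ → ℕ → ℂ) (N : ℕ → ℕ → ℕ) (s : T) : ℝ :=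
  4 * (∑ i ∈ Finset.range R, ∑ j ∈ Finset.range m, ((n : ℝ) - N i j) * ‖C s i j‖ ^ 2) - κ

/-- One more sample drawn at the entry `i`, `j`. -/
def incAt (N : ℕ → ℕ → ℕ) (i j : ℕ) : ℕ → ℕ → ℕ :=
  fun i' j' => if i' = i ∧ j' = j then N i' j' + 1 else N i' j'

lemma budget_incAt {R m n i j : ℕ} (hi : i < R) (hj : j < m) (κ : ℝ) (C : T → ℕ → ℕ → ℂ)
    (N : ℕ → ℕ → ℕ) (s : T) :
    budget R m n κ C (incAt N i j) s + 4 * ‖C s i j‖ ^ 2 = budget R m n κ C N s := by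
  have h : ∀ i' j', ((n : ℝ) - N i' j') * ‖C s i' j'‖ ^ 2 =
      ((n : ℝ) - incAt N i j i' j') * ‖C s i' j'‖ ^ 2 +
        if i' = i then (if j' = j then ‖C s i j‖ ^ 2 else 0) else 0 := by
    intro i' j'
    unfold incAt
    by_cases h1 : i' = i
    · by_cases h2 : j' = j
      · subst h1 h2
        simp only [and_self, if_true]; push_cast; ring
      · simp [h1, h2]
    · simp [h1]
  simp only [budget]
  simp_rw [h, Finset.sum_add_distrib]
  simp only [Finset.sum_ite_irrel, Finset.sum_ite_eq', Finset.sum_const_zero,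
    Finset.mem_range, hi, hj, if_true]
  ring

variable [Fintype T]

/-- An exponential potential for the deviations of `G` from `a` in the directions `C`. -/
def pot (R m : ℕ) (φ : ℝ) (C : T → ℕ → ℕ → ℂ) (a : ℕ → ℕ → ℂ) (B : T → ℝ) (G : ℕ → ℕ → ℂ) : ℝ :=
  φ + ∑ s, Real.exp (∑ i ∈ Finset.range R, ∑ j ∈ Finset.range m,
    (C s i j * (G i j - a i j)).re + B s)

/-- The supermartingale property. One sample at `(i, j)` multiplies each exponential on average by
at most exp(4x²) with x = Re(C c), and the drop from `B` to `B'` pays for exactly this factor. -/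
lemma pot_step {R m i j : ℕ} (hi : i < R) (hj : j < m) (φ : ℝ) (C : T → ℕ → ℕ → ℂ)
    (a : ℕ → ℕ → ℂ) (B B' : T → ℝ) (G : ℕ → ℕ → ℂ) (c : ℂ) {μ : ℝ} (hμ : |μ| ≤ 1)
    (hB : ∀ s, B' s + 4 * (C s i j * c).re ^ 2 ≤ B s) :
    (1 + μ) / 2 * pot R m φ C (addAt a i j (c * μ)) B' (addAt G i j c) +
      (1 - μ) / 2 * pot R m φ C (addAt a i j (c * μ)) B' (addAt G i j (-c)) ≤
      pot R m φ C a B G := by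
  simp only [pot, sum_mul_addAt hi hj]
  rw [mul_add, mul_add, Finset.mul_sum, Finset.mul_sum, add_add_add_comm, ← Finset.sum_add_distrib]
  refine add_le_add (le_of_eq (by ring)) (Finset.sum_le_sum fun s _ => ?_)
  set E := ∑ i' ∈ Finset.range R, ∑ j' ∈ Finset.range m, (C s i' j' * (G i' j' - a i' j')).re
  set x := (C s i j * c).re with hx
  have e1 : (C s i j * (c - c * μ)).re = x * (1 - μ) := by
    rw [show C s i j * (c - c * μ) = C s i j * c * ((1 - μ : ℝ) : ℂ) by push_cast; ring,
      Complex.re_mul_ofReal]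
  have e2 : (C s i j * (-c - c * μ)).re = x * (-1 - μ) := by
    rw [show C s i j * (-c - c * μ) = C s i j * c * ((-1 - μ : ℝ) : ℂ) by push_cast; ring,
      Complex.re_mul_ofReal]
  rw [e1, e2, show E + x * (1 - μ) + B' s = x * (1 - μ) + (E + B' s) by ring,
    show E + x * (-1 - μ) + B' s = x * (-1 - μ) + (E + B' s) by ring,
    Real.exp_add (x * (1 - μ)), Real.exp_add (x * (-1 - μ))]
  calc _ = ((1 + μ) / 2 * Real.exp (x * (1 - μ)) + (1 - μ) / 2 * Real.exp (x * (-1 - μ))) *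
        Real.exp (E + B' s) := by ring
    _ ≤ Real.exp (4 * x ^ 2) * Real.exp (E + B' s) :=
        mul_le_mul_of_nonneg_right (two_point_exp_le hμ x) (Real.exp_pos _).le
    _ ≤ _ := by
        rw [← Real.exp_add]
        exact Real.exp_le_exp.2 (by linarith [hB s])

/-- The potential when `N i j` of `n` samples with mean `μ i j` have been drawn. -/
def potN (R m n : ℕ) (φ κ : ℝ) (C : T → ℕ → ℕ → ℂ) (μ : ℕ → ℕ → ℂ) (N : ℕ → ℕ → ℕ)
    (G : ℕ → ℕ → ℂ) : ℝ :=
  pot R m φ C (fun i j => N i j * μ i j) (budget R m n κ C N) G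

lemma potN_congr {R m n : ℕ} {φ κ : ℝ} {C : T → ℕ → ℕ → ℂ} {μ : ℕ → ℕ → ℂ} {N N' : ℕ → ℕ → ℕ}
    {G : ℕ → ℕ → ℂ} (h : ∀ i j, i < R → j < m → N i j = N' i j) :
    potN R m n φ κ C μ N G = potN R m n φ κ C μ N' G := by
  have e1 : ∀ s, ∑ i ∈ Finset.range R, ∑ j ∈ Finset.range m, (C s i j * (G i j - N i j * μ i j)).re
      = ∑ i ∈ Finset.range R, ∑ j ∈ Finset.range m, (C s i j * (G i j - N' i j * μ i j)).re :=
    fun s => Finset.sum_congr rfl fun i hi => Finset.sum_congr rfl fun j hj => by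
      rw [h i j (Finset.mem_range.1 hi) (Finset.mem_range.1 hj)]
  have e2 : ∀ s, budget R m n κ C N s = budget R m n κ C N' s := fun s => by
    simp only [budget]
    congr 2
    exact Finset.sum_congr rfl fun i hi => Finset.sum_congr rfl fun j hj => by
      rw [h i j (Finset.mem_range.1 hi) (Finset.mem_range.1 hj)]
  simp only [potN, pot, e1, e2]

end Potential

/-! ### Estimation of overlaps -/

/-- One sample of the real part and one of the imaginary part. -/
def samplePair : Program := .seq (sample false) (sample true)

variable {S : FactorizedSystem}

/-- The test for the real part costs 4(Re C)² and the one for the imaginary part 4(Im C)²; together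
this is the 4‖C‖² released by `budget_incAt`. -/
lemma wp_samplePair {T : Type*} [Fintype T] {L R m n i j : ℕ} {σ : Store S.Wire} (hB : Base σ)
    (hL : ∀ c, (S.inputGates c).length ≤ L) (hi : i < R) (hj : j < m) (h5 : σ.nat 5 = i)
    (h6 : σ.nat 6 = j) (φ κ : ℝ) (C : T → ℕ → ℕ → ℂ) (μ : ℕ → ℕ → ℂ)
    (hμ : μ i j = S.overlap (σ.nat 14) (σ.nat 15)) (N : ℕ → ℕ → ℕ) :
    WP samplePair σ (16 * L + 49) (Agree [8, 9, 10] [20] σ)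
      (fun σ' => potN R m n φ κ C μ (incAt N i j) (σ'.num 20))
      (potN R m n φ κ C μ N (σ.num 20)) := by
  set z := S.overlap (σ.nat 14) (σ.nat 15) with hz
  have m1 : (testPhase false * z).re = z.re := by simp [testPhase]
  have m2 : (testPhase true * z).re = -z.im := by simp [testPhase]
  have b1 : |z.re| ≤ 1 := m1 ▸ abs_re_overlap_le S _ _ _ (norm_testPhase false)
  have b2 : |-z.im| ≤ 1 := m2 ▸ abs_re_overlap_le S _ _ _ (norm_testPhase true)
  set a₀ : ℕ → ℕ → ℂ := fun i j => N i j * μ i j with ha₀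
  set a₁ := addAt a₀ i j (testUnit false * (z.re : ℝ)) with ha₁
  have ha₂ : addAt a₁ i j (testUnit true * ((-z.im : ℝ) : ℂ)) =
      fun i' j' => incAt N i j i' j' * μ i' j' := by
    funext i' j'
    by_cases h : i' = i ∧ j' = j
    · obtain ⟨rfl, rfl⟩ := h
      simp only [addAt, incAt, ha₁, ha₀, and_self, if_true, testUnit, hμ]
      have : (z.re : ℂ) + z.im * Complex.I = z := Complex.re_add_im z
      push_cast
      linear_combination this
    · simp [addAt, incAt, h, ha₁, ha₀]
  set B₂ := budget R m n κ C (incAt N i j) with hB₂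
  -- The budget between the two tests: what remains afterwards plus the cost of the imaginary part.
  set B₁ : T → ℝ := fun s => B₂ s + 4 * (C s i j * testUnit true).re ^ 2 with hB₁
  refine (WP.seq (t₁ := 8 * L + 24) (t₂ := 8 * L + 24) (Mid := Agree [8, 9, 10] [20] σ)
    (QM := fun σ' => pot R m φ C a₁ B₁ (σ'.num 20)) ?_ ?_).mono
    (by omega) (fun σ' h => ⟨h, le_rfl⟩) le_rfl
  · refine (wp_sample false hB hL
      (φ₀ := pot R m φ C a₁ B₁ (addAt (σ.num 20) i j (testUnit false)))
      (φ₁ := pot R m φ C a₁ B₁ (addAt (σ.num 20) i j (-testUnit false)))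
      (fun σ' h e => ⟨h, by rw [e, h5, h6]⟩) (fun σ' h e => ⟨h, by rw [e, h5, h6]⟩)).mono
      le_rfl (fun σ' h => ⟨h, le_rfl⟩) ?_
    rw [← hz, m1]
    refine pot_step hi hj φ C a₀ _ B₁ _ _ b1 fun s => ?_
    rw [← budget_incAt hi hj, hB₁]
    have : ‖C s i j‖ ^ 2 = (C s i j * testUnit true).re ^ 2 + (C s i j * testUnit false).re ^ 2 := by
      rw [← Complex.normSq_eq_norm_sq, Complex.normSq_apply]
      simp [testUnit]; ring
    rw [this]; linarith
  · intro σ' hA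
    have e14 : σ'.nat 14 = σ.nat 14 := hA.nat 14 (by decide)
    have e15 : σ'.nat 15 = σ.nat 15 := hA.nat 15 (by decide)
    have e5 : σ'.nat 5 = i := (hA.nat 5 (by decide)).trans h5
    have e6 : σ'.nat 6 = j := (hA.nat 6 (by decide)).trans h6
    refine (wp_sample true (hB.agree hA) hL
      (φ₀ := pot R m φ C (fun i' j' => incAt N i j i' j' * μ i' j') B₂
        (addAt (σ'.num 20) i j (testUnit true)))
      (φ₁ := pot R m φ C (fun i' j' => incAt N i j i' j' * μ i' j') B₂
        (addAt (σ'.num 20) i j (-testUnit true)))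
      (fun σ'' h e => ⟨hA.trans h, by rw [e, e5, e6]; rfl⟩)
      (fun σ'' h e => ⟨hA.trans h, by rw [e, e5, e6]; rfl⟩)).mono
      le_rfl (fun σ' h => ⟨h, le_rfl⟩) ?_
    rw [e14, e15, ← hz, m2, ← ha₂]
    exact pot_step hi hj φ C a₁ _ B₂ _ _ b2 fun s => le_rfl

/-- Estimate the overlap for the current values of the variables `5` and `6`; the number of samples
is the least natural number above the scalar `8`. -/
def estimateEntry : Program :=
  seqs (block (.natAdd 14 11 5) [.natAdd 15 12 6, .intConst (sc 7) 0])
    [.loop (.reLe (sc 7) (sc 8))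
      (seqs samplePair [.instr (.arith .add (sc 7) (sc 7) (sc 13))])]

/-- The numbers of samples drawn before the `r`-th one at the entry `i`, `j`. -/
def drawn (n i j r : ℕ) : ℕ → ℕ → ℕ := fun i' j' =>
  if i' < i ∨ (i' = i ∧ j' < j) then n else if i' = i ∧ j' = j then r else 0

lemma incAt_drawn (n i j r : ℕ) : incAt (drawn n i j r) i j = drawn n i j (r + 1) := by
  funext i' j'
  unfold incAt drawn
  split_ifs <;> first | rfl | omega

lemma drawn_self (n i j : ℕ) : drawn n i j n = drawn n i (j + 1) 0 := by
  funext i' j'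
  unfold drawn
  split_ifs <;> first | rfl | omega

/-- The target scalar `8` and the offsets `11`, `12` of circuit numbers. -/
structure EstimateInput (σ : Store S.Wire) (s : ℝ) (ro co : ℕ) : Prop where
  base : Base σ
  target : σ.num 8 0 0 = (s : ℂ)
  row : σ.nat 11 = ro
  col : σ.nat 12 = co

lemma EstimateInput.agree {V A : List ℕ} {σ τ : Store S.Wire} {s : ℝ} {ro co : ℕ}
    (h : EstimateInput σ s ro co) (h' : Agree V A σ τ)
    (hV : 0 ∉ V ∧ 3 ∉ V ∧ 4 ∉ V ∧ 11 ∉ V ∧ 12 ∉ V := by decide)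
    (hA : 13 ∉ A ∧ 14 ∉ A ∧ 8 ∉ A := by decide) : EstimateInput τ s ro co where
  base := h.base.agree h' ⟨hV.1, hV.2.1, hV.2.2.1⟩ ⟨hA.1, hA.2.1⟩
  target := by rw [h'.num 8 hA.2.2, h.target]
  row := by rw [h'.nat 11 hV.2.2.2.1, h.row]
  col := by rw [h'.nat 12 hV.2.2.2.2, h.col]

/-- The counter is compared by `≤` with the real target `s`, so the loop body runs for the counter
values 0, …, ⌊s⌋. This gives ⌊s⌋ + 1 samples without the program ever computing a floor. -/
lemma wp_estimateEntry {T : Type*} [Fintype T] {L R m n i j ro co : ℕ} {s : ℝ} {σ : Store S.Wire}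
    (hE : EstimateInput σ s ro co) (hs : 0 ≤ s) (hn : n = ⌊s⌋₊ + 1)
    (hL : ∀ c, (S.inputGates c).length ≤ L) (hi : i < R) (hj : j < m) (h5 : σ.nat 5 = i)
    (h6 : σ.nat 6 = j) (φ κ : ℝ) (C : T → ℕ → ℕ → ℂ) :
    WP estimateEntry σ (n * (16 * L + 52) + 7)
      (fun σ' => Agree [8, 9, 10, 14, 15] [7, 20] σ σ' ∧ σ'.num 7 0 0 = n)
      (fun σ' => potN R m n φ κ C (fun i j => S.overlap (ro + i) (co + j)) (drawn n i (j + 1) 0)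
        (σ'.num 20))
      (potN R m n φ κ C (fun i j => S.overlap (ro + i) (co + j)) (drawn n i j 0) (σ.num 20)) := by
  set μ : ℕ → ℕ → ℂ := fun i j => S.overlap (ro + i) (co + j) with hμ
  have r1 := Runs.block (S := S) σ (.natAdd 14 11 5) [.natAdd 15 12 6, .intConst (sc 7) 0]
    (by simp [Instr.IsDet])
  set σ₁ := ([.natAdd 14 11 5, .natAdd 15 12 6, .intConst (sc 7) 0] : List Instr).foldl
    (execDet S) σ with hσ₁
  have A1 : Agree [8, 9, 10, 14, 15] [7, 20] σ σ₁ :=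
    (((Agree.refl σ).setNat (by simp) _).setNat (by simp) _).set (by simp) _
  have hE1 := hE.agree A1
  have c14 : σ₁.nat 14 = ro + i := by simp [hσ₁, execDet, hE.row, h5]
  have c15 : σ₁.nat 15 = co + j := by simp [hσ₁, execDet, hE.col, h6]
  have c7 : σ₁.num 7 0 0 = 0 := by simp [hσ₁, execDet, Store.set_num, hE.base.zero]
  have c20 : σ₁.num 20 = σ.num 20 := Store.set_num_of_ne _ _ _ (by decide)
  have key := WP.loop (S := S) (t := .reLe (sc 7) (sc 8))
    (P := seqs samplePair [.instr (.arith .add (sc 7) (sc 7) (sc 13))]) (tb := 16 * L + 51)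
    (n := n)
    (fun r τ => Agree [8, 9, 10] [7, 20] σ₁ τ ∧ τ.num 7 0 0 = r)
    (fun r τ => potN R m n φ κ C μ (drawn n i j r) (τ.num 20))
    (fun r τ ⟨hA, hr⟩ => by
      have hEτ := hE1.agree hA
      simp only [Test.Holds, Store.get, sc_array, sc_row, sc_col, hEτ.base.zero, hr, hEτ.target,
        Complex.natCast_re, Complex.ofReal_re, hn, Nat.lt_succ_iff]
      exact (Nat.le_floor_iff hs).symm)
    (fun r τ hr ⟨hA, hr'⟩ => by
      have hEτ := hE1.agree hA
      refine (WP.seq (wp_samplePair hEτ.base hL hi hj (R := R) (m := m) (n := n)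
        (by rw [hA.nat 5 (by decide), A1.nat 5 (by decide), h5])
        (by rw [hA.nat 6 (by decide), A1.nat 6 (by decide), h6]) φ κ C μ
        (by rw [hA.nat 14 (by decide), hA.nat 15 (by decide), c14, c15]) (drawn n i j r))
        (t₂ := 1) fun τ' hA' => ?_).mono (by omega) (fun σ' h => ⟨h, le_rfl⟩) le_rfl
      have hE' := hEτ.base.agree hA'
      have e7 : τ'.num 7 0 0 = r := by rw [hA'.num 7 (by decide), hr']
      have e13 : τ'.num 13 0 0 = 1 := hE'.unit false
      have e20 : (execDet S τ' (.arith .add (sc 7) (sc 7) (sc 13))).num 20 = τ'.num 20 :=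
        Store.set_num_of_ne _ _ _ (by decide)
      rw [incAt_drawn, ← e20]
      refine (Runs.instr τ' (by trivial)).wp (Q := fun σ' => potN R m n φ κ C μ (drawn n i j (r + 1))
        (σ'.num 20)) ⟨(hA.trans hA'.mono).set (by simp) _, ?_⟩
      simp [execDet, Store.set_num, Store.get, hE'.zero, e7, e13, Op.eval])
    n 0 σ₁ (by omega) ⟨Agree.refl _, by simpa using c7⟩
  rw [c20, show 16 * L + 51 + 1 = 16 * L + 52 by omega] at key
  refine (WP.seq_runs r1 key).mono (by simp only [List.length_cons, List.length_nil]; omega)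
    (fun σ' h => ⟨⟨A1.trans h.1.mono, h.2⟩, ?_⟩) le_rfl
  rw [drawn_self]

/-- Estimate all overlaps, for `i < R` and `j` below the variable `13`, as sums of samples in the
array `20`. -/
def estimate : Program :=
  .seq (forEach 13 (.instr (.intConst ⟨20, 5, 6⟩ 0))) (forEach 13 estimateEntry)

/-- A bound for the running time of `estimate`. -/
def estimateTime (L R m n : ℕ) : ℕ := R * (m * (n * (16 * L + 52) + 14) + 12) + 7

/-- At the start nothing is drawn and the whole budget 4nΣ‖C‖² is in the exponent; at the end it is
spent and only the threshold `κ` is left. The family `C` of functionals is arbitrary and exists only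
in the analysis, not in the program. -/
lemma wp_estimate {T : Type*} [Fintype T] {L m n ro co : ℕ} {s : ℝ} {σ : Store S.Wire}
    (hE : EstimateInput σ s ro co) (hs : 0 ≤ s) (hn : n = ⌊s⌋₊ + 1) (hm : σ.nat 13 = m)
    (hL : ∀ c, (S.inputGates c).length ≤ L) (hR0 : 0 < S.R) (hm0 : 0 < m)
    (φ κ : ℝ) (C : T → ℕ → ℕ → ℂ) :
    WP estimate σ (estimateTime L S.R m n)
      (fun σ' => Agree [5, 6, 8, 9, 10, 14, 15] [7, 20] σ σ' ∧ σ'.num 7 0 0 = n)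
      (fun σ' => φ + ∑ t, Real.exp (∑ i ∈ Finset.range S.R, ∑ j ∈ Finset.range m,
        (C t i j * (σ'.num 20 i j - n * S.overlap (ro + i) (co + j))).re - κ))
      (φ + ∑ t, Real.exp (4 * (n * ∑ i ∈ Finset.range S.R, ∑ j ∈ Finset.range m, ‖C t i j‖ ^ 2)
        - κ)) := by
  set μ : ℕ → ℕ → ℂ := fun i j => S.overlap (ro + i) (co + j) with hμ
  obtain ⟨σ₁, r1, A1, z1⟩ := Runs.forEach (S := S) (R := S.R) (m := m) (y := 13) (a := 20)
    (V := []) (A := []) (tb := 1) (body := .instr (.intConst ⟨20, 5, 6⟩ 0)) (σ := σ)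
    (fun _ _ => 0) hE.base.size hm hE.base.one (by simp) (by decide) (by
      intro τ i j hi hj hA h5 h6 _
      refine ⟨_, Runs.instr τ trivial, (Agree.refl τ).set (by simp) _, fun i' j' => ?_⟩
      simp [execDet, Store.set_num, h5, h6])
  have hE1 := hE.agree A1
  have hm1 : σ₁.nat 13 = m := (A1.nat 13 (by decide)).trans hm
  have key := WP.forLoop (S := S) (x := 5) (y := 0) (n := S.R) (body := forLoop 6 13 estimateEntry)
    (tb := m * (n * (16 * L + 52) + 7 + 3) + 3) (σ := σ₁)
    (fun i τ => Agree [5, 6, 8, 9, 10, 14, 15] [7, 20] σ₁ τ ∧ τ.nat 5 = i ∧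
      -- The counter holds `n` only after some entry has been estimated; this is where `R` and `m`
      -- must be positive.
      (0 < i → τ.num 7 0 0 = n))
    (fun i τ => potN S.R m n φ κ C μ (drawn n i 0 0) (τ.num 20))
    ⟨(Agree.refl _).setNat (by simp) _, by simp, by simp⟩
    (fun i τ h => ⟨h.2.1, by rw [h.1.nat 0 (by decide), hE1.base.size]⟩)
    (fun i τ hi ⟨hA, h5, h7⟩ => by
      have hEτ := hE1.agree hA
      have inner := WP.forLoop (S := S) (x := 6) (y := 13) (n := m) (body := estimateEntry)
        (tb := n * (16 * L + 52) + 7) (σ := τ)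
        (fun j υ => Agree [6, 8, 9, 10, 14, 15] [7, 20] τ υ ∧ υ.nat 6 = j ∧
          (0 < j → υ.num 7 0 0 = n))
        (fun j υ => potN S.R m n φ κ C μ (drawn n i j 0) (υ.num 20))
        ⟨(Agree.refl _).setNat (by simp) _, by simp, by simp⟩
        (fun j υ h => ⟨h.2.1, by rw [h.1.nat 13 (by decide), hA.nat 13 (by decide), hm1]⟩)
        (fun j υ hj ⟨hAυ, h6, _⟩ => by
          have hEυ := hEτ.agree hAυ
          refine (wp_estimateEntry hEυ hs hn hL hi hj
            (by rw [hAυ.nat 5 (by decide), h5]) h6 φ κ C).mono le_rfl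
            (fun σ' h => ⟨⟨?_, ?_, ?_, ?_, ?_⟩, le_rfl⟩) le_rfl
          · rw [h.1.nat 4 (by decide), hEυ.base.one]
          · rw [h.1.nat 6 (by decide), h6]
          · exact (hAυ.trans h.1.mono).setNat (by simp) _
          · simp
          · intro _; exact h.2)
      refine inner.mono le_rfl (fun σ' h => ⟨⟨?_, ?_, ?_, ?_, ?_⟩, ?_⟩) le_rfl
      · rw [h.1.nat 4 (by decide), hEτ.base.one]
      · rw [h.1.nat 5 (by decide), h5]
      · exact (hA.trans h.1.mono).setNat (by simp) _
      · simp
      · intro _; exact h.2.2 hm0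
      -- A finished row and the start of the next one have equal counts in the columns below `m`,
      -- the only ones that matter.
      · refine (potN_congr fun i' j' _ hj' => ?_).le
        unfold drawn
        split_ifs <;> first | rfl | omega)
  refine (WP.seq_runs r1 key).mono (by unfold estimateTime; ring_nf; omega)
    (fun σ' h => ⟨⟨A1.mono.trans h.1, h.2.2 hR0⟩, ?_⟩) ?_
  · rw [potN_congr (N' := fun _ _ => n) fun i' j' hi' _ => by simp [drawn, hi']]
    simp [potN, pot, budget, hμ, sub_eq_add_neg]
  · rw [potN_congr (N' := fun _ _ => 0) fun i' j' hi' _ => by simp [drawn]]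
    simp only [potN, pot, budget, Nat.cast_zero, zero_mul, sub_zero, Store.setNat_num,
      ← Finset.mul_sum]
    refine add_le_add le_rfl (Finset.sum_le_sum fun t _ => Real.exp_le_exp.2 ?_)
    rw [Finset.sum_eq_zero fun i hi => Finset.sum_eq_zero fun j hj => ?_, zero_add]
    rw [z1, if_pos ⟨Finset.mem_range.1 hi, Finset.mem_range.1 hj⟩]; simp

end

/-! ### Nets and the spectral-norm error of the estimates. -/

section

/-! ### Nets -/

/-- A maximal 1-separated subset of the ball of radius 2 is a 1-net of it. A separated set has at
most 5^dim points, and the real dimension is 2R. -/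
lemma exists_net (R : ℕ) : ∃ s : Finset (EuclideanSpace ℂ (Fin R)), s.card ≤ 25 ^ R ∧
    (∀ w ∈ s, ‖w‖ ≤ 2) ∧ ∀ x : EuclideanSpace ℂ (Fin R), ‖x‖ ≤ 2 → ∃ w ∈ s, ‖x - w‖ ≤ 1 := by
  classical
  set P : Finset (EuclideanSpace ℂ (Fin R)) → Prop := fun s =>
    (∀ c ∈ s, ‖c‖ ≤ 2) ∧ ∀ c ∈ s, ∀ d ∈ s, c ≠ d → 1 ≤ ‖c - d‖ with hP
  have hdim : Module.finrank ℝ (EuclideanSpace ℂ (Fin R)) = 2 * R := by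
    rw [← Module.finrank_mul_finrank ℝ ℂ (EuclideanSpace ℂ (Fin R)), Complex.finrank_real_complex,
      finrank_euclideanSpace_fin]
  have hcard : ∀ s, P s → s.card ≤ 25 ^ R := fun s hs => by
    have := Besicovitch.card_le_of_separated s hs.1 hs.2
    rwa [hdim, pow_mul] at this
  set Q : ℕ → Prop := fun k => ∃ s, P s ∧ s.card = k with hQ
  have hQ0 : Q 0 := ⟨∅, by simp [hP], rfl⟩
  obtain ⟨s, hs, hk⟩ := Nat.findGreatest_spec (P := Q) (Nat.zero_le (25 ^ R)) hQ0
  refine ⟨s, hcard s hs, hs.1, fun x hx => ?_⟩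
  by_contra! hcon
  have hxs : x ∉ s := fun h => by
    have := hcon x h; simp at this; linarith
  have hins : P (insert x s) := by
    refine ⟨fun c hc => ?_, fun c hc d hd hcd => ?_⟩
    · rcases Finset.mem_insert.1 hc with rfl | hc
      exacts [hx, hs.1 c hc]
    · rcases Finset.mem_insert.1 hc with hc' | hc' <;> rcases Finset.mem_insert.1 hd with hd' | hd'
      · exact absurd (hc'.trans hd'.symm) hcd
      · rw [hc']; exact (hcon d hd').le
      · rw [hd', norm_sub_rev]; exact (hcon c hc').le
      · exact hs.2 c hc' d hd' hcd
  have h1 : Q (s.card + 1) := ⟨insert x s, hins, Finset.card_insert_of_notMem hxs⟩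
  have h2 : s.card + 1 ≤ 25 ^ R := by
    have := hcard _ hins
    rwa [Finset.card_insert_of_notMem hxs] at this
  have := Nat.le_findGreatest h2 h1
  omega

/-- A finite set of test vectors. -/
def net (R : ℕ) : Finset (EuclideanSpace ℂ (Fin R)) := (exists_net R).choose

lemma card_net_le (R : ℕ) : (net R).card ≤ 25 ^ R := (exists_net R).choose_spec.1

lemma norm_le_of_mem_net {R : ℕ} {w : EuclideanSpace ℂ (Fin R)} (h : w ∈ net R) : ‖w‖ ≤ 2 :=
  (exists_net R).choose_spec.2.1 w h

/-- Scale `v` to norm 2 and take a net vector `w` within distance 1: then Re⟨w, v⟩ ≥ 2‖v‖ − ‖v‖.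
Choosing the radius 2 for mesh 1 is what avoids a loss in the constant. -/
lemma norm_le_of_net {R : ℕ} {a : ℝ} (v : EuclideanSpace ℂ (Fin R))
    (h : ∀ w ∈ net R, |(inner ℂ w v).re| ≤ a) : ‖v‖ ≤ a := by
  have ha : 0 ≤ a := by
    obtain ⟨w, hw, -⟩ := (exists_net R).choose_spec.2.2 0 (by simp)
    exact (abs_nonneg _).trans (h w hw)
  rcases eq_or_ne v 0 with rfl | hv
  · simpa using ha
  have hv' : 0 < ‖v‖ := norm_pos_iff.2 hv
  obtain ⟨w, hw, hx⟩ := (exists_net R).choose_spec.2.2 (((2 / ‖v‖ : ℝ) : ℂ) • v) (by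
    rw [norm_smul, Complex.norm_real, Real.norm_of_nonneg (by positivity)]
    field_simp; exact le_rfl)
  have h1 : (inner ℂ (((2 / ‖v‖ : ℝ) : ℂ) • v) v).re = 2 * ‖v‖ := by
    rw [inner_smul_left, inner_self_eq_norm_sq_to_K, Complex.conj_ofReal]
    have : ((2 / ‖v‖ : ℝ) : ℂ) * ((‖v‖ : ℝ) : ℂ) ^ 2 = ((2 * ‖v‖ : ℝ) : ℂ) := by
      rw [← Complex.ofReal_pow, ← Complex.ofReal_mul]
      congr 1; field_simp
    exact (congrArg Complex.re this).trans (Complex.ofReal_re _)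
  have h2 : (inner ℂ ((((2 / ‖v‖ : ℝ) : ℂ) • v) - w) v).re ≤ 1 * ‖v‖ :=
    (Complex.re_le_norm _).trans ((norm_inner_le_norm _ _).trans
      (mul_le_mul_of_nonneg_right hx (norm_nonneg _)))
  rw [inner_sub_left, Complex.sub_re, h1] at h2
  have h3 := (abs_le.1 (h w hw)).2
  linarith

/-- The net bound is used twice: over `z`, to bound the adjoint at each net vector `w`, and then
over `w`. -/
lemma l2_opNorm_le_of_net {R m : ℕ} {a : ℝ} (ha : 0 ≤ a) (D : Matrix (Fin R) (Fin m) ℂ)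
    (h : ∀ w ∈ net R, ∀ z ∈ net m, |(inner ℂ w (Matrix.toEuclideanLin D z)).re| ≤ a) :
    ‖D‖ ≤ a := by
  set L := Matrix.toEuclideanLin D with hL
  have h1 : ∀ w ∈ net R, ‖LinearMap.adjoint L w‖ ≤ a := fun w hw => norm_le_of_net _ fun z hz => by
    rw [LinearMap.adjoint_inner_right, ← inner_conj_symm, Complex.conj_re]
    exact h w hw z hz
  rw [Matrix.l2_opNorm_def]
  refine ContinuousLinearMap.opNorm_le_bound _ ha fun x => ?_
  change ‖L x‖ ≤ _
  refine norm_le_of_net _ fun w hw => ?_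
  rw [← LinearMap.adjoint_inner_left]
  exact (Complex.abs_re_le_norm _).trans ((norm_inner_le_norm _ _).trans
    (mul_le_mul_of_nonneg_right (h1 w hw) (norm_nonneg _)))

/-! ### Accuracy of the estimates -/

lemma re_inner_toEuclideanLin {R m : ℕ} (D : Matrix (Fin R) (Fin m) ℂ)
    (w : EuclideanSpace ℂ (Fin R)) (z : EuclideanSpace ℂ (Fin m)) :
    inner ℂ w (Matrix.toEuclideanLin D z) = ∑ i, ∑ j, star (w i) * z j * D i j := by
  simp only [PiLp.inner_apply, Matrix.ofLp_toLpLin, Matrix.toLin'_apply, Matrix.mulVec, dotProduct,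
    RCLike.inner_apply, Finset.sum_mul]
  exact Finset.sum_congr rfl fun i _ => Finset.sum_congr rfl fun j _ => by
    rw [RCLike.star_def]; ring

/-- The coefficients of the test functionals. -/
def testCoeff {R m : ℕ} (θ : ℝ) (w : EuclideanSpace ℂ (Fin R)) (z : EuclideanSpace ℂ (Fin m))
    (i j : ℕ) : ℂ :=
  if h : i < R ∧ j < m then (θ : ℂ) * (star (w ⟨i, h.1⟩) * z ⟨j, h.2⟩) else 0

lemma sum_testCoeff {R m : ℕ} (θ : ℝ) (w : EuclideanSpace ℂ (Fin R))
    (z : EuclideanSpace ℂ (Fin m)) (D : ℕ → ℕ → ℂ) :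
    ∑ i ∈ Finset.range R, ∑ j ∈ Finset.range m, (testCoeff θ w z i j * D i j).re =
      θ * (inner ℂ w (Matrix.toEuclideanLin (Matrix.of fun (i : Fin R) (j : Fin m) => D i j) z)).re := by
  rw [re_inner_toEuclideanLin, ← Complex.re_ofReal_mul, Finset.mul_sum, Complex.re_sum,
    Finset.sum_range]
  refine Finset.sum_congr rfl fun i _ => ?_
  rw [Finset.mul_sum, Complex.re_sum, Finset.sum_range]
  refine Finset.sum_congr rfl fun j _ => ?_
  simp only [testCoeff, i.2, j.2, and_self, dif_pos, Matrix.of_apply, mul_assoc, Fin.eta]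

lemma sum_norm_sq_testCoeff {R m : ℕ} (θ : ℝ) (w : EuclideanSpace ℂ (Fin R))
    (z : EuclideanSpace ℂ (Fin m)) :
    ∑ i ∈ Finset.range R, ∑ j ∈ Finset.range m, ‖testCoeff θ w z i j‖ ^ 2 =
      θ ^ 2 * (‖w‖ ^ 2 * ‖z‖ ^ 2) := by
  rw [EuclideanSpace.norm_sq_eq, EuclideanSpace.norm_sq_eq, Finset.sum_mul_sum, Finset.mul_sum,
    Finset.sum_range]
  refine Finset.sum_congr rfl fun i _ => ?_
  rw [Finset.mul_sum, Finset.sum_range]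
  refine Finset.sum_congr rfl fun j _ => ?_
  simp only [testCoeff, i.2, j.2, and_self, dif_pos, Fin.eta, norm_mul, Complex.norm_real,
    norm_star, mul_pow, Real.norm_eq_abs, sq_abs]

/-- The matrix held by the array `a`. -/
def matOf {W : Type} (σ : Store W) (a R m : ℕ) : Matrix (Fin R) (Fin m) ℂ :=
  Matrix.of fun i j => σ.num a i j

/-- The matrix of overlaps of the input circuits with numbers from `ro` and from `co`. -/
def overlapMat (S : FactorizedSystem) (ro co R m : ℕ) : Matrix (Fin R) (Fin m) ℂ :=
  Matrix.of fun i j => S.overlap (ro + i) (co + j)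

variable {S : FactorizedSystem}

/-- The probability that an estimate with `n` samples deviates by more than `t`. -/
def deviationProb (R n : ℕ) (t : ℝ) : ℝ := 2 * 625 ^ R * Real.exp (-(n * t ^ 2 / 256))

/-- The functionals are ±θ Re⟨w, D z⟩ for net vectors `w`, `z`, the sign being the Boolean index. If
the error exceeds `n * t`, one functional exceeds its threshold, its exponential is at least 1, and
it covers the trivial bound for whatever follows. -/
lemma tri_estimate {L m n ro co : ℕ} {s t : ℝ} {σ : Store S.Wire}
    (hE : EstimateInput σ s ro co) (hs : 0 ≤ s) (hn : n = ⌊s⌋₊ + 1) (hm : σ.nat 13 = m)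
    (hL : ∀ c, (S.inputGates c).length ≤ L) (hR0 : 0 < S.R) (hm0 : 0 < m) (hmR : m ≤ S.R)
    (ht : 0 ≤ t) :
    Tri estimate σ (estimateTime L S.R m n) (deviationProb S.R n t) fun σ' =>
      Agree [5, 6, 8, 9, 10, 14, 15] [7, 20] σ σ' ∧ σ'.num 7 0 0 = n ∧
        ‖matOf σ' 20 S.R m - (n : ℂ) • overlapMat S ro co S.R m‖ ≤ n * t := by
  intro φ hφ
  -- As ‖w‖, ‖z‖ ≤ 2, the initial exponent is at most n(64θ² − θt), minimal at θ = t/128 with the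
  -- value −nt²/256.
  set θ : ℝ := t / 128 with hθ
  set κ : ℝ := θ * (n * t) with hκ
  let C : (Bool × net S.R × net m) → ℕ → ℕ → ℂ := fun p =>
    testCoeff (if p.1 then θ else -θ) p.2.1.1 p.2.2.1
  have hcard : (Fintype.card (Bool × net S.R × net m) : ℝ) ≤ 2 * 625 ^ S.R := by
    have : Fintype.card (Bool × net S.R × net m) ≤ 2 * (25 ^ S.R * 25 ^ S.R) := by
      simp only [Fintype.card_prod, Fintype.card_bool, Fintype.card_coe]
      gcongr
      · exact card_net_le _
      · exact (card_net_le m).trans (Nat.pow_le_pow_right (by norm_num) hmR)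
    refine (Nat.cast_le.2 this).trans (le_of_eq ?_)
    push_cast
    rw [← mul_pow]; norm_num
  intro Good K T hK
  refine (wp_estimate hE hs hn hm hL hR0 hm0 φ κ C).mono le_rfl (fun σ' h => ⟨h, le_rfl⟩) ?_
    Good K T fun σ' ⟨hA, h7⟩ => ?_
  · refine add_le_add le_rfl ?_
    calc _ ≤ ∑ _p : Bool × net S.R × net m, Real.exp (-(n * t ^ 2 / 256)) := by
          refine Finset.sum_le_sum fun p _ => Real.exp_le_exp.2 ?_
          simp only [C, sum_norm_sq_testCoeff]
          have h1 : (if p.1 then θ else -θ) ^ 2 = θ ^ 2 := by split_ifs <;> ring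
          have hw := norm_le_of_mem_net p.2.1.2
          have hz := norm_le_of_mem_net p.2.2.2
          have h2 : ‖p.2.1.1‖ ^ 2 * ‖p.2.2.1‖ ^ 2 ≤ 4 * 4 := by
            gcongr
            · nlinarith [norm_nonneg p.2.1.1]
            · nlinarith [norm_nonneg p.2.2.1]
          rw [h1]
          have h3 : θ ^ 2 * (‖p.2.1.1‖ ^ 2 * ‖p.2.2.1‖ ^ 2) ≤ θ ^ 2 * (4 * 4) :=
            mul_le_mul_of_nonneg_left h2 (sq_nonneg _)
          have h4 := mul_le_mul_of_nonneg_left h3 (Nat.cast_nonneg (α := ℝ) n)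
          rw [hκ, hθ] at *
          nlinarith
      _ ≤ _ := by
          rw [Finset.sum_const, nsmul_eq_mul, Finset.card_univ, deviationProb]
          gcongr
  · by_cases hgood : ‖matOf σ' 20 S.R m - (n : ℂ) • overlapMat S ro co S.R m‖ ≤ n * t
    · exact (hK σ' ⟨hA, h7, hgood⟩).trans
        (le_add_of_nonneg_right (Finset.sum_nonneg fun _ _ => (Real.exp_pos _).le))
    refine (failProb_le_one _ _).trans ?_
    have hbad : ¬ ∀ w ∈ net S.R, ∀ z ∈ net m, |(inner ℂ w (Matrix.toEuclideanLin
        (matOf σ' 20 S.R m - (n : ℂ) • overlapMat S ro co S.R m) z)).re| ≤ n * t :=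
      fun h => hgood (l2_opNorm_le_of_net (by positivity) _ h)
    push Not at hbad
    obtain ⟨w, hw, z, hz, hwz⟩ := hbad
    set D := matOf σ' 20 S.R m - (n : ℂ) • overlapMat S ro co S.R m with hD
    set r := (inner ℂ w (Matrix.toEuclideanLin D z)).re with hr
    let p : Bool × net S.R × net m := (decide (0 ≤ r), ⟨w, hw⟩, ⟨z, hz⟩)
    have hp : 1 ≤ Real.exp (∑ i ∈ Finset.range S.R, ∑ j ∈ Finset.range m,
        (C p i j * (σ'.num 20 i j - n * S.overlap (ro + i) (co + j))).re - κ) := by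
      rw [Real.one_le_exp_iff]
      have e := sum_testCoeff (if p.1 then θ else -θ) w z
        (fun i j => σ'.num 20 i j - n * S.overlap (ro + i) (co + j))
      have eD : (Matrix.of fun (i : Fin S.R) (j : Fin m) =>
          σ'.num 20 i j - n * S.overlap (ro + i) (co + j)) = D := by
        ext i j; simp [hD, matOf, overlapMat]
      rw [eD, ← hr] at e
      simp only [C, p] at e ⊢
      rw [e, hκ]
      have hθ0 : 0 ≤ θ := by positivity
      by_cases h0 : 0 ≤ r
      · rw [abs_of_nonneg h0] at hwz
        simp only [h0, decide_true, if_true]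
        nlinarith
      · rw [abs_of_neg (not_le.1 h0)] at hwz
        simp only [h0, decide_false, Bool.false_eq_true, if_false]
        nlinarith
    have h2 := Finset.single_le_sum (f := fun p => Real.exp (∑ i ∈ Finset.range S.R,
      ∑ j ∈ Finset.range m, (C p i j * (σ'.num 20 i j - n * S.overlap (ro + i) (co + j))).re - κ))
      (fun _ _ => (Real.exp_pos _).le) (Finset.mem_univ p)
    linarith

end

/-! ### Inversion and positivity by conjugate directions. -/

section

/-! ### Inversion of Hermitian matrices by successive conjugate directions -/

section Inversion
variable {R : ℕ}

/-- The direction added in one step of the inversion. -/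
def invVec (W X : Matrix (Fin R) (Fin R) ℂ) (k : Fin R) : Fin R → ℂ :=
  Pi.single k 1 - X *ᵥ W.col k

/-- The pivot in one step of the inversion. -/
def invPivot (W X : Matrix (Fin R) (Fin R) ℂ) (k : Fin R) : ℂ := (W *ᵥ invVec W X k) k

/-- One step of the inversion. -/
def invStep (W X : Matrix (Fin R) (Fin R) ℂ) (k : Fin R) : Matrix (Fin R) (Fin R) ℂ :=
  X + (invPivot W X k)⁻¹ • Matrix.vecMulVec (invVec W X k) (star (invVec W X k))

/-- The approximate inverses. -/
def invIter (W : Matrix (Fin R) (Fin R) ℂ) : ℕ → Matrix (Fin R) (Fin R) ℂ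
  | 0 => 0
  | k + 1 => if h : k < R then invStep W (invIter W k) ⟨k, h⟩ else invIter W k

/-- The Hermitian form of a matrix. -/
def qform (W : Matrix (Fin R) (Fin R) ℂ) (x : Fin R → ℂ) : ℝ := (star x ⬝ᵥ W *ᵥ x).re

/-- The invariant of the inversion. -/
structure InvOK (W X : Matrix (Fin R) (Fin R) ℂ) (k : ℕ) : Prop where
  herm : Xᴴ = X
  psd : ∀ x, 0 ≤ qform X x
  zero : ∀ i j : Fin R, k ≤ i → X i j = 0
  inv : ∀ i : Fin R, (i : ℕ) < k → X *ᵥ W.col i = Pi.single i 1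

variable {W X : Matrix (Fin R) (Fin R) ℂ} {k : Fin R}

lemma col_eq_mulVec (W : Matrix (Fin R) (Fin R) ℂ) (i : Fin R) : W.col i = W *ᵥ Pi.single i 1 := by
  simp

lemma star_dot_mulVec_comm (hW : Wᴴ = W) (x y : Fin R → ℂ) :
    star (star x ⬝ᵥ W *ᵥ y) = star y ⬝ᵥ W *ᵥ x := by
  rw [Matrix.star_dotProduct, star_star, Matrix.star_mulVec, hW, ← Matrix.dotProduct_mulVec]

/-- Gram–Schmidt for the form `W`: since `X` is Hermitian and `X W eᵢ = eᵢ`, the correction `X W eₖ`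
has the same pairing with `W eᵢ` as `eₖ` itself. -/
lemma invVec_orth (hW : Wᴴ = W) (h : InvOK W X k) (i : Fin R) (hi : i < k) :
    star (invVec W X k) ⬝ᵥ W.col i = 0 := by
  have e : star (X *ᵥ W.col k) ⬝ᵥ W.col i = W k i := by
    rw [Matrix.star_mulVec, h.herm, ← Matrix.dotProduct_mulVec, h.inv i hi]
    have := congrFun (congrFun hW k) i
    simpa [dotProduct_single, Matrix.conjTranspose_apply] using this
  rw [invVec, star_sub, sub_dotProduct, e]
  have : star (Pi.single k (1 : ℂ) : Fin R → ℂ) = Pi.single k 1 := by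
    rw [← Pi.single_star, star_one]
  rw [this, single_dotProduct]; simp

/-- Write p for the new direction. The correction `X W eₖ` is supported on indices below `k`, where
`p* W` vanishes by `invVec_orth`. Hence `p* W p = p* W eₖ`, and the left-hand side is real. -/
lemma star_invPivot (hW : Wᴴ = W) (h : InvOK W X k) :
    star (invPivot W X k) = star (invVec W X k) ⬝ᵥ W.col k ∧
      invPivot W X k = star (invVec W X k) ⬝ᵥ W *ᵥ invVec W X k ∧
      star (invPivot W X k) = invPivot W X k := by
  set p := invVec W X k with hp
  have h1 : star (invPivot W X k) = star p ⬝ᵥ W.col k := by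
    have : invPivot W X k = star (Pi.single k (1 : ℂ) : Fin R → ℂ) ⬝ᵥ W *ᵥ p := by
      rw [← Pi.single_star, star_one, single_dotProduct, one_mul]; rfl
    rw [this, star_dot_mulVec_comm hW, col_eq_mulVec]
  have h2 : star p ⬝ᵥ W *ᵥ p = star p ⬝ᵥ W.col k := by
    have e : W *ᵥ p = W.col k - W *ᵥ (X *ᵥ W.col k) := by
      rw [hp, invVec, Matrix.mulVec_sub, ← col_eq_mulVec]
    rw [e, dotProduct_sub, sub_eq_self, Matrix.dotProduct_mulVec, dotProduct]
    refine Finset.sum_eq_zero fun i _ => ?_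
    by_cases hi : i < k
    · have : (star p ᵥ* W) i = star p ⬝ᵥ W.col i := rfl
      rw [this, invVec_orth hW h i hi, zero_mul]
    · have : (X *ᵥ W.col k) i = 0 := by
        simp only [Matrix.mulVec, dotProduct]
        exact Finset.sum_eq_zero fun j _ => by rw [h.zero i j (not_lt.1 hi), zero_mul]
      rw [this, mul_zero]
  have h3 : star (star p ⬝ᵥ W *ᵥ p) = star p ⬝ᵥ W *ᵥ p := star_dot_mulVec_comm hW p p
  rw [h2, ← h1, star_star] at h3
  exact ⟨h1, by rw [h2, ← h1, ← h3], h3.symm⟩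

/-- The direction is nonzero because row `k` of `X` is still zero, so that its `k`-th coordinate is
1. -/
lemma invPivot_pos (hW : Wᴴ = W) (h : InvOK W X k) (hpos : ∀ x, x ≠ 0 → 0 < qform W x) :
    0 < (invPivot W X k).re := by
  rw [(star_invPivot hW h).2.1]
  refine hpos _ fun h0 => ?_
  have := congrFun h0 k
  have hz : (X *ᵥ W.col k) k = 0 := by
    simp only [Matrix.mulVec, dotProduct]
    exact Finset.sum_eq_zero fun j _ => by rw [h.zero k j le_rfl, zero_mul]
  simp [invVec, hz] at this

/-- The correction d⁻¹pp* annihilates the earlier columns `W eᵢ` by orthogonality and contributes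
exactly `p` at `W eₖ`, because `p* W eₖ = d`. A positive `d` keeps `X` positive semidefinite. -/
lemma InvOK.step (hW : Wᴴ = W) (h : InvOK W X k) (hd : 0 < (invPivot W X k).re) :
    InvOK W (invStep W X k) (k + 1) := by
  obtain ⟨h1, h2, h3⟩ := star_invPivot hW h
  set p := invVec W X k with hp
  set d := invPivot W X k with hdd
  have hd0 : d ≠ 0 := fun h0 => by rw [h0] at hd; simp at hd
  have hdr : d = ((d.re : ℝ) : ℂ) := (Complex.conj_eq_iff_re.1 h3).symm
  refine ⟨?_, fun x => ?_, fun i j hij => ?_, fun i hi => ?_⟩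
  · rw [invStep, Matrix.conjTranspose_add, h.herm, Matrix.conjTranspose_smul,
      Matrix.conjTranspose_vecMulVec, star_star, star_inv₀, h3]
  · have e : qform (invStep W X k) x = qform X x + d.re⁻¹ * Complex.normSq (star p ⬝ᵥ x) := by
      simp only [qform, invStep, Matrix.add_mulVec, dotProduct_add, Complex.add_re,
        Matrix.smul_mulVec, dotProduct_smul, smul_eq_mul, Matrix.vecMulVec_mulVec]
      congr 1
      rw [← hp, ← hdd, hdr, ← Complex.ofReal_inv, Complex.re_ofReal_mul]
      congr 1
      have : star x ⬝ᵥ p = star (star p ⬝ᵥ x) :=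
        Matrix.star_dotProduct _ _
      simp only [op_smul_eq_smul, smul_eq_mul, this]
      rw [RCLike.star_def, Complex.mul_conj, Complex.ofReal_re]
    rw [e]
    have := h.psd x
    have := Complex.normSq_nonneg (star p ⬝ᵥ x)
    positivity
  · have hX : X i j = 0 := h.zero i j (by omega)
    have hpi : p i = 0 := by
      have hik : i ≠ k := fun e => by rw [e] at hij; omega
      have hz : (X *ᵥ W.col k) i = 0 := by
        simp only [Matrix.mulVec, dotProduct]
        exact Finset.sum_eq_zero fun j _ => by rw [h.zero i j (by omega), zero_mul]
      simp [hp, invVec, hz, hik]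
    simp [invStep, ← hp, hX, hpi, Matrix.vecMulVec_apply]
  · have e : invStep W X k *ᵥ W.col i =
        X *ᵥ W.col i + (d⁻¹ * (star p ⬝ᵥ W.col i)) • p := by
      rw [invStep, Matrix.add_mulVec, Matrix.smul_mulVec, Matrix.vecMulVec_mulVec,
        op_smul_eq_smul, smul_smul]
    rw [e]
    rcases Nat.lt_succ_iff_lt_or_eq.1 hi with hi | hi
    · rw [h.inv i hi, hp, invVec_orth hW h i hi]; simp
    · obtain rfl : i = k := Fin.ext hi
      rw [← h1, h3, inv_mul_cancel₀ hd0, one_smul, hp, invVec]; abel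

lemma InvOK.zero_start (W : Matrix (Fin R) (Fin R) ℂ) : InvOK W 0 0 :=
  ⟨by simp, by simp [qform], by simp, by simp⟩

lemma invOK_of_pivots (hW : Wᴴ = W) {n : ℕ} (hn : n ≤ R)
    (h : ∀ k : Fin R, (k : ℕ) < n → 0 < (invPivot W (invIter W k) k).re) :
    InvOK W (invIter W n) n := by
  induction n with
  | zero => exact InvOK.zero_start W
  | succ n ih =>
    rw [invIter, dif_pos (by omega)]
    exact (ih (by omega) fun k hk => h k (by omega)).step hW (h ⟨n, by omega⟩ (by simp))

lemma pivots_pos (hW : Wᴴ = W) (hpos : ∀ x, x ≠ 0 → 0 < qform W x) (k : Fin R) :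
    0 < (invPivot W (invIter W k) k).re := by
  obtain ⟨k, hk⟩ := k
  induction k using Nat.strong_induction_on with
  | _ k ih =>
    exact invPivot_pos hW (k := ⟨k, hk⟩)
      (invOK_of_pivots hW (by omega) fun j hj => ih j hj j.2) hpos

lemma InvOK.mul_eq_one (h : InvOK W X R) : X * W = 1 := by
  ext i j
  have := congrFun (h.inv j j.2) i
  rw [Matrix.one_apply, Matrix.mul_apply]
  simpa [Matrix.mulVec, dotProduct, Pi.single_apply, Matrix.col_apply] using this

lemma invIter_mul (hW : Wᴴ = W) (hpos : ∀ x, x ≠ 0 → 0 < qform W x) : invIter W R * W = 1 :=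
  (invOK_of_pivots hW le_rfl fun k _ => pivots_pos hW hpos k).mul_eq_one

/-- The converse direction of the test: positive pivots make `X = W⁻¹` a sum of nonnegative rank-one
matrices, and `x* W x = (W x)* X (W x)`. Nothing about the positivity of `W` is assumed beforehand.
-/
lemma qform_nonneg_of_pivots (hW : Wᴴ = W)
    (h : ∀ k : Fin R, 0 < (invPivot W (invIter W k) k).re) (x : Fin R → ℂ) : 0 ≤ qform W x := by
  have hX := invOK_of_pivots hW le_rfl fun k _ => h k
  have := hX.psd (W *ᵥ x)
  rwa [qform, Matrix.mulVec_mulVec, hX.mul_eq_one, Matrix.one_mulVec, Matrix.star_mulVec, hW,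
    ← Matrix.dotProduct_mulVec] at this

end Inversion

variable {S : FactorizedSystem}

/-- The array `23` becomes the new direction, for the step number in variable `17`. -/
def dirProgram : Program :=
  .seq (forLoop 5 0 (.seq (dot ⟨22, 5, 7⟩ ⟨21, 7, 17⟩)
      (block (.intConst (sc 6) 0) [.arith .sub ⟨23, 5, 3⟩ (sc 6) (sc 5)])))
    (.instr (.arith .add ⟨23, 17, 3⟩ ⟨23, 17, 3⟩ (sc 13)))

lemma Runs.dirProgram {σ : Store S.Wire} (hB : Base σ) (k : Fin S.R) (hk : σ.nat 17 = k) :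
    ∃ σ', Runs dirProgram σ (S.R * (6 * S.R + 12) + 5) σ' ∧ Agree [5, 7] [5, 6, 23] σ σ' ∧
      ∀ i : Fin S.R, σ'.num 23 i 0 =
        invVec (matOf σ 21 S.R S.R) (matOf σ 22 S.R S.R) k i := by
  obtain ⟨σ₁, r1, A1, -, h1⟩ := Runs.forLoop (S := S) (x := 5) (y := 0) (n := S.R)
    (tb := 6 * S.R + 9) (body := .seq (HybridLS.dot ⟨22, 5, 7⟩ ⟨21, 7, 17⟩)
      (HybridLS.block (.intConst (sc 6) 0) [.arith .sub ⟨23, 5, 3⟩ (sc 6) (sc 5)])) (σ := σ)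
    (fun i τ => Agree [5, 7] [5, 6, 23] σ τ ∧ τ.nat 5 = i ∧ ∀ i' < i, τ.num 23 i' 0 =
      - ∑ l ∈ Finset.range S.R, σ.num 22 i' l * σ.num 21 l k)
    ⟨(Agree.refl σ).setNat (by simp) _, by simp, by simp⟩
    (fun i τ h => ⟨h.2.1, by rw [h.1.nat 0 (by decide), hB.size]⟩)
    (fun i τ hi ⟨hA, h5, hs⟩ => by
      have hBτ := hB.agree hA
      obtain ⟨τ₁, q1, B1, d1⟩ := Runs.dot (S := S) (ra := ⟨22, 5, 7⟩) (rb := ⟨21, 7, 17⟩) hBτ.size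
        hBτ.zero hBτ.one (by decide) (by decide)
      have hB1 := hBτ.agree B1
      have e17 : τ.nat 17 = k := by rw [hA.nat 17 (by decide), hk]
      simp only [Ref.at, h5, e17, hA.num 22 (by decide), hA.num 21 (by decide)] at d1
      norm_num at d1
      have e5 : τ₁.nat 5 = i := by rw [B1.nat 5 (by decide), h5]
      refine ⟨_, (q1.seq (Runs.block τ₁ _ _ (by simp [Instr.IsDet]))).mono
        (by simp only [List.length_cons, List.length_nil]; omega), ?_, ?_, ?_, ?_, ?_⟩
      · simp [execDet, hB1.one]
      · simp [execDet, e5]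
      · exact (((hA.trans B1.mono).set (by simp) _).set (by simp) _).setNat (by simp) _
      · simp
      · intro i' hi'
        have e23 : τ₁.num 23 = τ.num 23 := B1.num 23 (by decide)
        rcases Nat.lt_succ_iff_lt_or_eq.1 hi' with h | h
        · simp [execDet, Store.set_num, hB1.zero, e5, h.ne, e23, hs i' h]
        · subst h
          simp [execDet, Store.set_num, Store.get, hB1.zero, e5, Op.eval, d1])
  have hB1 := hB.agree A1
  have e17 : σ₁.nat 17 = k := by rw [A1.nat 17 (by decide), hk]
  refine ⟨_, (r1.seq (Runs.instr σ₁ (by trivial))).mono (by ring_nf; omega),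
    A1.set (by simp) _, fun i => ?_⟩
  have hsum : - ∑ l ∈ Finset.range S.R, σ.num 22 i l * σ.num 21 l k =
      - (matOf σ 22 S.R S.R *ᵥ (matOf σ 21 S.R S.R).col k) i := by
    rw [Finset.sum_range]; rfl
  have e13 : σ₁.num 13 0 0 = 1 := hB1.unit false
  by_cases hik : i = k
  · subst hik
    simp only [execDet, Store.set_num, Store.get, hB1.zero, e17, Op.eval, sc_array, sc_row, sc_col,
      e13, h1 i i.2, hsum, invVec]
    simp; ring
  · have : (i : ℕ) ≠ k := fun h => hik (Fin.ext h)
    simp only [execDet, Store.set_num, hB1.zero, e17, this, h1 i i.2, hsum, invVec]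
    simp [hik]

/-- One step of the inversion; the variable `16` becomes one if the pivot is not positive. -/
def invStepProgram : Program :=
  seqs dirProgram [dot ⟨21, 17, 7⟩ ⟨23, 7, 3⟩,
    block (.intConst (sc 6) 0) [.arith .add (sc 15) (sc 5) (sc 6)],
    -- A bad pivot does not stop the computation, since division is total; it is only recorded in
    -- the flag. The other branch is idle.
    .branch (.reLe (sc 15) (sc 6)) (.instr (.natConst 16 1)) (.instr (.natConst 8 0)),
    forEach 0 (block (.conj (sc 6) ⟨23, 6, 3⟩) [.arith .mul (sc 6) ⟨23, 5, 3⟩ (sc 6),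
      .arith .div (sc 6) (sc 6) (sc 15), .arith .add ⟨22, 5, 6⟩ ⟨22, 5, 6⟩ (sc 6)])]

lemma Runs.invStepProgram {σ : Store S.Wire} (hB : Base σ) (k : Fin S.R) (hk : σ.nat 17 = k) :
    ∃ σ', Runs invStepProgram σ (S.R * (16 * S.R + 24) + 22) σ' ∧
      Agree [5, 6, 7, 8, 16] [5, 6, 15, 22, 23] σ σ' ∧
      matOf σ' 22 S.R S.R = invStep (matOf σ 21 S.R S.R) (matOf σ 22 S.R S.R) k ∧
      σ'.nat 16 = if (invPivot (matOf σ 21 S.R S.R) (matOf σ 22 S.R S.R) k).re ≤ 0 then 1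
        else σ.nat 16 := by
  set W := matOf σ 21 S.R S.R with hW
  set X := matOf σ 22 S.R S.R with hX
  obtain ⟨σ₁, r1, A1, p1⟩ := Runs.dirProgram hB k hk
  rw [← hW, ← hX] at p1
  have hB1 := hB.agree A1
  have e17 : σ₁.nat 17 = k := by rw [A1.nat 17 (by decide), hk]
  obtain ⟨σ₂, r2, A2, d2⟩ := Runs.dot (S := S) (σ := σ₁) (ra := ⟨21, 17, 7⟩) (rb := ⟨23, 7, 3⟩)
    hB1.size hB1.zero hB1.one (by decide) (by decide)
  have hB2 := hB1.agree A2
  have d2' : σ₂.num 5 0 0 = invPivot W X k := by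
    rw [d2, Finset.sum_range, invPivot, Matrix.mulVec, dotProduct]
    refine Finset.sum_congr rfl fun l _ => ?_
    simp only [Ref.at, e17, hB1.zero, A1.num 21 (by decide)]
    norm_num
    rw [p1 l]; rfl
  have r3 := Runs.block (S := S) σ₂ (.intConst (sc 6) 0) [.arith .add (sc 15) (sc 5) (sc 6)]
    (by simp [Instr.IsDet])
  set σ₃ := ([.intConst (sc 6) 0, .arith .add (sc 15) (sc 5) (sc 6)] : List Instr).foldl
    (execDet S) σ₂ with hσ₃
  have A3 : Agree [] [6, 15] σ₂ σ₃ := ((Agree.refl σ₂).set (by simp) _).set (by simp) _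
  have hB3 := hB2.agree A3
  have e15 : σ₃.num 15 0 0 = invPivot W X k := by
    simp [hσ₃, execDet, Store.set_num, Store.get, hB2.zero, Op.eval, d2']
  have e6 : σ₃.num 6 0 0 = 0 := by
    simp [hσ₃, execDet, Store.set_num, hB2.zero]
  have e16 : σ₃.nat 16 = σ.nat 16 := by
    rw [A3.nat 16 (by decide), A2.nat 16 (by decide), A1.nat 16 (by decide)]
  obtain ⟨σ₄, r4, A4, f4⟩ : ∃ σ₄, Runs (.branch (.reLe (sc 15) (sc 6)) (.instr (.natConst 16 1))
      (.instr (.natConst 8 0))) σ₃ 2 σ₄ ∧ Agree [8, 16] [] σ₃ σ₄ ∧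
      σ₄.nat 16 = if (invPivot W X k).re ≤ 0 then 1 else σ.nat 16 := by
    have ht : Test.Holds σ₃ (.reLe (sc 15) (sc 6)) ↔ (invPivot W X k).re ≤ 0 := by
      simp only [Test.Holds, Store.get, sc_array, sc_row, sc_col, hB3.zero, e15, e6,
        Complex.zero_re]
    by_cases h : (invPivot W X k).re ≤ 0
    · exact ⟨_, Runs.branch_pos (ht.2 h) (Runs.instr _ (by trivial)),
        (Agree.refl _).setNat (by simp) _, by simp [execDet, h]⟩
    · exact ⟨_, Runs.branch_neg (mt ht.1 h) (Runs.instr _ (by trivial)),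
        (Agree.refl _).setNat (by simp) _, by simp [execDet, h, e16]⟩
  have hB4 := hB3.agree A4
  have A14 : Agree [7, 8, 16] [5, 6, 15] σ₁ σ₄ := (A2.mono.trans A3.mono).trans A4.mono
  have e23 : ∀ i : Fin S.R, σ₄.num 23 i 0 = invVec W X k i := fun i => by
    rw [A14.num 23 (by decide), p1]
  have e15' : σ₄.num 15 0 0 = invPivot W X k := by rw [A4.num 15 (by decide), e15]
  obtain ⟨σ₅, r5, A5, u5⟩ := Runs.forEach (S := S) (R := S.R) (m := S.R) (y := 0) (a := 22)
    (V := []) (A := [6]) (tb := 7) (σ := σ₄)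
    (body := HybridLS.block (.conj (sc 6) ⟨23, 6, 3⟩) [.arith .mul (sc 6) ⟨23, 5, 3⟩ (sc 6),
      .arith .div (sc 6) (sc 6) (sc 15), .arith .add ⟨22, 5, 6⟩ ⟨22, 5, 6⟩ (sc 6)])
    (fun i j => σ₄.num 22 i j + σ₄.num 23 i 0 * star (σ₄.num 23 j 0) / σ₄.num 15 0 0)
    hB4.size hB4.size hB4.one (by simp) (by decide) (by
      intro τ i j hi hj hA h5 h6 hval
      refine ⟨_, Runs.block τ _ _ (by simp [Instr.IsDet]),
        ((((Agree.refl τ).set (by simp) _).set (by simp) _).set (by simp) _).set (by simp) _,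
        fun i' j' => ?_⟩
      have t3 : τ.nat 3 = 0 := by rw [hA.nat 3 (by decide), hB4.zero]
      have t23 : τ.num 23 = σ₄.num 23 := hA.num 23 (by decide)
      have t15 : τ.num 15 = σ₄.num 15 := hA.num 15 (by decide)
      simp [execDet, Store.set_num, Store.get, t3, h5, h6, hval, t23, t15, Op.eval])
  refine ⟨σ₅, (r1.seq (r2.seq (r3.seq (r4.seq r5)))).mono ?_, ?_, ?_, ?_⟩
  · simp only [List.length_cons, List.length_nil]; ring_nf; omega
  · exact (A1.mono.trans A14.mono).trans A5.mono
  · ext i j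
    simp only [matOf, Matrix.of_apply, u5, i.2, j.2, and_self, if_true, e23, e15']
    rw [A14.num 22 (by decide), A1.num 22 (by decide)]
    simp [invStep, Matrix.vecMulVec_apply, hX, matOf]
    ring
  · rw [A5.nat 16 (by decide), f4]

/-- Compute in the array `22` the inverse of the Hermitian matrix in the array `21`; the variable
`16` becomes one if the matrix is not positive definite. -/
def invert : Program :=
  .seq (forEach 0 (.instr (.intConst ⟨22, 5, 6⟩ 0))) (forLoop 17 0 invStepProgram)

/-- A bound for the running time of `invert`. -/
def invertTime (R : ℕ) : ℕ := R * (R * (16 * R + 28) + 31) + 7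

/-- The flag is never cleared here, so that two inversions in succession can share it. -/
lemma Runs.invert {σ : Store S.Wire} (hB : Base σ) (h16 : σ.nat 16 = 0 ∨ σ.nat 16 = 1) :
    ∃ σ', Runs invert σ (invertTime S.R) σ' ∧
      Agree [5, 6, 7, 8, 16, 17] [5, 6, 15, 22, 23] σ σ' ∧
      matOf σ' 22 S.R S.R = invIter (matOf σ 21 S.R S.R) S.R ∧
      (σ'.nat 16 = 0 ∨ σ'.nat 16 = 1) ∧
      (σ'.nat 16 = 0 ↔ σ.nat 16 = 0 ∧ ∀ k : Fin S.R,
        0 < (invPivot (matOf σ 21 S.R S.R) (invIter (matOf σ 21 S.R S.R) k) k).re) := by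
  set W := matOf σ 21 S.R S.R with hW
  obtain ⟨σ₁, r1, A1, z1⟩ := Runs.forEach (S := S) (R := S.R) (m := S.R) (y := 0) (a := 22)
    (V := []) (A := []) (tb := 1) (body := .instr (.intConst ⟨22, 5, 6⟩ 0)) (σ := σ)
    (fun _ _ => 0) hB.size hB.size hB.one (by simp) (by decide) (by
      intro τ i j hi hj hA h5 h6 _
      refine ⟨_, Runs.instr τ trivial, (Agree.refl τ).set (by simp) _, fun i' j' => ?_⟩
      simp [execDet, Store.set_num, h5, h6])
  have hB1 := hB.agree A1
  obtain ⟨σ₂, r2, A2, -, m2, s2, f2⟩ := Runs.forLoop (S := S) (x := 17) (y := 0) (n := S.R)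
    (tb := S.R * (16 * S.R + 24) + 22) (body := HybridLS.invStepProgram) (σ := σ₁)
    (fun k τ => Agree [5, 6, 7, 8, 16, 17] [5, 6, 15, 22, 23] σ₁ τ ∧ τ.nat 17 = k ∧
      matOf τ 22 S.R S.R = invIter W k ∧ (τ.nat 16 = 0 ∨ τ.nat 16 = 1) ∧
      (τ.nat 16 = 0 ↔ σ.nat 16 = 0 ∧ ∀ j : Fin S.R, (j : ℕ) < k →
        0 < (invPivot W (invIter W j) j).re))
    ⟨(Agree.refl _).setNat (by simp) _, by simp, by
        ext i j
        simp [matOf, z1, invIter],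
      by simpa [A1.nat 16 (by decide)] using h16, by simp [A1.nat 16 (by decide)]⟩
    (fun k τ h => ⟨h.2.1, by rw [h.1.nat 0 (by decide), hB1.size]⟩)
    (fun k τ hk ⟨hA, h17, hm, hs, hf⟩ => by
      have hBτ := hB1.agree hA
      obtain ⟨τ', r, A', m', f'⟩ := Runs.invStepProgram hBτ ⟨k, hk⟩ h17
      have eW : matOf τ 21 S.R S.R = W := by
        rw [matOf, hA.num 21 (by decide), A1.num 21 (by decide)]; rfl
      rw [eW, hm] at m' f'
      refine ⟨τ', r, (hBτ.agree A').one, by rw [A'.nat 17 (by decide), h17],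
        (hA.trans A'.mono).setNat (by simp) _, by simp, ?_, ?_, ?_⟩
      · rw [invIter, dif_pos hk, ← m']; rfl
      · rw [Store.setNat_nat, Function.update_of_ne (by decide), f']
        split_ifs <;> simp [hs]
      · rw [Store.setNat_nat, Function.update_of_ne (by decide), f']
        split_ifs with h
        · simp only [false_iff, not_and, not_forall]
          intro _
          exact ⟨⟨k, hk⟩, Nat.lt_succ_self k, not_lt.2 h⟩
        · rw [hf]
          refine and_congr_right fun _ => ⟨fun H j hj => ?_, fun H j hj => H j (by omega)⟩
          rcases Nat.lt_succ_iff_lt_or_eq.1 hj with hj | hj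
          · exact H j hj
          · obtain rfl : j = ⟨k, hk⟩ := Fin.ext hj
            exact not_le.1 h)
  refine ⟨σ₂, (r1.seq r2).mono ?_, A1.mono.trans A2, m2, s2, ?_⟩
  · unfold invertTime; ring_nf; omega
  · rw [f2]
    exact and_congr_right fun _ => ⟨fun H j => H j j.2, fun H j _ => H j⟩

end

/-! ### Hermitian forms and two-sided spectral tests. -/

section

/-! ### Hermitian forms -/

section Forms
variable {R : ℕ}

/-- The squared Euclidean norm. -/
def nsq {ι : Type*} [Fintype ι] (x : ι → ℂ) : ℝ := ∑ i, ‖x i‖ ^ 2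

lemma nsq_eq_norm_sq {ι : Type*} [Fintype ι] (x : ι → ℂ) : nsq x = ‖WithLp.toLp 2 x‖ ^ 2 := by
  rw [EuclideanSpace.norm_sq_eq]; rfl

lemma nsq_pos {ι : Type*} [Fintype ι] {x : ι → ℂ} (h : x ≠ 0) : 0 < nsq x := by
  obtain ⟨i, hi⟩ := Function.ne_iff.1 h
  exact Finset.sum_pos' (fun _ _ => by positivity)
    ⟨i, Finset.mem_univ _, by have := norm_pos_iff.2 hi; positivity⟩

lemma qform_sub (W W' : Matrix (Fin R) (Fin R) ℂ) (x : Fin R → ℂ) :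
    qform (W - W') x = qform W x - qform W' x := by
  simp [qform, Matrix.sub_mulVec, dotProduct_sub]

lemma qform_smul_one (c : ℝ) (x : Fin R → ℂ) :
    qform ((c : ℂ) • (1 : Matrix (Fin R) (Fin R) ℂ)) x = c * nsq x := by
  rw [qform, Matrix.smul_mulVec, Matrix.one_mulVec, dotProduct_smul, smul_eq_mul,
    ← sum_norm_sq_eq, Complex.re_ofReal_mul, Complex.ofReal_re]
  rfl

lemma abs_qform_le (D : Matrix (Fin R) (Fin R) ℂ) (x : Fin R → ℂ) :
    |qform D x| ≤ ‖D‖ * nsq x := by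
  have h : star x ⬝ᵥ D *ᵥ x = inner ℂ (WithLp.toLp 2 x) (WithLp.toLp 2 (D *ᵥ x)) := by
    rw [EuclideanSpace.inner_toLp_toLp, dotProduct_comm]
  rw [qform, h, nsq_eq_norm_sq]
  refine (Complex.abs_re_le_norm _).trans ((norm_inner_le_norm _ _).trans ?_)
  have := mul_le_mul_of_nonneg_left (Matrix.l2_opNorm_mulVec D (WithLp.toLp 2 x))
    (norm_nonneg (WithLp.toLp 2 x))
  calc _ ≤ _ := this
    _ = _ := by ring

/-- The Hermitian estimate from a matrix of sums of `n` samples. -/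
def hermEst (G : Matrix (Fin R) (Fin R) ℂ) (n : ℕ) : Matrix (Fin R) (Fin R) ℂ :=
  (2 * n : ℂ)⁻¹ • (G + Gᴴ)

lemma hermEst_conjTranspose (G : Matrix (Fin R) (Fin R) ℂ) (n : ℕ) :
    (hermEst G n)ᴴ = hermEst G n := by
  rw [hermEst, Matrix.conjTranspose_smul, Matrix.conjTranspose_add,
    Matrix.conjTranspose_conjTranspose, add_comm]
  simp

/-- Since `H` is Hermitian and the norm is invariant under conjugate transposition, symmetrizing the
estimate does not increase its error. -/
lemma norm_hermEst_sub_le {G H : Matrix (Fin R) (Fin R) ℂ} (hH : Hᴴ = H) {n : ℕ} (hn : 0 < n)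
    {t : ℝ} (h : ‖G - (n : ℂ) • H‖ ≤ n * t) : ‖hermEst G n - H‖ ≤ t := by
  have hn' : (n : ℂ) ≠ 0 := by exact_mod_cast hn.ne'
  have e : hermEst G n - H = (2 * n : ℂ)⁻¹ • ((G - (n : ℂ) • H) + (G - (n : ℂ) • H)ᴴ) := by
    rw [hermEst, Matrix.conjTranspose_sub, Matrix.conjTranspose_smul, hH,
      show G - (n : ℂ) • H + (Gᴴ - star (n : ℂ) • H) = G + Gᴴ - (2 * n : ℂ) • H by
        simp; module, smul_sub, smul_smul, inv_mul_cancel₀ (by simpa using hn'), one_smul]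
  rw [e, norm_smul, norm_inv, norm_mul, Complex.norm_natCast]
  have h2 : ‖(2 : ℂ)‖ = 2 := by simp
  have hn2 : (0 : ℝ) < n := by exact_mod_cast hn
  rw [h2, inv_mul_le_iff₀ (by positivity)]
  refine (norm_add_le _ _).trans ?_
  rw [Matrix.l2_opNorm_conjTranspose]
  linarith

/-- The two matrices whose positivity is tested. -/
def lowerTest (E : Matrix (Fin R) (Fin R) ℂ) (k : ℝ) : Matrix (Fin R) (Fin R) ℂ :=
  E - ((k⁻¹ : ℝ) : ℂ) • 1

/-- The second matrix whose positivity is tested. -/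
def upperTest (E : Matrix (Fin R) (Fin R) ℂ) (k : ℝ) : Matrix (Fin R) (Fin R) ℂ :=
  ((k : ℝ) : ℂ) • 1 - E

lemma lowerTest_conjTranspose {E : Matrix (Fin R) (Fin R) ℂ} (hE : Eᴴ = E) (k : ℝ) :
    (lowerTest E k)ᴴ = lowerTest E k := by
  rw [lowerTest, Matrix.conjTranspose_sub, hE, Matrix.conjTranspose_smul,
    Matrix.conjTranspose_one, RCLike.star_def, Complex.conj_ofReal]

lemma upperTest_conjTranspose {E : Matrix (Fin R) (Fin R) ℂ} (hE : Eᴴ = E) (k : ℝ) :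
    (upperTest E k)ᴴ = upperTest E k := by
  rw [upperTest, Matrix.conjTranspose_sub, hE, Matrix.conjTranspose_smul,
    Matrix.conjTranspose_one, RCLike.star_def, Complex.conj_ofReal]

/-- All pivots of the inversion are positive. -/
def PivotsPos (W : Matrix (Fin R) (Fin R) ℂ) : Prop :=
  ∀ k : Fin R, 0 < (invPivot W (invIter W k) k).re

/-- In the order of Hermitian forms, E ≥ 1/k gives H ≥ 1/k − 1/(4k) ≥ 1/(2k), and E ≤ k gives H ≤ k
+ 1/(4k) ≤ 2k. -/
lemma bounds_of_tests {E H : Matrix (Fin R) (Fin R) ℂ} (hE : Eᴴ = E) {k : ℝ} (hk : 1 ≤ k)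
    (h : ‖E - H‖ ≤ 1 / (4 * k)) (h1 : PivotsPos (lowerTest E k)) (h2 : PivotsPos (upperTest E k))
    (x : Fin R → ℂ) : 1 / (2 * k) * nsq x ≤ qform H x ∧ qform H x ≤ 2 * k * nsq x := by
  have q1 := qform_nonneg_of_pivots (lowerTest_conjTranspose hE k) h1 x
  have q2 := qform_nonneg_of_pivots (upperTest_conjTranspose hE k) h2 x
  rw [lowerTest, qform_sub, qform_smul_one] at q1
  rw [upperTest, qform_sub, qform_smul_one] at q2
  have hx : 0 ≤ nsq x := Finset.sum_nonneg fun _ _ => by positivity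
  have q3 := abs_le.1 ((abs_qform_le (E - H) x).trans (mul_le_mul_of_nonneg_right h hx))
  rw [qform_sub] at q3
  have hk0 : 0 < k := by linarith
  have e1 : 1 / (4 * k) = k⁻¹ / 4 := by field_simp
  have e2 : 1 / (2 * k) = k⁻¹ / 2 := by field_simp
  have hk1 : k⁻¹ ≤ 1 := inv_le_one_of_one_le₀ hk
  have hk2 : 0 < k⁻¹ := by positivity
  rw [e1] at q3
  rw [e2]
  have p1 : 0 ≤ k⁻¹ * nsq x := by positivity
  have p2 : k⁻¹ * nsq x ≤ k * nsq x := mul_le_mul_of_nonneg_right (by linarith) hx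
  constructor <;> linarith [q3.1, q3.2]

/-- The counterpart of `bounds_of_tests`, with the gap needed to absorb the estimation error. It
guarantees that the doubling of the guess comes to an end. -/
lemma tests_of_bounds {E H : Matrix (Fin R) (Fin R) ℂ} (hE : Eᴴ = E) {k : ℝ} (hk : 1 ≤ k)
    (h : ‖E - H‖ ≤ 1 / (4 * k))
    (hH : ∀ x, 2 / k * nsq x ≤ qform H x ∧ qform H x ≤ k / 2 * nsq x) :
    PivotsPos (lowerTest E k) ∧ PivotsPos (upperTest E k) := by
  have hk0 : 0 < k := by linarith
  have hk2 : 0 < k⁻¹ := by positivity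
  have e1 : 1 / (4 * k) = k⁻¹ / 4 := by field_simp
  have hk1 : k⁻¹ ≤ 1 := inv_le_one_of_one_le₀ hk
  have key : ∀ x : Fin R → ℂ, x ≠ 0 → 0 < nsq x ∧ qform H x - k⁻¹ / 4 * nsq x ≤ qform E x ∧
      qform E x ≤ qform H x + k⁻¹ / 4 * nsq x := fun x hx0 => by
    have hx := nsq_pos hx0
    have q3 := abs_le.1 ((abs_qform_le (E - H) x).trans (mul_le_mul_of_nonneg_right h hx.le))
    rw [qform_sub, e1] at q3
    exact ⟨hx, by linarith [q3.1], by linarith [q3.2]⟩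
  constructor
  · refine pivots_pos (lowerTest_conjTranspose hE k) fun x hx0 => ?_
    obtain ⟨hx, q1, q2⟩ := key x hx0
    rw [lowerTest, qform_sub, qform_smul_one]
    have := (hH x).1
    have p := mul_pos hk2 hx
    rw [div_mul_eq_mul_div, div_eq_inv_mul] at this
    nlinarith
  · refine pivots_pos (upperTest_conjTranspose hE k) fun x hx0 => ?_
    obtain ⟨hx, q1, q2⟩ := key x hx0
    rw [upperTest, qform_sub, qform_smul_one]
    have := (hH x).2
    have p : k⁻¹ * nsq x ≤ k * nsq x := mul_le_mul_of_nonneg_right (by linarith) hx.le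
    have p' := mul_pos hk0 hx
    linarith

end Forms

variable {S : FactorizedSystem}

lemma overlap_conj (S : FactorizedSystem) (x y : ℕ) : star (S.overlap x y) = S.overlap y x := by
  simp only [FactorizedSystem.overlap, star_sum, star_mul', star_star, mul_comm]

lemma overlapMat_conjTranspose (S : FactorizedSystem) (ro R : ℕ) :
    (overlapMat S ro ro R R)ᴴ = overlapMat S ro ro R R := by
  ext i j; simp only [overlapMat, Matrix.conjTranspose_apply, Matrix.of_apply, overlap_conj]

/-! ### Calibration -/

/-- The array `21` becomes the Hermitian part of the array `20`, times twice the scalar `11`, plus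
the scalar `12` times the identity. -/
def fillWork : Program :=
  .seq (forEach 0 (block (.conj (sc 6) ⟨20, 6, 5⟩) [.arith .add (sc 6) (sc 6) ⟨20, 5, 6⟩,
      .arith .mul ⟨21, 5, 6⟩ (sc 6) (sc 11)]))
    (forLoop 5 0 (.instr (.arith .add ⟨21, 5, 5⟩ ⟨21, 5, 5⟩ (sc 12))))

/-- A bound for the running time of `fillWork`. -/
def fillTime (R : ℕ) : ℕ := R * (R * 8 + 10) + 7

lemma Runs.fillWork {σ : Store S.Wire} (hB : Base σ) :
    ∃ σ', Runs fillWork σ (fillTime S.R) σ' ∧ Agree [5, 6] [6, 21] σ σ' ∧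
      matOf σ' 21 S.R S.R = σ.num 11 0 0 • (matOf σ 20 S.R S.R + (matOf σ 20 S.R S.R)ᴴ) +
        σ.num 12 0 0 • 1 := by
  obtain ⟨σ₁, r1, A1, u1⟩ := Runs.forEach (S := S) (R := S.R) (m := S.R) (y := 0) (a := 21)
    (V := []) (A := [6]) (tb := 5) (σ := σ)
    (body := HybridLS.block (.conj (sc 6) ⟨20, 6, 5⟩) [.arith .add (sc 6) (sc 6) ⟨20, 5, 6⟩,
      .arith .mul ⟨21, 5, 6⟩ (sc 6) (sc 11)])
    (fun i j => (star (σ.num 20 j i) + σ.num 20 i j) * σ.num 11 0 0)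
    hB.size hB.size hB.one (by simp) (by decide) (by
      intro τ i j hi hj hA h5 h6 hval
      refine ⟨_, Runs.block τ _ _ (by simp [Instr.IsDet]),
        (((Agree.refl τ).set (by simp) _).set (by simp) _).set (by simp) _, fun i' j' => ?_⟩
      have t3 : τ.nat 3 = 0 := by rw [hA.nat 3 (by decide), hB.zero]
      have t20 : τ.num 20 = σ.num 20 := hA.num 20 (by decide)
      have t11 : τ.num 11 = σ.num 11 := hA.num 11 (by decide)
      simp [execDet, Store.set_num, Store.get, t3, h5, h6, t20, t11, Op.eval])
  have hB1 := hB.agree A1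
  obtain ⟨σ₂, r2, A2, -, u2⟩ := Runs.forLoop (S := S) (x := 5) (y := 0) (n := S.R) (tb := 1)
    (body := .instr (.arith .add ⟨21, 5, 5⟩ ⟨21, 5, 5⟩ (sc 12))) (σ := σ₁)
    (fun i τ => Agree [5] [21] σ₁ τ ∧ τ.nat 5 = i ∧ ∀ i' j', τ.num 21 i' j' =
      σ₁.num 21 i' j' + if i' = j' ∧ i' < i then σ₁.num 12 0 0 else 0)
    ⟨(Agree.refl _).setNat (by simp) _, by simp, by simp⟩
    (fun i τ h => ⟨h.2.1, by rw [h.1.nat 0 (by decide), hB1.size]⟩)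
    (fun i τ hi ⟨hA, h5, hs⟩ => by
      have hBτ := hB1.agree hA
      refine ⟨_, Runs.instr τ trivial, hBτ.one, h5, (hA.set (by simp) _).setNat (by simp) _,
        by simp, fun i' j' => ?_⟩
      have e12 : τ.num 12 = σ₁.num 12 := hA.num 12 (by decide)
      simp only [execDet, Store.setNat_num, Store.set_num, Store.get, sc_array, sc_row, sc_col,
        hBτ.zero, h5, e12, Op.eval, hs]
      by_cases h1 : i' = i
      · by_cases h2 : j' = i
        · subst h1 h2; simp
        · have : ¬ i' = j' := fun h => h2 (h ▸ h1)
          simp [h2, this]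
      · have : i' < i + 1 ↔ i' < i := by omega
        simp [h1, this])
  refine ⟨σ₂, (r1.seq r2).mono ?_, A1.mono.trans A2.mono, ?_⟩
  · simp only [fillTime]; ring_nf; omega
  · ext i j
    have e12 : σ₁.num 12 = σ.num 12 := A1.num 12 (by decide)
    simp only [matOf, Matrix.of_apply, u2, u1, i.2, j.2, and_self, if_true, and_true, e12,
      Matrix.add_apply, Matrix.smul_apply, Matrix.conjTranspose_apply, Matrix.one_apply,
      smul_eq_mul, Fin.ext_iff, mul_ite, mul_one, mul_zero]
    ring

/-- Test the positivity of the two matrices for the scalar `kc`. -/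
def testProgram (kc : ℕ) : Program :=
  -- The scalars `11` and `12` are 1/(2n) and −1/k for the lower test, then −1/(2n) and k for the
  -- upper one.
  seqs (block (.arith .add (sc 11) (sc 7) (sc 7)) [.arith .div (sc 11) (sc 13) (sc 11),
      .intConst (sc 6) 0, .arith .div (sc 12) (sc 13) (sc kc), .arith .sub (sc 12) (sc 6) (sc 12)])
    [fillWork, invert,
      block (.intConst (sc 6) 0) [.arith .sub (sc 11) (sc 6) (sc 11),
        .arith .add (sc 12) (sc kc) (sc 6)],
      fillWork, invert]

lemma Runs.testProgram {kc n : ℕ} (hkc : kc = 9 ∨ kc = 10) {k : ℝ} {σ : Store S.Wire}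
    (hB : Base σ) (h7 : σ.num 7 0 0 = n) (hk : σ.num kc 0 0 = (k : ℂ)) (h16 : σ.nat 16 = 0) :
    ∃ σ', Runs (testProgram kc) σ (2 * fillTime S.R + 2 * invertTime S.R + 19) σ' ∧
      Agree [5, 6, 7, 8, 16, 17] [5, 6, 11, 12, 15, 21, 22, 23] σ σ' ∧
      (σ'.nat 16 = 0 ∨ σ'.nat 16 = 1) ∧
      (σ'.nat 16 = 0 ↔ PivotsPos (lowerTest (hermEst (matOf σ 20 S.R S.R) n) k) ∧
        PivotsPos (upperTest (hermEst (matOf σ 20 S.R S.R) n) k)) := by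
  set G := matOf σ 20 S.R S.R with hG
  have r1 := Runs.block (S := S) σ (.arith .add (sc 11) (sc 7) (sc 7))
    [.arith .div (sc 11) (sc 13) (sc 11), .intConst (sc 6) 0, .arith .div (sc 12) (sc 13) (sc kc),
      .arith .sub (sc 12) (sc 6) (sc 12)] (by simp [Instr.IsDet])
  set σ₁ := ([.arith .add (sc 11) (sc 7) (sc 7), .arith .div (sc 11) (sc 13) (sc 11),
    .intConst (sc 6) 0, .arith .div (sc 12) (sc 13) (sc kc),
    .arith .sub (sc 12) (sc 6) (sc 12)] : List Instr).foldl (execDet S) σ with hσ₁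
  have A1 : Agree [] [6, 11, 12] σ σ₁ := (((((Agree.refl σ).set (by simp) _).set (by simp) _).set
    (by simp) _).set (by simp) _).set (by simp) _
  have u13 : σ.num 13 0 0 = 1 := hB.unit false
  have hk6 : kc ≠ 6 ∧ kc ≠ 11 ∧ kc ≠ 12 := by omega
  have e11 : σ₁.num 11 0 0 = (2 * n : ℂ)⁻¹ := by
    simp [hσ₁, execDet, Store.set_num, Store.get, hB.zero, Op.eval, u13, h7, two_mul]
  have e12 : σ₁.num 12 0 0 = -((k⁻¹ : ℝ) : ℂ) := by
    simp [hσ₁, execDet, Store.set_num, Store.get, hB.zero, Op.eval, u13, hk, hk6]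
  have e20 : matOf σ₁ 20 S.R S.R = G := by rw [matOf, A1.num 20 (by decide)]; rfl
  have hB1 := hB.agree A1
  obtain ⟨σ₂, r2, A2, u2⟩ := Runs.fillWork hB1
  have hB2 := hB1.agree A2
  have w2 : matOf σ₂ 21 S.R S.R = lowerTest (hermEst G n) k := by
    rw [u2, e11, e12, e20, lowerTest, hermEst, neg_smul, sub_eq_add_neg]
  have z2 : σ₂.nat 16 = 0 := by rw [A2.nat 16 (by decide), A1.nat 16 (by decide), h16]
  obtain ⟨σ₃, r3, A3, -, s3, f3⟩ := Runs.invert hB2 (Or.inl z2)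
  rw [w2] at f3
  have hB3 := hB2.agree A3
  have A13 : Agree [5, 6, 7, 8, 16, 17] [5, 6, 15, 21, 22, 23] σ₁ σ₃ := A2.mono.trans A3.mono
  have r4 := Runs.block (S := S) σ₃ (.intConst (sc 6) 0) [.arith .sub (sc 11) (sc 6) (sc 11),
    .arith .add (sc 12) (sc kc) (sc 6)] (by simp [Instr.IsDet])
  set σ₄ := ([.intConst (sc 6) 0, .arith .sub (sc 11) (sc 6) (sc 11),
    .arith .add (sc 12) (sc kc) (sc 6)] : List Instr).foldl (execDet S) σ₃ with hσ₄
  have A4 : Agree [] [6, 11, 12] σ₃ σ₄ :=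
    (((Agree.refl σ₃).set (by simp) _).set (by simp) _).set (by simp) _
  have hB4 := hB3.agree A4
  have k3 : σ₃.num kc 0 0 = (k : ℂ) := by
    rcases hkc with rfl | rfl <;> rw [A13.num _ (by decide), A1.num _ (by decide), hk]
  have e11' : σ₄.num 11 0 0 = -(2 * n : ℂ)⁻¹ := by
    simp [hσ₄, execDet, Store.set_num, Store.get, hB3.zero, Op.eval, A13.num 11 (by decide), e11]
  have e12' : σ₄.num 12 0 0 = (k : ℂ) := by
    simp [hσ₄, execDet, Store.set_num, Store.get, hB3.zero, Op.eval, k3, hk6]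
  have e20' : matOf σ₄ 20 S.R S.R = G := by
    rw [matOf, A4.num 20 (by decide), A13.num 20 (by decide), A1.num 20 (by decide)]; rfl
  obtain ⟨σ₅, r5, A5, u5⟩ := Runs.fillWork hB4
  have hB5 := hB4.agree A5
  have w5 : matOf σ₅ 21 S.R S.R = upperTest (hermEst G n) k := by
    rw [u5, e11', e12', e20', upperTest, hermEst, neg_smul]; abel
  have z5 : σ₅.nat 16 = σ₃.nat 16 := by rw [A5.nat 16 (by decide), A4.nat 16 (by decide)]
  obtain ⟨σ₆, r6, A6, -, s6, f6⟩ := Runs.invert hB5 (by rw [z5]; exact s3)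
  rw [w5, z5, f3, z2] at f6
  refine ⟨σ₆, (r1.seq (r2.seq (r3.seq (r4.seq (r5.seq r6))))).mono ?_, ?_, s6, ?_⟩
  · simp only [List.length_cons, List.length_nil]; omega
  · exact ((A1.mono.trans A13.mono).trans (A4.mono.trans A5.mono)).trans A6.mono
  · rw [f6]
    simp only [true_and, PivotsPos]

end

/-! ### Sample factors and the search for spectral bounds. -/

section

variable {S : FactorizedSystem}

/-- A factor for sample numbers that makes all failure probabilities small. -/
def GoodFactor (K : ℕ) (δ : ℝ) : Prop :=
  ∀ (R n : ℕ) (x t : ℝ), 1 ≤ R → 1 ≤ x → K * R * x / 16 ≤ n * t ^ 2 →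
    deviationProb R n t ≤ δ / x

/-- With K ≥ 4096(7 + 2/δ) the exponent nt²/256 is at least 7R + 2x/δ. The first term absorbs 625^R
≤ e^(7R), and the second one gives e^(−2x/δ) ≤ δ/(2x). -/
lemma exists_goodFactor {δ : ℝ} (hδ : 0 < δ) : ∃ K : ℕ, GoodFactor K δ := by
  obtain ⟨K, hK⟩ := exists_nat_ge (4096 * (7 + 2 / δ))
  have hK0 : (0 : ℝ) < K := lt_of_lt_of_le (by positivity) hK
  refine ⟨K, fun R n x t hR hx hn => ?_⟩
  have hR' : (1 : ℝ) ≤ R := by exact_mod_cast hR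
  have hRx : (R : ℝ) ≤ R * x := by nlinarith
  have hxR : x ≤ R * x := by nlinarith
  have h1 : 7 * R + 2 / δ * x ≤ n * t ^ 2 / 256 := by
    have h2 : 4096 * (7 + 2 / δ) * (R * x) ≤ K * (R * x) :=
      mul_le_mul_of_nonneg_right hK (by positivity)
    have h3 : 2 / δ * x ≤ 2 / δ * (R * x) := mul_le_mul_of_nonneg_left hxR (by positivity)
    nlinarith
  have h625 : (625 : ℝ) ≤ Real.exp 7 := by
    have h2 : (2.7 : ℝ) ≤ Real.exp 1 := by linarith [Real.exp_one_gt_d9]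
    calc (625 : ℝ) ≤ 2.7 ^ 7 := by norm_num
      _ ≤ Real.exp 1 ^ 7 := pow_le_pow_left₀ (by norm_num) h2 7
      _ = _ := by rw [← Real.exp_nat_mul]; norm_num
  have h4 : (625 : ℝ) ^ R ≤ Real.exp (7 * R) := by
    rw [mul_comm, Real.exp_nat_mul]
    exact pow_le_pow_left₀ (by norm_num) h625 R
  have h5 : Real.exp (-(n * t ^ 2 / 256)) ≤ Real.exp (-(7 * R)) * Real.exp (-(2 / δ * x)) := by
    rw [← Real.exp_add]; exact Real.exp_le_exp.2 (by linarith)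
  have hy : 0 < 2 / δ * x := by positivity
  have h6 : Real.exp (-(2 / δ * x)) ≤ (2 / δ * x)⁻¹ := by
    rw [Real.exp_neg]
    exact inv_anti₀ hy (by linarith [Real.add_one_le_exp (2 / δ * x)])
  calc deviationProb R n t
      ≤ 2 * Real.exp (7 * R) * (Real.exp (-(7 * R)) * (2 / δ * x)⁻¹) := by
        unfold deviationProb; gcongr
        exact h5.trans (by gcongr)
    _ = δ / x := by
        rw [Real.exp_neg]
        have := Real.exp_pos (7 * R)
        field_simp

/-! ### Calibration -/

/-- One round of the calibration. -/
def calibrateRound (K kc : ℕ) : Program :=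
  .seq (block (.arith .add (sc kc) (sc kc) (sc kc)) [.natConst 16 0, .intConst (sc 8) K,
      .ofNat (sc 6) 0, .arith .mul (sc 8) (sc 8) (sc 6), .arith .mul (sc 8) (sc 8) (sc kc),
      .arith .mul (sc 8) (sc 8) (sc kc), .arith .mul (sc 8) (sc 8) (sc kc)])
    (.seq estimate (testProgram kc))

/-- The scalar `kc` becomes a number such that the spectrum of the Gram matrix lies between
`1 / (2 kc)` and `2 kc`. -/
def calibrate (K kc : ℕ) : Program :=
  .seq (block (.intConst (sc kc) 1) [.natConst 16 1]) (.loop (.natLt 3 16) (calibrateRound K kc))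

/-- The inputs of the calibration. -/
structure CalibrateInput (σ : Store S.Wire) (ro : ℕ) : Prop where
  base : Base σ
  row : σ.nat 11 = ro
  col : σ.nat 12 = ro
  cols : σ.nat 13 = S.R

lemma CalibrateInput.agree {V A : List ℕ} {σ τ : Store S.Wire} {ro : ℕ}
    (h : CalibrateInput σ ro) (h' : Agree V A σ τ)
    (hV : 0 ∉ V ∧ 3 ∉ V ∧ 4 ∉ V ∧ 11 ∉ V ∧ 12 ∉ V ∧ 13 ∉ V := by decide)
    (hA : 13 ∉ A ∧ 14 ∉ A := by decide) : CalibrateInput τ ro where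
  base := h.base.agree h' ⟨hV.1, hV.2.1, hV.2.2.1⟩ hA
  row := by rw [h'.nat 11 hV.2.2.2.1, h.row]
  col := by rw [h'.nat 12 hV.2.2.2.2.1, h.col]
  cols := by rw [h'.nat 13 hV.2.2.2.2.2, h.cols]

/-- A bound for the running time of a round with `n` samples. -/
def roundTime (L R n : ℕ) : ℕ := estimateTime L R R n + 2 * fillTime R + 2 * invertTime R + 36

/-- The numbers `k` that are acceptable results of the calibration. -/
def SpectralBound (S : FactorizedSystem) (ro : ℕ) (k : ℝ) : Prop :=
  ∀ x, 1 / (2 * k) * nsq x ≤ qform (overlapMat S ro ro S.R S.R) x ∧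
    qform (overlapMat S ro ro S.R S.R) x ≤ 2 * k * nsq x

/-- For the doubled guess k = 2^(m+1) the error must be t = 1/(4k). Two of the factors k in the
sample number pay for t², and the third leaves nt² ≥ KRk/16, so that the failure probability is δ/k
and summable over the rounds. -/
lemma tri_calibrateRound {K kc L m ro : ℕ} {δ : ℝ} (hK : GoodFactor K δ)
    (hkc : kc = 9 ∨ kc = 10) (hR : 1 ≤ S.R) (hL : ∀ c, (S.inputGates c).length ≤ L)
    {σ : Store S.Wire} (hC : CalibrateInput σ ro) (hk : σ.num kc 0 0 = ((2 ^ m : ℝ) : ℂ)) :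
    Tri (calibrateRound K kc) σ (roundTime L S.R (K * S.R * 8 ^ (m + 1) + 1)) (δ / 2 ^ (m + 1))
      fun σ' => Agree [5, 6, 7, 8, 9, 10, 14, 15, 16, 17]
          [5, 6, 7, 8, kc, 11, 12, 15, 20, 21, 22, 23] σ σ' ∧
        σ'.num kc 0 0 = ((2 ^ (m + 1) : ℝ) : ℂ) ∧ (σ'.nat 16 = 0 ∨ σ'.nat 16 = 1) ∧
        (σ'.nat 16 = 0 → SpectralBound S ro (2 ^ (m + 1))) ∧
        ((∀ x, 2 / (2 ^ (m + 1)) * nsq x ≤ qform (overlapMat S ro ro S.R S.R) x ∧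
          qform (overlapMat S ro ro S.R S.R) x ≤ 2 ^ (m + 1) / 2 * nsq x) → σ'.nat 16 = 0) := by
  have r1 := Runs.block (S := S) σ (.arith .add (sc kc) (sc kc) (sc kc)) [.natConst 16 0,
    .intConst (sc 8) K, .ofNat (sc 6) 0, .arith .mul (sc 8) (sc 8) (sc 6),
    .arith .mul (sc 8) (sc 8) (sc kc), .arith .mul (sc 8) (sc 8) (sc kc),
    .arith .mul (sc 8) (sc 8) (sc kc)] (by simp [Instr.IsDet])
  set σ₁ := ([.arith .add (sc kc) (sc kc) (sc kc), .natConst 16 0,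
    .intConst (sc 8) K, .ofNat (sc 6) 0, .arith .mul (sc 8) (sc 8) (sc 6),
    .arith .mul (sc 8) (sc 8) (sc kc), .arith .mul (sc 8) (sc 8) (sc kc),
    .arith .mul (sc 8) (sc 8) (sc kc)] : List Instr).foldl (execDet S) σ with hσ₁
  have A1 : Agree [16] [6, 8, kc] σ σ₁ :=
    ((((((((Agree.refl σ).set (by simp) _).setNat (by simp) _).set (by simp) _).set
      (by simp) _).set (by simp) _).set (by simp) _).set (by simp) _).set (by simp) _
  have hne : kc ≠ 6 ∧ kc ≠ 8 := by omega
  have k1 : σ₁.num kc 0 0 = ((2 ^ (m + 1) : ℝ) : ℂ) := by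
    simp [hσ₁, execDet, Store.set_num, Store.get, hC.base.zero, Op.eval, hk, hne, pow_succ, mul_two]
  have t1 : σ₁.num 8 0 0 = ((K * S.R * 8 ^ (m + 1) : ℕ) : ℝ) := by
    have e8 : (8 : ℂ) ^ (m + 1) = 2 ^ (m + 1) * 2 ^ (m + 1) * 2 ^ (m + 1) := by
      rw [← mul_pow, ← mul_pow]; norm_num
    push_cast
    rw [e8]
    simp [hσ₁, execDet, Store.set_num, Store.get, hC.base.zero, Op.eval, hk, hne, pow_succ, mul_two,
      hC.base.size]
    ring
  have z1 : σ₁.nat 16 = 0 := by simp [hσ₁, execDet]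
  have hC1 : CalibrateInput σ₁ ro := by
    rcases hkc with rfl | rfl <;> exact hC.agree A1
  set n := K * S.R * 8 ^ (m + 1) + 1 with hn
  set t : ℝ := 1 / (4 * 2 ^ (m + 1)) with ht
  have h2m : (1 : ℝ) ≤ 2 ^ (m + 1) := one_le_pow₀ (by norm_num)
  have hdev : deviationProb S.R n t ≤ δ / 2 ^ (m + 1) := by
    refine hK S.R n _ t hR h2m ?_
    have e8 : (8 : ℝ) ^ (m + 1) = 2 ^ (m + 1) * 2 ^ (m + 1) * 2 ^ (m + 1) := by
      rw [← mul_pow, ← mul_pow]; norm_num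
    have hn' : (K * S.R * 8 ^ (m + 1) : ℝ) ≤ n := by rw [hn]; push_cast; linarith
    calc (K * S.R * 2 ^ (m + 1) / 16 : ℝ) = K * S.R * 8 ^ (m + 1) * t ^ 2 := by
          rw [ht, e8]; field_simp; norm_num
      _ ≤ _ := mul_le_mul_of_nonneg_right hn' (sq_nonneg _)
  have est := tri_estimate (S := S) (L := L) (m := S.R) (n := n) (t := t) (σ := σ₁)
    ⟨hC1.base, t1, hC1.row, hC1.col⟩ (Nat.cast_nonneg _)
    (by rw [Nat.floor_natCast]) hC1.cols hL hR hR le_rfl (by positivity)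
  refine (Tri.seq_runs r1 (Tri.seq (t₂ := 2 * fillTime S.R + 2 * invertTime S.R + 19)
    (η₂ := 0) est le_rfl (Post := fun σ' => _) fun σ₂ h2 => ?_)).mono ?_ (by simpa using hdev)
    (fun σ' h => h)
  · obtain ⟨A2, n2, d2⟩ := h2
    have hC2 := hC1.agree A2
    have k2 : σ₂.num kc 0 0 = ((2 ^ (m + 1) : ℝ) : ℂ) := by
      rcases hkc with rfl | rfl <;> rw [A2.num _ (by decide), k1]
    obtain ⟨σ₃, r3, A3, s3, f3⟩ := Runs.testProgram hkc hC2.base n2 k2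
      (by rw [A2.nat 16 (by decide), z1])
    have hest := norm_hermEst_sub_le (overlapMat_conjTranspose S ro S.R) (by omega) d2
    have herm := hermEst_conjTranspose (matOf σ₂ 20 S.R S.R) n
    refine r3.tri ⟨?_, ?_, s3, fun h0 => ?_, fun hx => ?_⟩
    · rcases hkc with rfl | rfl <;> exact (A1.mono.trans A2.mono).trans A3.mono
    · rcases hkc with rfl | rfl <;> rw [A3.num _ (by decide), k2]
    · have := f3.1 h0
      exact bounds_of_tests herm h2m hest this.1 this.2
    · exact f3.2 (tests_of_bounds herm h2m hest hx)
  · simp only [roundTime, List.length_cons, List.length_nil]; omega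

lemma Tri.loop_step {t : Test} {P : Program} {σ : Store S.Wire} {t₁ t₂ : ℕ} {η₁ η₂ : ℝ}
    {Mid Post : Store S.Wire → Prop} (ht : t.Holds σ) (h₁ : Tri P σ t₁ η₁ Mid) (hη : 0 ≤ η₂)
    (h₂ : ∀ σ', Mid σ' → Tri (.loop t P) σ' t₂ η₂ Post) :
    Tri (.loop t P) σ (t₁ + t₂ + 1) (η₁ + η₂) Post := fun φ hφ =>
  (WP.loop_step ht (h₁ (φ + η₂) (by positivity)) fun σ' hσ' => h₂ σ' hσ' φ hφ).mono le_rfl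
    (fun σ' h => ⟨h, le_rfl⟩) (by linarith)

/-- The running time of a calibration with at most `M` rounds. -/
def calibrateTime (K L R M : ℕ) : ℕ := (roundTime L R (K * R + 1) + 1) * 8 ^ (M + 1) + 5

/-- Only the sample number grows with `m`, and it grows at most by the factor 8^m; all other terms
may be multiplied by it too. -/
lemma roundTime_le (K L R m : ℕ) :
    roundTime L R (K * R * 8 ^ m + 1) ≤ roundTime L R (K * R + 1) * 8 ^ m := by
  have h : 1 ≤ 8 ^ m := Nat.one_le_pow _ _ (by norm_num)
  simp only [roundTime, estimateTime]
  have h1 : K * R * 8 ^ m + 1 ≤ (K * R + 1) * 8 ^ m := by nlinarith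
  have h2 : ∀ a : ℕ, a ≤ a * 8 ^ m := fun a => Nat.le_mul_of_pos_right _ h
  calc _ ≤ R * (R * ((K * R + 1) * 8 ^ m * (16 * L + 52) + 14 * 8 ^ m) + 12 * 8 ^ m) + 7 * 8 ^ m +
        2 * fillTime R * 8 ^ m + 2 * invertTime R * 8 ^ m + 36 * 8 ^ m := by
        refine Nat.add_le_add (Nat.add_le_add (Nat.add_le_add (Nat.add_le_add ?_ (h2 7)) (h2 _))
          (h2 _)) (h2 36)
        refine Nat.mul_le_mul_left _ (Nat.add_le_add (Nat.mul_le_mul_left _ (Nat.add_le_add ?_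
          (h2 14))) (h2 12))
        exact Nat.mul_le_mul_right _ h1
    _ = _ := by ring

/-- Induction on the number of rounds left. From the guess 2^m on, the failure bound δ/2^m splits
into δ/2^(m+1) for the next round and the same for all later ones, and the times form a geometric
sum of ratio 8. A good estimate must pass the tests at 2^M ≥ 2q. -/
lemma tri_calibrate {K kc L M ro : ℕ} {δ q : ℝ} (hδ : 0 < δ) (hK : GoodFactor K δ)
    (hkc : kc = 9 ∨ kc = 10) (hR : 1 ≤ S.R) (hL : ∀ c, (S.inputGates c).length ≤ L)
    {σ : Store S.Wire} (hC : CalibrateInput σ ro) (hq : 0 < q)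
    (hM : 2 * q ≤ 2 ^ M) (hM1 : 1 ≤ M)
    (hspec : ∀ x, q⁻¹ * nsq x ≤ qform (overlapMat S ro ro S.R S.R) x ∧
      qform (overlapMat S ro ro S.R S.R) x ≤ q * nsq x) :
    Tri (calibrate K kc) σ (calibrateTime K L S.R M) δ fun σ' =>
      Agree [5, 6, 7, 8, 9, 10, 14, 15, 16, 17]
        [5, 6, 7, 8, kc, 11, 12, 15, 20, 21, 22, 23] σ σ' ∧
      ∃ k : ℝ, 1 ≤ k ∧ k ≤ 2 ^ M ∧ σ'.num kc 0 0 = (k : ℂ) ∧ SpectralBound S ro k := by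
  set V : List ℕ := [5, 6, 7, 8, 9, 10, 14, 15, 16, 17] with hV
  set A : List ℕ := [5, 6, 7, 8, kc, 11, 12, 15, 20, 21, 22, 23] with hA
  set Post : Store S.Wire → Prop := fun σ' => Agree V A σ σ' ∧
      ∃ k : ℝ, 1 ≤ k ∧ k ≤ 2 ^ M ∧ σ'.num kc 0 0 = (k : ℂ) ∧ SpectralBound S ro k with hPost
  set c := roundTime L S.R (K * S.R + 1) + 1 with hc
  have hlast : ∀ x, 2 / 2 ^ M * nsq x ≤ qform (overlapMat S ro ro S.R S.R) x ∧
      qform (overlapMat S ro ro S.R S.R) x ≤ 2 ^ M / 2 * nsq x := fun x => by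
    have hx : 0 ≤ nsq x := Finset.sum_nonneg fun _ _ => by positivity
    refine ⟨le_trans (mul_le_mul_of_nonneg_right ?_ hx) (hspec x).1,
      (hspec x).2.trans (mul_le_mul_of_nonneg_right (by linarith) hx)⟩
    rw [div_le_iff₀ (by positivity), inv_mul_eq_div, le_div_iff₀ hq]
    linarith
  have key : ∀ d m τ, m + d = M → Agree V A σ τ → τ.num kc 0 0 = ((2 ^ m : ℝ) : ℂ) →
      (τ.nat 16 = 0 ∧ SpectralBound S ro (2 ^ m) ∨ τ.nat 16 = 1 ∧ m < M) →
      Tri (.loop (.natLt 3 16) (calibrateRound K kc)) τ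
        (c * (8 ^ (M + 1) - 8 ^ (m + 1)) + 1) (δ / 2 ^ m) Post := by
    intro d
    induction d with
    | zero =>
      intro m τ hm hAτ hk h
      rcases h with ⟨h16, hb⟩ | ⟨-, h⟩
      · have ht : ¬ Test.Holds τ (.natLt 3 16) := by simp [Test.Holds, h16]
        exact ((Runs.loop_done ht).tri (Post := Post) ⟨hAτ, 2 ^ m, one_le_pow₀ (by norm_num),
          pow_le_pow_right₀ (by norm_num) (by omega), hk, hb⟩).mono (by omega) (by positivity)
          (fun _ h => h)
      · omega
    | succ d ih =>
      intro m τ hm hAτ hk h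
      rcases h with ⟨h16, hb⟩ | ⟨h16, h⟩
      · have ht : ¬ Test.Holds τ (.natLt 3 16) := by simp [Test.Holds, h16]
        exact ((Runs.loop_done ht).tri (Post := Post) ⟨hAτ, 2 ^ m, one_le_pow₀ (by norm_num),
          pow_le_pow_right₀ (by norm_num) (by omega), hk, hb⟩).mono (by omega) (by positivity)
          (fun _ h => h)
      · have hCτ : CalibrateInput τ ro := by
          rcases hkc with rfl | rfl <;> exact hC.agree hAτ
        have ht : Test.Holds τ (.natLt 3 16) := by
          simp only [Test.Holds, hCτ.base.zero, h16]; norm_num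
        refine (Tri.loop_step ht (tri_calibrateRound hK hkc hR hL hCτ hk)
          (η₂ := δ / 2 ^ (m + 1)) (by positivity) fun σ' h => ?_).mono
          (t := roundTime L S.R (K * S.R * 8 ^ (m + 1) + 1) +
            (c * (8 ^ (M + 1) - 8 ^ (m + 1 + 1)) + 1) + 1) ?_ ?_ (fun _ h => h)
        · obtain ⟨A', k', s', b', e'⟩ := h
          refine ih (m + 1) σ' (by omega) (hAτ.trans A') k' ?_
          rcases s' with s' | s'
          · exact Or.inl ⟨s', b' s'⟩
          -- A raised flag at the guess 2^M would contradict `hlast`.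
          · refine Or.inr ⟨s', lt_of_le_of_ne (by omega) fun hmM => ?_⟩
            have := e' (by rw [hmM]; exact hlast)
            omega
        · have hr := roundTime_le K L S.R (m + 1)
          have h8 : 8 ^ (m + 1 + 1) ≤ 8 ^ (M + 1) := Nat.pow_le_pow_right (by norm_num) (by omega)
          obtain ⟨e, he⟩ := Nat.exists_eq_add_of_le h8
          have h81 : 1 ≤ 8 ^ (m + 1) := Nat.one_le_pow _ _ (by norm_num)
          have h82 : 8 ^ (m + 1 + 1) = 8 * 8 ^ (m + 1) := by ring
          have e2 : 8 ^ (M + 1) - 8 ^ (m + 1) = e + 7 * 8 ^ (m + 1) := by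
            rw [he, h82]; omega
          rw [e2, he, Nat.add_sub_cancel_left]
          have : roundTime L S.R (K * S.R * 8 ^ (m + 1) + 1) + 1 ≤ c * 8 ^ (m + 1) := by
            rw [hc]; nlinarith
          nlinarith
        · rw [pow_succ]
          have : (0 : ℝ) < 2 ^ m := by positivity
          apply le_of_eq; field_simp; norm_num
  have r1 := Runs.block (S := S) σ (.intConst (sc kc) 1) [.natConst 16 1] (by simp [Instr.IsDet])
  set σ₁ := ([.intConst (sc kc) 1, .natConst 16 1] : List Instr).foldl (execDet S) σ with hσ₁
  have A1 : Agree V A σ σ₁ := ((Agree.refl σ).set (by simp [hA]) _).setNat (by simp [hV]) _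
  refine (Tri.seq_runs r1 (key M 0 σ₁ (by omega) A1 ?_ (Or.inr ⟨?_, hM1⟩))).mono ?_ (by simp)
    (fun _ h => h)
  · simp [hσ₁, execDet, Store.set_num, hC.base.zero]
  · simp [hσ₁, execDet]
  · have : c * (8 ^ (M + 1) - 8 ^ (0 + 1)) ≤ c * 8 ^ (M + 1) := Nat.mul_le_mul_left _ (Nat.sub_le _ _)
    simp only [calibrateTime, List.length_cons, List.length_nil, ← hc]
    omega

end

/-! ### From spectral errors of the estimates to the residual. -/

section

/-! ### Error analysis -/

section Analysis

/-- The Euclidean norm. -/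
def enorm2 {ι : Type*} [Fintype ι] (x : ι → ℂ) : ℝ := ‖WithLp.toLp 2 x‖

variable {ι : Type*} [Fintype ι] {R : ℕ}

lemma enorm2_nonneg (x : ι → ℂ) : 0 ≤ enorm2 x := norm_nonneg _

lemma enorm2_add_le (x y : ι → ℂ) : enorm2 (x + y) ≤ enorm2 x + enorm2 y := by
  simp only [enorm2, WithLp.toLp_add]; exact norm_add_le _ _

lemma enorm2_sub_le (x y : ι → ℂ) : enorm2 (x - y) ≤ enorm2 x + enorm2 y := by
  simp only [enorm2, WithLp.toLp_sub]; exact norm_sub_le _ _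

lemma enorm2_smul (c : ℂ) (x : ι → ℂ) : enorm2 (c • x) = ‖c‖ * enorm2 x := by
  simp only [enorm2, WithLp.toLp_smul]; exact norm_smul _ _

lemma nsq_eq (x : ι → ℂ) : nsq x = enorm2 x ^ 2 := nsq_eq_norm_sq x

lemma enorm2_sq (x : ι → ℂ) : enorm2 x ^ 2 = (star x ⬝ᵥ x).re := by
  rw [← sum_norm_sq_eq, Complex.ofReal_re, ← nsq_eq]; rfl

lemma re_dot_le (x y : ι → ℂ) : (star x ⬝ᵥ y).re ≤ enorm2 x * enorm2 y := by
  have h : star x ⬝ᵥ y = inner ℂ (WithLp.toLp 2 x) (WithLp.toLp 2 y) := by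
    rw [EuclideanSpace.inner_toLp_toLp, dotProduct_comm]
  rw [h]
  exact (Complex.re_le_norm _).trans (norm_inner_le_norm _ _)

lemma enorm2_mulVec_le {n m : ℕ} (B : Matrix (Fin n) (Fin m) ℂ) (x : Fin m → ℂ) :
    enorm2 (B *ᵥ x) ≤ ‖B‖ * enorm2 x := Matrix.l2_opNorm_mulVec B (WithLp.toLp 2 x)

lemma enorm2_mul_le {D : ℝ} (hD : 0 ≤ D) {d : ι → ℂ} (hd : ∀ i, ‖d i‖ ≤ D) (x : ι → ℂ) :
    enorm2 (fun i => d i * x i) ≤ D * enorm2 x := by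
  refine le_of_sq_le_sq ?_ (mul_nonneg hD (enorm2_nonneg x))
  rw [mul_pow, ← nsq_eq, ← nsq_eq, nsq, nsq, Finset.mul_sum]
  refine Finset.sum_le_sum fun i _ => ?_
  rw [norm_mul, mul_pow]
  exact mul_le_mul_of_nonneg_right (pow_le_pow_left₀ (norm_nonneg _) (hd i) 2) (by positivity)

lemma qform_gram {n : ℕ} (U : Matrix (Fin n) (Fin R) ℂ) (x : Fin R → ℂ) :
    qform (Uᴴ * U) x = enorm2 (U *ᵥ x) ^ 2 := by
  rw [qform, enorm2_sq, Matrix.star_mulVec, ← Matrix.dotProduct_mulVec, Matrix.mulVec_mulVec]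

/-- Perturbation of a least squares problem. -/
lemma least_squares_perturbation {n : ℕ} {U : Matrix (Fin n) (Fin R) ℂ} {b : Fin n → ℂ}
    {G' : Matrix (Fin R) (Fin R) ℂ} {g' ws wh : Fin R → ℂ} {k t β : ℝ} (hk : 1 ≤ k)
    (hU : ∀ x, 1 / (2 * k) * nsq x ≤ qform (Uᴴ * U) x)
    (ht : 0 ≤ t) (htk : t ≤ 1 / (16 * k)) (hb : enorm2 b = β)
    (hws : (Uᴴ * U) *ᵥ ws = Uᴴ *ᵥ b) (hwh : G' *ᵥ wh = g')
    (hG : ‖G' - Uᴴ * U‖ ≤ t) (hg : enorm2 (g' - Uᴴ *ᵥ b) ≤ t * β) :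
    enorm2 (U *ᵥ (wh - ws)) ≤ 8 * k * t * β ∧ enorm2 (U *ᵥ ws) ≤ β := by
  have hβ : 0 ≤ β := hb ▸ enorm2_nonneg b
  set a := Real.sqrt (2 * k) with ha
  have ha2 : a ^ 2 = 2 * k := Real.sq_sqrt (by positivity)
  have ha1 : 1 ≤ a := Real.one_le_sqrt.2 (by linarith)
  have low : ∀ x, enorm2 x ≤ a * enorm2 (U *ᵥ x) := fun x => by
    refine le_of_sq_le_sq ?_ (mul_nonneg (by positivity) (enorm2_nonneg _))
    have := hU x
    rw [qform_gram, nsq_eq, one_div_mul_eq_div, div_le_iff₀ (by positivity)] at this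
    rw [mul_pow, ha2]; linarith
  have w1 : enorm2 (U *ᵥ ws) ≤ β := by
    have h1 : enorm2 (U *ᵥ ws) ^ 2 ≤ enorm2 (U *ᵥ ws) * β := by
      have := re_dot_le (U *ᵥ ws) b
      rwa [Matrix.star_mulVec, ← Matrix.dotProduct_mulVec, ← hws, ← qform, qform_gram, hb] at this
    by_contra h
    have : 0 < enorm2 (U *ᵥ ws) := by linarith
    nlinarith
  refine ⟨?_, w1⟩
  set v := wh - ws with hv
  set r := G' *ᵥ v with hr
  have r1 : r = (g' - Uᴴ *ᵥ b) - (G' - Uᴴ * U) *ᵥ ws := by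
    rw [hr, hv, Matrix.mulVec_sub, hwh, Matrix.sub_mulVec, hws]; abel
  have r2 : enorm2 r ≤ t * β * (2 * a) := by
    have e1 := enorm2_mulVec_le (G' - Uᴴ * U) ws
    have e2 : ‖G' - Uᴴ * U‖ * enorm2 ws ≤ t * (a * β) :=
      mul_le_mul hG ((low ws).trans (mul_le_mul_of_nonneg_left w1 (by positivity)))
        (enorm2_nonneg _) ht
    have e3 : t * β * 1 ≤ t * β * a := mul_le_mul_of_nonneg_left ha1 (by positivity)
    rw [r1]
    have := enorm2_sub_le (g' - Uᴴ *ᵥ b) ((G' - Uᴴ * U) *ᵥ ws)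
    linarith
  set y := enorm2 (U *ᵥ v) with hy
  have hy0 : 0 ≤ y := enorm2_nonneg _
  have hv0 := enorm2_nonneg v
  -- The error is measured by y = ‖U v‖ and not by ‖v‖: in y² = v*G'v − v*(G' − U*U)v each of ‖v‖
  -- and ‖r‖ costs only a = √(2k), hence one factor k in total.
  have q1 : y ^ 2 ≤ enorm2 v * enorm2 r + t * enorm2 v ^ 2 := by
    have e1 : y ^ 2 = qform G' v - qform (G' - Uᴴ * U) v := by rw [qform_sub, qform_gram]; ring
    have e2 := (abs_le.1 (abs_qform_le (G' - Uᴴ * U) v)).1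
    have e3 : ‖G' - Uᴴ * U‖ * nsq v ≤ t * enorm2 v ^ 2 := by
      rw [nsq_eq]; exact mul_le_mul_of_nonneg_right hG (by positivity)
    have e4 : qform G' v ≤ enorm2 v * enorm2 r := re_dot_le v r
    linarith
  have q2 : t * enorm2 v ^ 2 ≤ y ^ 2 / 8 := by
    have : enorm2 v ^ 2 ≤ a ^ 2 * y ^ 2 := by
      rw [← mul_pow]; exact pow_le_pow_left₀ hv0 (low v) 2
    calc t * enorm2 v ^ 2 ≤ 1 / (16 * k) * (a ^ 2 * y ^ 2) := by gcongr
      _ = y ^ 2 / 8 := by rw [ha2]; field_simp; ring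
  have q3 : enorm2 v * enorm2 r ≤ a * y * (t * β * (2 * a)) :=
    mul_le_mul (low v) r2 (enorm2_nonneg _) (by positivity)
  have q4 : a * y * (t * β * (2 * a)) = 4 * k * t * β * y := by
    calc _ = 2 * a ^ 2 * t * β * y := by ring
      _ = _ := by rw [ha2]; ring
  -- Together `q1` to `q4` say (7/8)y² ≤ 4ktβ·y.
  by_contra h
  push Not at h
  have p : 0 ≤ k * t * β := by positivity
  have : 0 < y := by nlinarith
  nlinarith

end Analysis

variable {S : FactorizedSystem}

/-- The matrix with the columns `|u_j⟩`. -/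
def colMat (S : FactorizedSystem) : Matrix (Fin S.N) (Fin S.R) ℂ := Matrix.of fun i j => S.u j i

/-- The matrix with the columns `|v_j⟩`. -/
def rowMat (S : FactorizedSystem) : Matrix (Fin S.M) (Fin S.R) ℂ := Matrix.of fun i j => S.v j i

/-- The products of the norms. -/
def normProd (S : FactorizedSystem) (j : Fin S.R) : ℝ := S.colNorm j * S.rowNorm j

lemma overlapMat_col (S : FactorizedSystem) :
    overlapMat S 0 0 S.R S.R = (colMat S)ᴴ * colMat S := by
  ext i j
  simp only [overlapMat, Matrix.of_apply, zero_add, S.overlap_col_col]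
  rfl

lemma overlapMat_row (S : FactorizedSystem) :
    overlapMat S S.R S.R S.R S.R = (rowMat S)ᴴ * rowMat S := by
  ext i j
  simp only [overlapMat, Matrix.of_apply, S.overlap_row_row]
  rfl

lemma overlapMat_rhs (S : FactorizedSystem) (i : Fin S.R) (j : Fin 1) :
    (S.rhsNorm : ℂ) * overlapMat S 0 (2 * S.R) S.R 1 i j = ((colMat S)ᴴ *ᵥ S.b) i := by
  simp only [overlapMat, Matrix.of_apply, zero_add, Fin.val_eq_zero, add_zero, S.overlap_col_rhs]
  simp only [Matrix.mulVec, dotProduct, FactorizedSystem.b, Finset.mul_sum]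
  exact Finset.sum_congr rfl fun l _ => by
    simp [colMat, Matrix.conjTranspose_apply]; ring

lemma enorm2_b (S : FactorizedSystem) : enorm2 S.b = S.rhsNorm := by
  have h : S.b = (S.rhsNorm : ℂ) • prepared S.rhsCircuit := rfl
  have h1 : enorm2 (prepared S.rhsCircuit) = 1 := by
    have : enorm2 (prepared S.rhsCircuit) ^ 2 = 1 := by
      rw [← nsq_eq]; exact sum_norm_sq_prepared S.prepares_rhs
    nlinarith [enorm2_nonneg (prepared S.rhsCircuit)]
  rw [h, enorm2_smul, h1, mul_one, Complex.norm_real, Real.norm_of_nonneg S.rhsNorm_pos.le]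

lemma A₁_mulVec (S : FactorizedSystem) (z : Fin S.R → ℂ) :
    S.A₁ *ᵥ z = colMat S *ᵥ fun j => (S.colNorm j : ℂ) * z j := by
  ext i
  simp only [Matrix.mulVec, dotProduct, FactorizedSystem.A₁, colMat, Matrix.of_apply]
  exact Finset.sum_congr rfl fun j _ => by ring

lemma A₂_mulVec_combination (S : FactorizedSystem) (s : Fin S.R → ℂ) :
    S.A₂ *ᵥ S.combination s =
      fun j => (S.rowNorm j : ℂ) * (overlapMat S S.R S.R S.R S.R *ᵥ s) j := by
  have h : S.combination s = rowMat S *ᵥ s := by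
    ext i
    simp only [FactorizedSystem.combination, Finset.sum_apply, Pi.smul_apply, smul_eq_mul,
      Matrix.mulVec, dotProduct, rowMat, Matrix.of_apply]
    exact Finset.sum_congr rfl fun j _ => by ring
  rw [overlapMat_row, h, ← Matrix.mulVec_mulVec]
  ext j
  simp only [Matrix.mulVec, dotProduct, FactorizedSystem.A₂, rowMat, Matrix.of_apply,
    Matrix.conjTranspose_apply, Finset.mul_sum, mul_assoc]

lemma residual_eq (S : FactorizedSystem) (x : Fin S.M → ℂ) :
    S.residual x = enorm2 (S.A *ᵥ x - S.b) := rfl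

/-- `colMat S *ᵥ ws` is the orthogonal projection of `b` onto the range of `colMat S`, which
contains the range of `A`. Its distance from `b` thus bounds the infimum from below, and no
minimizer for `A` is needed. -/
lemma isSolution_of_close {ε : ℝ} {s ws : Fin S.R → ℂ}
    (hws : ((colMat S)ᴴ * colMat S) *ᵥ ws = (colMat S)ᴴ *ᵥ S.b)
    (h : enorm2 (S.A *ᵥ S.combination s - colMat S *ᵥ ws) ≤ ε) : S.IsSolution ε s := by
  have low : ∀ x, enorm2 (colMat S *ᵥ ws - S.b) ≤ S.residual x := fun x => by
    obtain ⟨z, hz⟩ : ∃ z, S.A *ᵥ x = colMat S *ᵥ z := by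
      rw [FactorizedSystem.A, ← Matrix.mulVec_mulVec, A₁_mulVec]
      exact ⟨_, rfl⟩
    set r := colMat S *ᵥ ws - S.b with hr
    have e : S.A *ᵥ x - S.b = colMat S *ᵥ (z - ws) + r := by
      rw [hz, Matrix.mulVec_sub, hr]; abel
    have o : star r ⬝ᵥ (S.A *ᵥ x - S.b) = star r ⬝ᵥ r := by
      have h0 : (colMat S)ᴴ *ᵥ r = 0 := by
        rw [hr, Matrix.mulVec_sub, Matrix.mulVec_mulVec, hws, sub_self]
      have h1 : star r ⬝ᵥ colMat S *ᵥ (z - ws) = 0 := by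
        rw [Matrix.dotProduct_mulVec, ← Matrix.conjTranspose_conjTranspose (colMat S),
          ← Matrix.star_mulVec, h0]
        simp
      rw [e, dotProduct_add, h1, zero_add]
    have := re_dot_le r (S.A *ᵥ x - S.b)
    rw [o, ← enorm2_sq] at this
    rw [residual_eq]
    by_contra hc
    have : 0 < enorm2 r := (enorm2_nonneg _).trans_lt (not_le.1 hc)
    nlinarith
  have h2 : S.residual (S.combination s) ≤ enorm2 (colMat S *ᵥ ws - S.b) + ε := by
    have e : S.A *ᵥ S.combination s - S.b =
        (S.A *ᵥ S.combination s - colMat S *ᵥ ws) + (colMat S *ᵥ ws - S.b) := by abel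
    rw [residual_eq, e]
    linarith [enorm2_add_le (S.A *ᵥ S.combination s - colMat S *ᵥ ws) (colMat S *ᵥ ws - S.b)]
  have h3 : enorm2 (colMat S *ᵥ ws - S.b) ≤ ⨅ x, S.residual x := le_ciInf low
  rw [FactorizedSystem.IsSolution]
  linarith

/-- The accuracy of the final estimates, as the inverse of sixteen times this number. -/
def accuracy (S : FactorizedSystem) (ε ku kv D E : ℝ) : ℝ :=
  ku * kv * D * E * ((S.rhsNorm + ε) / ε)

lemma qform_pos_of_close {R : ℕ} {G G' : Matrix (Fin R) (Fin R) ℂ} {k t : ℝ} (hk : 1 ≤ k)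
    (hG : ∀ x, 1 / (2 * k) * nsq x ≤ qform G x) (htk : t ≤ 1 / (16 * k)) (h : ‖G' - G‖ ≤ t)
    (x : Fin R → ℂ) : 1 / (4 * k) * nsq x ≤ qform G' x := by
  have hx : 0 ≤ nsq x := Finset.sum_nonneg fun _ _ => by positivity
  have e := (abs_le.1 ((abs_qform_le (G' - G) x).trans
    (mul_le_mul_of_nonneg_right (h.trans htk) hx))).1
  rw [qform_sub] at e
  have e1 : 1 / (2 * k) = 8 * (1 / (16 * k)) := by field_simp; norm_num
  have e2 : 1 / (4 * k) = 4 * (1 / (16 * k)) := by field_simp; norm_num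
  have e3 := hG x
  have e4 : 0 ≤ 1 / (16 * k) * nsq x := by positivity
  rw [e1] at e3; rw [e2]; linarith

/-- With d = `normProd S`, the equations Gv s = τ and diag(d) τ = wh give A x̂ − U ws = U(wh − ws) −
U diag(d)(Gv − V*V)s. The first term is at most 8·ku·tβ by `least_squares_perturbation`. For the
second, ‖s‖ ≤ 4·kv·E·√(2ku)(β+ε), and applying U, diag(d) and the error of Gv costs √(2ku)·D·t. The
choice of `t` makes each term at most ε/2. -/
lemma isSolution_of_estimates {ε ku kv D E t : ℝ} (hε : 0 < ε) (hR : 0 < S.R)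
    (hku : 1 ≤ ku) (hkv : 1 ≤ kv)
    (hu : SpectralBound S 0 ku) (hv : SpectralBound S S.R kv)
    (hd : ∀ j, 0 < normProd S j ∧ normProd S j ≤ D ∧ (normProd S j)⁻¹ ≤ E)
    (ht : t = 1 / (16 * accuracy S ε ku kv D E))
    {Gu Gv Xu Xv : Matrix (Fin S.R) (Fin S.R) ℂ} {g : Matrix (Fin S.R) (Fin 1) ℂ}
    (hGu : ‖Gu - overlapMat S 0 0 S.R S.R‖ ≤ t) (hXu : Xu * Gu = 1)
    (hg : ‖g - overlapMat S 0 (2 * S.R) S.R 1‖ ≤ t)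
    (hGv : ‖Gv - overlapMat S S.R S.R S.R S.R‖ ≤ t) (hXv : Xv * Gv = 1)
    {τ s : Fin S.R → ℂ}
    (hτ : ∀ i, τ i = (Xu *ᵥ fun j => g j 0) i * S.rhsNorm / normProd S i)
    (hs : s = Xv *ᵥ τ) : S.IsSolution ε s := by
  set β := S.rhsNorm with hβ
  have hβ0 : 0 < β := S.rhsNorm_pos
  set j₀ : Fin S.R := ⟨0, hR⟩
  have hD : 0 < D := (hd j₀).1.trans_le (hd j₀).2.1
  have hE : 0 < E := (inv_pos.2 (hd j₀).1).trans_le (hd j₀).2.2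
  have hDE : 1 ≤ D * E := by
    rw [← mul_inv_cancel₀ (hd j₀).1.ne']
    exact mul_le_mul (hd j₀).2.1 (hd j₀).2.2 (inv_pos.2 (hd j₀).1).le hD.le
  have hkuv : 1 ≤ ku * kv := one_le_mul_of_one_le_of_one_le hku hkv
  have ht0 : 0 < t := by rw [ht, accuracy]; positivity
  have hid : 16 * (ku * kv * (D * E) * t * (β + ε)) = ε := by
    rw [ht, accuracy, ← hβ]; field_simp
  have hP : 0 < t * (β + ε) := by positivity
  have hku1 : 16 * (ku * t * (β + ε)) ≤ ε := by
    have : ku * 1 ≤ ku * (kv * (D * E)) := mul_le_mul_of_nonneg_left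
      (one_le_mul_of_one_le_of_one_le hkv hDE) (by positivity)
    nlinarith
  have hkv1 : 16 * (kv * t * (β + ε)) ≤ ε := by
    have : kv * 1 ≤ kv * (ku * (D * E)) := mul_le_mul_of_nonneg_left
      (one_le_mul_of_one_le_of_one_le hku hDE) (by positivity)
    nlinarith
  -- As β > 0, the bound 16·ku·t(β+ε) ≤ ε forces 16·ku·t < 1.
  have htu : t ≤ 1 / (16 * ku) := by
    rw [le_div_iff₀ (by positivity)]
    have : 16 * (ku * t * β) > 0 := by positivity
    by_contra hc
    nlinarith
  have htv : t ≤ 1 / (16 * kv) := by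
    rw [le_div_iff₀ (by positivity)]
    have : 16 * (kv * t * β) > 0 := by positivity
    by_contra hc
    nlinarith
  have hu' : ∀ x, 1 / (2 * ku) * nsq x ≤ qform ((colMat S)ᴴ * colMat S) x := fun x => by
    rw [← overlapMat_col]; exact (hu x).1
  have hupos : ∀ x, x ≠ 0 → 0 < qform ((colMat S)ᴴ * colMat S) x := fun x hx =>
    lt_of_lt_of_le (by have := nsq_pos hx; positivity) (hu' x)
  set ws := invIter ((colMat S)ᴴ * colMat S) S.R *ᵥ ((colMat S)ᴴ *ᵥ S.b) with hws
  have hws1 : ((colMat S)ᴴ * colMat S) *ᵥ ws = (colMat S)ᴴ *ᵥ S.b := by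
    have := invIter_mul (by simp) hupos
    rw [hws, Matrix.mulVec_mulVec, mul_eq_one_comm.1 this, Matrix.one_mulVec]
  set wh : Fin S.R → ℂ := (β : ℂ) • Xu *ᵥ fun j => g j 0 with hwh
  have hwh1 : Gu *ᵥ wh = (β : ℂ) • fun j => g j 0 := by
    rw [hwh, Matrix.mulVec_smul, Matrix.mulVec_mulVec, mul_eq_one_comm.1 hXu, Matrix.one_mulVec]
  have hgb : enorm2 ((β : ℂ) • (fun j => g j 0) - (colMat S)ᴴ *ᵥ S.b) ≤ t * β := by
    have e : (β : ℂ) • (fun j => g j 0) - (colMat S)ᴴ *ᵥ S.b =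
        (β : ℂ) • ((g - overlapMat S 0 (2 * S.R) S.R 1) *ᵥ fun _ => 1) := by
      ext i
      rw [Pi.sub_apply, ← overlapMat_rhs S i 0]
      simp [Matrix.mulVec, dotProduct, mul_sub, hβ]
    have e1 : enorm2 (fun _ : Fin 1 => (1 : ℂ)) = 1 := by
      simp [enorm2, EuclideanSpace.norm_eq]
    rw [e, enorm2_smul, Complex.norm_real, Real.norm_of_nonneg hβ0.le, mul_comm]
    have := enorm2_mulVec_le (g - overlapMat S 0 (2 * S.R) S.R 1) fun _ => 1
    rw [e1, mul_one] at this
    exact mul_le_mul_of_nonneg_right (this.trans hg) hβ0.le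
  obtain ⟨hU1, hU2⟩ := least_squares_perturbation hku hu' ht0.le htu (enorm2_b S) hws1 hwh1
    (by rw [← overlapMat_col]; exact hGu) hgb
  have hU3 : enorm2 (colMat S *ᵥ (wh - ws)) ≤ ε / 2 := by
    have : ku * t * β ≤ ku * t * (β + ε) := mul_le_mul_of_nonneg_left (by linarith) (by positivity)
    linarith
  have hU4 : enorm2 (colMat S *ᵥ wh) ≤ β + ε := by
    have e : colMat S *ᵥ wh = colMat S *ᵥ (wh - ws) + colMat S *ᵥ ws := by
      rw [Matrix.mulVec_sub]; abel
    rw [e]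
    linarith [enorm2_add_le (colMat S *ᵥ (wh - ws)) (colMat S *ᵥ ws)]
  have hτ1 : enorm2 τ ≤ E * enorm2 wh := by
    have : τ = fun i => (((normProd S i)⁻¹ : ℝ) : ℂ) * wh i := by
      funext i
      rw [hτ, hwh, Pi.smul_apply, smul_eq_mul]; push_cast; ring
    rw [this]
    refine enorm2_mul_le hE.le (fun i => ?_) _
    rw [Complex.norm_real, Real.norm_of_nonneg (inv_pos.2 (hd i).1).le]
    exact (hd i).2.2
  have hGs : Gv *ᵥ s = τ := by
    rw [hs, Matrix.mulVec_mulVec, mul_eq_one_comm.1 hXv, Matrix.one_mulVec]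
  have hs1 : enorm2 s ≤ 4 * kv * enorm2 τ := by
    have e := qform_pos_of_close hkv (fun x => (hv x).1) htv hGv s
    have e2 : qform Gv s ≤ enorm2 s * enorm2 τ := by rw [← hGs]; exact re_dot_le _ _
    rw [nsq_eq, one_div_mul_eq_div, div_le_iff₀ (by positivity)] at e
    by_contra hc
    push Not at hc
    have : 0 < enorm2 s := lt_of_le_of_lt (mul_nonneg (by positivity) (enorm2_nonneg _)) hc
    nlinarith
  set z : Fin S.R → ℂ := fun j => (normProd S j : ℂ) *
    ((Gv - overlapMat S S.R S.R S.R S.R) *ᵥ s) j with hz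
  have hz1 : enorm2 z ≤ D * (t * enorm2 s) := by
    refine (enorm2_mul_le hD.le (fun i => ?_) _).trans (mul_le_mul_of_nonneg_left
      ((enorm2_mulVec_le _ _).trans (mul_le_mul_of_nonneg_right hGv (enorm2_nonneg _))) hD.le)
    rw [Complex.norm_real, Real.norm_of_nonneg (hd i).1.le]
    exact (hd i).2.1
  refine isSolution_of_close hws1 ?_
  have split : S.A *ᵥ S.combination s - colMat S *ᵥ ws =
      colMat S *ᵥ (wh - ws) - colMat S *ᵥ z := by
    rw [FactorizedSystem.A, ← Matrix.mulVec_mulVec, A₂_mulVec_combination, A₁_mulVec,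
      ← Matrix.mulVec_sub, ← Matrix.mulVec_sub]
    congr 1
    funext j
    have hdj : (normProd S j : ℂ) ≠ 0 := by exact_mod_cast (hd j).1.ne'
    have e1 : (normProd S j : ℂ) * τ j = wh j := by
      rw [hτ, hwh, Pi.smul_apply, smul_eq_mul]; field_simp
    have e2 : (normProd S j : ℂ) = S.colNorm j * S.rowNorm j := by simp [normProd]
    simp only [Pi.sub_apply, hz, Matrix.sub_mulVec, hGs, mul_sub, e1]
    rw [e2]; ring
  have a2 : 0 ≤ 2 * ku := by positivity
  set a := Real.sqrt (2 * ku) with ha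
  have ha2 : a ^ 2 = 2 * ku := Real.sq_sqrt a2
  have up : ∀ x, enorm2 (colMat S *ᵥ x) ≤ a * enorm2 x := fun x => by
    refine le_of_sq_le_sq ?_ (mul_nonneg (Real.sqrt_nonneg _) (enorm2_nonneg _))
    rw [mul_pow, ha2, ← nsq_eq x, ← qform_gram, ← overlapMat_col]
    exact (hu x).2
  have low : ∀ x, enorm2 x ≤ a * enorm2 (colMat S *ᵥ x) := fun x => by
    refine le_of_sq_le_sq ?_ (mul_nonneg (Real.sqrt_nonneg _) (enorm2_nonneg _))
    have := hu' x
    rw [qform_gram, nsq_eq, one_div_mul_eq_div, div_le_iff₀ (by positivity)] at this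
    rw [mul_pow, ha2]; linarith
  have ha0 : 0 ≤ a := Real.sqrt_nonneg _
  have fin : enorm2 (colMat S *ᵥ z) ≤ ε / 2 := by
    calc enorm2 (colMat S *ᵥ z) ≤ a * (D * (t * (4 * kv * (E * (a * (β + ε)))))) := by
          refine (up z).trans (mul_le_mul_of_nonneg_left (hz1.trans ?_) ha0)
          gcongr
          refine hs1.trans (mul_le_mul_of_nonneg_left (hτ1.trans ?_) (by positivity))
          exact mul_le_mul_of_nonneg_left ((low wh).trans
            (mul_le_mul_of_nonneg_left hU4 ha0)) hE.le
      _ = 4 * a ^ 2 * (kv * (D * E) * t * (β + ε)) := by ring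
      _ = ε / 2 := by rw [ha2]; linarith
  rw [split]
  linarith [enorm2_sub_le (colMat S *ᵥ (wh - ws)) (colMat S *ᵥ z)]

end

/-! ### Solving with estimated Gram matrices, and the sample number. -/

section

variable {S : FactorizedSystem}

/-! ### The algorithm -/

/-- The array `22` becomes the inverse of an estimate of a Gram matrix. -/
def solveGram : Program :=
  seqs estimate [block (.natConst 16 0) [.arith .add (sc 11) (sc 7) (sc 7),
    .arith .div (sc 11) (sc 13) (sc 11), .intConst (sc 12) 0], fillWork, invert]

/-- A bound for the running time of `solveGram` with `n` samples. -/
def solveTime (L R n : ℕ) : ℕ := estimateTime L R R n + fillTime R + invertTime R + 10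

/-- An estimate within 1/(16k) of a Gram matrix bounded below by 1/(2k) is positive definite, so its
inversion is exact and the flag need not be inspected. -/
lemma tri_solveGram {L n ro : ℕ} {s t k : ℝ} {σ : Store S.Wire}
    (hE : EstimateInput σ s ro ro) (hs : 0 ≤ s) (hn : n = ⌊s⌋₊ + 1) (hm : σ.nat 13 = S.R)
    (hL : ∀ c, (S.inputGates c).length ≤ L) (hR0 : 0 < S.R) (ht : 0 ≤ t) (hk : 1 ≤ k)
    (hb : SpectralBound S ro k) (htk : t ≤ 1 / (16 * k)) :
    Tri solveGram σ (solveTime L S.R n) (deviationProb S.R n t) fun σ' =>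
      Agree [5, 6, 7, 8, 9, 10, 14, 15, 16, 17] [5, 6, 7, 11, 12, 15, 20, 21, 22, 23] σ σ' ∧
      ∃ G' : Matrix (Fin S.R) (Fin S.R) ℂ, ‖G' - overlapMat S ro ro S.R S.R‖ ≤ t ∧
        matOf σ' 22 S.R S.R * G' = 1 := by
  refine (Tri.seq (t₂ := fillTime S.R + invertTime S.R + 9) (η₂ := 0)
    (tri_estimate hE hs hn hm hL hR0 hR0 le_rfl ht) le_rfl fun σ₁ h => ?_).mono
    (by simp only [solveTime]; omega) (by simp) (fun _ h => h)
  obtain ⟨A1, n1, d1⟩ := h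
  have hB1 := hE.base.agree A1
  have r2 := Runs.block (S := S) σ₁ (.natConst 16 0) [.arith .add (sc 11) (sc 7) (sc 7),
    .arith .div (sc 11) (sc 13) (sc 11), .intConst (sc 12) 0] (by simp [Instr.IsDet])
  set σ₂ := ([.natConst 16 0, .arith .add (sc 11) (sc 7) (sc 7),
    .arith .div (sc 11) (sc 13) (sc 11), .intConst (sc 12) 0] : List Instr).foldl
    (execDet S) σ₁ with hσ₂
  have A2 : Agree [16] [11, 12] σ₁ σ₂ := ((((Agree.refl σ₁).setNat (by simp) _).set (by simp) _).set
    (by simp) _).set (by simp) _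
  have u13 : σ₁.num 13 0 0 = 1 := hB1.unit false
  have e11 : σ₂.num 11 0 0 = (2 * n : ℂ)⁻¹ := by
    simp [hσ₂, execDet, Store.set_num, Store.get, hB1.zero, Op.eval, u13, n1, two_mul]
  have e12 : σ₂.num 12 0 0 = 0 := by simp [hσ₂, execDet, Store.set_num, hB1.zero]
  have hB2 := hB1.agree A2
  obtain ⟨σ₃, r3, A3, u3⟩ := Runs.fillWork hB2
  have hB3 := hB2.agree A3
  have w3 : matOf σ₃ 21 S.R S.R = hermEst (matOf σ₁ 20 S.R S.R) n := by
    have e20 : matOf σ₂ 20 S.R S.R = matOf σ₁ 20 S.R S.R := by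
      rw [matOf, A2.num 20 (by decide)]; rfl
    rw [u3, e11, e12, e20, hermEst, zero_smul, add_zero]
  obtain ⟨σ₄, r4, A4, m4, -⟩ := Runs.invert hB3 (Or.inl (by
    rw [A3.nat 16 (by decide)]; simp [hσ₂, execDet]))
  refine ((r2.seq (r3.seq r4)).mono (by simp only [List.length_cons, List.length_nil]; omega)).tri
    ⟨((A1.mono.trans A2.mono).trans A3.mono).trans A4.mono, hermEst (matOf σ₁ 20 S.R S.R) n, ?_, ?_⟩
  · exact norm_hermEst_sub_le (overlapMat_conjTranspose S ro S.R) (by omega) d1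
  · rw [m4, w3]
    refine invIter_mul (hermEst_conjTranspose _ _) fun x hx => lt_of_lt_of_le ?_
      (qform_pos_of_close hk (fun x => (hb x).1) htk
        (norm_hermEst_sub_le (overlapMat_conjTranspose S ro S.R) (by omega) d1) x)
    have := nsq_pos hx
    positivity

/-- The memory holds the classical input. -/
structure InputStore (S : FactorizedSystem) (ε : ℝ) (σ : Store S.Wire) : Prop where
  base : Base σ
  col : ∀ j : Fin S.R, σ.num 0 j 0 = (S.colNorm j : ℂ)
  row : ∀ j : Fin S.R, σ.num 1 j 0 = (S.rowNorm j : ℂ)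
  rhs : σ.num 2 0 0 = (S.rhsNorm : ℂ)
  acc : σ.num 3 0 0 = (ε : ℂ)

lemma InputStore.agree {V A : List ℕ} {σ τ : Store S.Wire} {ε : ℝ} (h : InputStore S ε σ)
    (h' : Agree V A σ τ) (hV : 0 ∉ V ∧ 3 ∉ V ∧ 4 ∉ V := by decide)
    (hA : 13 ∉ A ∧ 14 ∉ A ∧ 0 ∉ A ∧ 1 ∉ A ∧ 2 ∉ A ∧ 3 ∉ A := by decide) : InputStore S ε τ where
  base := h.base.agree h' hV ⟨hA.1, hA.2.1⟩
  col j := by rw [h'.num 0 hA.2.2.1, h.col]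
  row j := by rw [h'.num 1 hA.2.2.2.1, h.row]
  rhs := by rw [h'.num 2 hA.2.2.2.2.1, h.rhs]
  acc := by rw [h'.num 3 hA.2.2.2.2.2, h.acc]

/-- Replace the scalar `a` by its maximum with the scalar `18`. -/
def maxUpdate (a : ℕ) : Program :=
  -- Multiplying by scalar `13`, which is one, copies an entry.
  .branch (.reLe (sc a) (sc 18)) (.instr (.arith .mul (sc a) (sc 18) (sc 13)))
    (.instr (.natConst 8 0))

lemma Runs.maxUpdate {a : ℕ} {x y : ℝ} {σ : Store S.Wire} (hB : Base σ)
    (hx : σ.num a 0 0 = (x : ℂ)) (hy : σ.num 18 0 0 = (y : ℂ)) :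
    ∃ σ', Runs (maxUpdate a) σ 2 σ' ∧ Agree [8] [a] σ σ' ∧
      σ'.num a 0 0 = ((max x y : ℝ) : ℂ) := by
  have ht : Test.Holds σ (.reLe (sc a) (sc 18)) ↔ x ≤ y := by
    simp [Test.Holds, Store.get, hB.zero, hx, hy]
  have u13 : σ.num 13 0 0 = 1 := hB.unit false
  by_cases h : x ≤ y
  · refine ⟨_, Runs.branch_pos (ht.2 h) (Runs.instr _ (by trivial)),
      (Agree.refl _).set (by simp) _, ?_⟩
    simp [execDet, Store.set_num, Store.get, hB.zero, Op.eval, hy, u13, h]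
  · refine ⟨_, Runs.branch_neg (mt ht.1 h) (Runs.instr _ (by trivial)),
      (Agree.refl _).setNat (by simp) _, ?_⟩
    simp [execDet, hx, max_eq_left (not_le.1 h).le]

/-- One step of the computation of the extremes of the products of the norms. -/
def extremesStep : Program :=
  seqs (.instr (.arith .mul (sc 18) ⟨0, 5, 3⟩ ⟨1, 5, 3⟩))
    [maxUpdate 16, .instr (.arith .div (sc 18) (sc 13) (sc 18)), maxUpdate 17]

lemma Runs.extremesStep {ε D E : ℝ} {τ : Store S.Wire} (hτ : InputStore S ε τ) (j : Fin S.R)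
    (h5 : τ.nat 5 = j) (e16 : τ.num 16 0 0 = (D : ℂ)) (e17 : τ.num 17 0 0 = (E : ℂ)) :
    ∃ τ', Runs extremesStep τ 9 τ' ∧ Agree [8] [16, 17, 18] τ τ' ∧
      τ'.num 16 0 0 = ((max D (normProd S j) : ℝ) : ℂ) ∧
      τ'.num 17 0 0 = ((max E (normProd S j)⁻¹ : ℝ) : ℂ) := by
  have c0 : τ.num 0 j 0 = (S.colNorm j : ℂ) := hτ.col j
  have c1 : τ.num 1 j 0 = (S.rowNorm j : ℂ) := hτ.row j
  have q1 := Runs.instr (S := S) τ (i := .arith .mul (sc 18) ⟨0, 5, 3⟩ ⟨1, 5, 3⟩) trivial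
  set τ₁ := execDet S τ (.arith .mul (sc 18) ⟨0, 5, 3⟩ ⟨1, 5, 3⟩) with hτ₁
  have B1 : Agree [8] [16, 17, 18] τ τ₁ := (Agree.refl τ).set (by simp) _
  have v1 : τ₁.num 18 0 0 = (normProd S j : ℂ) := by
    simp [hτ₁, execDet, Store.set_num, Store.get, hτ.base.zero, Op.eval, h5, c0, c1, normProd]
  have w1 : τ₁.num 16 0 0 = (D : ℂ) ∧ τ₁.num 17 0 0 = (E : ℂ) := by
    simp [hτ₁, execDet, Store.set_num, e16, e17]
  have hb1 := hτ.agree B1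
  obtain ⟨τ₂, q2, B2, x2⟩ := Runs.maxUpdate hb1.base w1.1 v1
  have hb2 := hb1.agree B2
  have q3 := Runs.instr (S := S) τ₂ (i := .arith .div (sc 18) (sc 13) (sc 18)) trivial
  set τ₃ := execDet S τ₂ (.arith .div (sc 18) (sc 13) (sc 18)) with hτ₃
  have B3 : Agree [] [18] τ₂ τ₃ := (Agree.refl τ₂).set (by simp) _
  have hb3 := hb2.agree B3
  have u13 : τ₂.num 13 0 0 = 1 := hb2.base.unit false
  have v3 : τ₃.num 18 0 0 = (((normProd S j)⁻¹ : ℝ) : ℂ) := by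
    have e18 : τ₂.num 18 = τ₁.num 18 := B2.num 18 (by decide)
    simp [hτ₃, execDet, Store.set_num, Store.get, hb2.base.zero, Op.eval, u13, e18, v1]
  have w3 : τ₃.num 17 0 0 = (E : ℂ) := by
    rw [B3.num 17 (by decide), B2.num 17 (by decide), w1.2]
  obtain ⟨τ₄, q4, B4, x4⟩ := Runs.maxUpdate hb3.base w3 v3
  refine ⟨τ₄, (q1.seq (q2.seq (q3.seq q4))).mono (by omega), ((B1.trans B2.mono).trans B3.mono).trans B4.mono,
    ?_, x4⟩
  rw [B4.num 16 (by decide), B3.num 16 (by decide), x2]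

/-- The scalars `16` and `17` become the maxima of the products of the norms and of their
inverses. -/
def normExtremes : Program :=
  .seq (block (.intConst (sc 16) 0) [.intConst (sc 17) 0]) (forLoop 5 0 extremesStep)

/-- `D` and `E` are upper bounds of the products of the norms with indices below `i` and of their
inverses, and they are zero or attained. -/
structure Extremes (S : FactorizedSystem) (i : ℕ) (D E : ℝ) : Prop where
  le : ∀ j : Fin S.R, (j : ℕ) < i → normProd S j ≤ D ∧ (normProd S j)⁻¹ ≤ E
  fst : D = 0 ∨ ∃ j, D = normProd S j
  snd : E = 0 ∨ ∃ j, E = (normProd S j)⁻¹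

/-- Attainment is carried along because the running time needs D·E to be a quotient of two actual
products, not merely an upper bound for such quotients. -/
lemma Extremes.step {D E : ℝ} (j : Fin S.R) (h : Extremes S j D E) :
    Extremes S (j + 1) (max D (normProd S j)) (max E (normProd S j)⁻¹) where
  le i hi := by
    rcases Nat.lt_succ_iff_lt_or_eq.1 hi with hi | hi
    · exact ⟨(h.le i hi).1.trans (le_max_left _ _), (h.le i hi).2.trans (le_max_left _ _)⟩
    · obtain rfl : i = j := Fin.ext hi
      exact ⟨le_max_right _ _, le_max_right _ _⟩
  fst := by
    rcases max_choice D (normProd S j) with e | e <;> rw [e]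
    exacts [h.fst, Or.inr ⟨_, rfl⟩]
  snd := by
    rcases max_choice E (normProd S j)⁻¹ with e | e <;> rw [e]
    exacts [h.snd, Or.inr ⟨_, rfl⟩]

lemma Runs.normExtremes {ε : ℝ} {σ : Store S.Wire} (h : InputStore S ε σ) :
    ∃ σ', Runs normExtremes σ (S.R * 12 + 7) σ' ∧ Agree [5, 8] [16, 17, 18] σ σ' ∧
      ∃ D E : ℝ, σ'.num 16 0 0 = (D : ℂ) ∧ σ'.num 17 0 0 = (E : ℂ) ∧ Extremes S S.R D E := by
  have r1 := Runs.block (S := S) σ (.intConst (sc 16) 0) [.intConst (sc 17) 0]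
    (by simp [Instr.IsDet])
  set σ₁ := ([.intConst (sc 16) 0, .intConst (sc 17) 0] : List Instr).foldl (execDet S) σ with hσ₁
  have A1 : Agree [5, 8] [16, 17, 18] σ σ₁ := ((Agree.refl σ).set (by simp) _).set (by simp) _
  have h1 := h.agree A1
  have z1 : σ₁.num 16 0 0 = ((0 : ℝ) : ℂ) ∧ σ₁.num 17 0 0 = ((0 : ℝ) : ℂ) := by
    simp [hσ₁, execDet, Store.set_num, h.base.zero]
  obtain ⟨σ₂, r2, A2, -, H⟩ := Runs.forLoop (S := S) (x := 5) (y := 0)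
    (n := S.R) (tb := 9) (body := HybridLS.extremesStep) (σ := σ₁)
    (fun i τ => Agree [5, 8] [16, 17, 18] σ₁ τ ∧ τ.nat 5 = i ∧
      ∃ D E : ℝ, τ.num 16 0 0 = (D : ℂ) ∧ τ.num 17 0 0 = (E : ℂ) ∧ Extremes S i D E)
    ⟨(Agree.refl _).setNat (by simp) _, by simp, 0, 0, z1.1, z1.2, by simp, Or.inl rfl,
      Or.inl rfl⟩
    (fun i τ h => ⟨h.2.1, by rw [h.1.nat 0 (by decide), h1.base.size]⟩)
    (fun i τ hi ⟨hA, h5, D, E, e16, e17, hj⟩ => by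
      have hτ := h1.agree hA
      obtain ⟨τ', q, B, x16, x17⟩ := Runs.extremesStep hτ ⟨i, hi⟩ h5 e16 e17
      refine ⟨τ', q, (hτ.agree B).base.one, by rw [B.nat 5 (by decide), h5],
        (hA.trans B.mono).setNat (by simp) _, by simp, _, _, x16, x17, hj.step ⟨i, hi⟩⟩)
  exact ⟨σ₂, (r1.seq r2).mono
    (by simp only [List.length_cons, List.length_nil]; omega), A1.trans A2, H⟩

/-- The real number of samples that is asked for. -/
def sampleTarget (S : FactorizedSystem) (K : ℕ) (y : ℝ) : ℝ := 16 * K * S.R * y ^ 2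

/-- Compute the number of samples for the final estimates. -/
def setTarget (K : ℕ) : Program :=
  block (.arith .add (sc 18) (sc 2) (sc 3)) [.arith .div (sc 18) (sc 18) (sc 3),
    .arith .mul (sc 18) (sc 18) (sc 9), .arith .mul (sc 18) (sc 18) (sc 10),
    .arith .mul (sc 18) (sc 18) (sc 16), .arith .mul (sc 18) (sc 18) (sc 17),
    .arith .mul (sc 18) (sc 18) (sc 18), .intConst (sc 19) (16 * K),
    .arith .mul (sc 18) (sc 18) (sc 19), .ofNat (sc 19) 0, .arith .mul (sc 8) (sc 18) (sc 19),
    .natConst 11 0, .natConst 12 0]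

/-- The factor 16K in `sampleTarget` is fixed by t = 1/(16y): more than 16KRy² samples give nt² ≥
KR/16, the hypothesis of `GoodFactor` at x = 1. -/
lemma Runs.setTarget {K : ℕ} {ε ku kv D E : ℝ} {σ : Store S.Wire} (h : InputStore S ε σ)
    (h9 : σ.num 9 0 0 = (ku : ℂ)) (h10 : σ.num 10 0 0 = (kv : ℂ)) (h16 : σ.num 16 0 0 = (D : ℂ))
    (h17 : σ.num 17 0 0 = (E : ℂ)) :
    ∃ σ', Runs (setTarget K) σ 25 σ' ∧ Agree [11, 12] [8, 18, 19] σ σ' ∧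
      EstimateInput σ' (sampleTarget S K (accuracy S ε ku kv D E)) 0 0 := by
  have r1 := Runs.block (S := S) σ (.arith .add (sc 18) (sc 2) (sc 3))
    [.arith .div (sc 18) (sc 18) (sc 3),
    .arith .mul (sc 18) (sc 18) (sc 9), .arith .mul (sc 18) (sc 18) (sc 10),
    .arith .mul (sc 18) (sc 18) (sc 16), .arith .mul (sc 18) (sc 18) (sc 17),
    .arith .mul (sc 18) (sc 18) (sc 18), .intConst (sc 19) (16 * K),
    .arith .mul (sc 18) (sc 18) (sc 19), .ofNat (sc 19) 0, .arith .mul (sc 8) (sc 18) (sc 19),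
    .natConst 11 0, .natConst 12 0] (by simp [Instr.IsDet])
  have A1 : Agree [11, 12] [8, 18, 19] σ (([.arith .add (sc 18) (sc 2) (sc 3),
    .arith .div (sc 18) (sc 18) (sc 3),
    .arith .mul (sc 18) (sc 18) (sc 9), .arith .mul (sc 18) (sc 18) (sc 10),
    .arith .mul (sc 18) (sc 18) (sc 16), .arith .mul (sc 18) (sc 18) (sc 17),
    .arith .mul (sc 18) (sc 18) (sc 18), .intConst (sc 19) (16 * K),
    .arith .mul (sc 18) (sc 18) (sc 19), .ofNat (sc 19) 0, .arith .mul (sc 8) (sc 18) (sc 19),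
    .natConst 11 0, .natConst 12 0] : List Instr).foldl (execDet S) σ) :=
    (((((((((((((Agree.refl σ).set (by simp) _).set (by simp) _).set (by simp) _).set
      (by simp) _).set (by simp) _).set (by simp) _).set (by simp) _).set (by simp) _).set
      (by simp) _).set (by simp) _).set (by simp) _).setNat (by simp) _).setNat (by simp) _
  refine ⟨_, r1, A1, h.base.agree A1, ?_, ?_, ?_⟩
  · simp [execDet, Store.set_num, Store.get, h.base.zero, Op.eval, h9, h10, h16, h17, h.rhs, h.acc,
      h.base.size, sampleTarget, accuracy]
    ring
  · simp [execDet]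
  · simp [execDet]

/-- Common to the two products of an inverse with a vector. The vector in `a` and the result in `b`
occupy different arrays, so no row overwrites the data of later ones. -/
lemma Runs.rowLoop {a b tb : ℕ} {P : Program} {σ : Store S.Wire} (hB : Base σ)
    (hab : (a = 20 ∧ b = 25) ∨ (a = 25 ∧ b = 4)) (f : Fin S.R → ℂ)
    (hP : ∀ (τ : Store S.Wire) (i : Fin S.R), Agree [5, 7] [5, 6, b] σ τ → τ.nat 5 = i →
      τ.num 5 0 0 = (matOf σ 22 S.R S.R *ᵥ fun j => σ.num a j 0) i →
      ∃ τ', Runs P τ tb τ' ∧ Agree [] [5, 6, b] τ τ' ∧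
        ∀ i' : ℕ, τ'.num b i' 0 = if i' = i then f i else τ.num b i' 0) :
    ∃ σ', Runs (HybridLS.forLoop 5 0 (.seq (HybridLS.dot ⟨22, 5, 7⟩ ⟨a, 7, 3⟩) P)) σ
        (S.R * (6 * S.R + tb + 9) + 3) σ' ∧
      Agree [5, 7] [5, 6, b] σ σ' ∧ ∀ i : Fin S.R, σ'.num b i 0 = f i := by
  have hB' : ∀ τ, Agree [5, 7] [5, 6, b] σ τ → Base τ := fun τ h => by
    rcases hab with ⟨rfl, rfl⟩ | ⟨rfl, rfl⟩ <;> exact hB.agree h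
  obtain ⟨σ', r, A', -, h'⟩ := Runs.forLoop (S := S) (x := 5) (y := 0) (n := S.R)
    (tb := 6 * S.R + tb + 6) (body := .seq (HybridLS.dot ⟨22, 5, 7⟩ ⟨a, 7, 3⟩) P) (σ := σ)
    (fun i τ => Agree [5, 7] [5, 6, b] σ τ ∧ τ.nat 5 = i ∧
      ∀ j : Fin S.R, (j : ℕ) < i → τ.num b j 0 = f j)
    ⟨(Agree.refl _).setNat (by simp) _, by simp, by simp⟩
    (fun i τ h => ⟨h.2.1, (hB' τ h.1).size⟩)
    (fun i τ hi ⟨hA, h5, hf⟩ => by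
      have hBτ := hB' τ hA
      obtain ⟨τ₁, q1, B1, d1⟩ := Runs.dot (S := S) (σ := τ) (ra := ⟨22, 5, 7⟩) (rb := ⟨a, 7, 3⟩)
        hBτ.size hBτ.zero hBτ.one (by simp)
        (by rcases hab with ⟨rfl, rfl⟩ | ⟨rfl, rfl⟩ <;> simp)
      have e22 : τ.num 22 = σ.num 22 := by
        rcases hab with ⟨rfl, rfl⟩ | ⟨rfl, rfl⟩ <;> exact hA.num 22 (by decide)
      have ea : τ.num a = σ.num a := by
        rcases hab with ⟨rfl, rfl⟩ | ⟨rfl, rfl⟩ <;> exact hA.num _ (by decide)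
      have d2 : τ₁.num 5 0 0 =
          (matOf σ 22 S.R S.R *ᵥ fun j => σ.num a j 0) (⟨i, hi⟩ : Fin S.R) := by
        rw [d1, Finset.sum_range]
        simp only [Ref.at, h5, hBτ.zero, e22, ea, Matrix.mulVec, dotProduct, matOf,
          Matrix.of_apply]
        norm_num
      have e5 : τ₁.nat 5 = i := by rw [B1.nat 5 (by decide), h5]
      have A1 : Agree [5, 7] [5, 6, b] σ τ₁ :=
        hA.trans (B1.mono (by decide) (by intro x hx; simp at hx ⊢; tauto))
      obtain ⟨τ₂, q2, B2, f2⟩ := hP τ₁ ⟨i, hi⟩ A1 e5 d2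
      have A2 : Agree [5, 7] [5, 6, b] σ τ₂ := A1.trans (B2.mono (by simp) (fun _ h => h))
      refine ⟨τ₂, (q1.seq q2).mono (by omega), (hB' τ₂ A2).one,
        by rw [B2.nat 5 (by simp), e5], A2.setNat (by simp) _, by simp, fun j hj => ?_⟩
      rw [Store.setNat_num, f2]
      rcases Nat.lt_succ_iff_lt_or_eq.1 hj with hj | hj
      · have eb : τ₁.num b = τ.num b := by
          rcases hab with ⟨rfl, rfl⟩ | ⟨rfl, rfl⟩ <;> exact B1.num _ (by decide)
        rw [if_neg hj.ne, eb, hf j hj]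
      · rw [if_pos hj]; congr 1; exact Fin.ext hj.symm)
  refine ⟨σ', r.mono ?_, A', fun i => h' i i.2⟩
  exact Nat.add_le_add_right (Nat.mul_le_mul_left _ (by omega)) _

/-- The array `25` becomes the solution for the first factor. -/
def weights : Program :=
  forLoop 5 0 (.seq (dot ⟨22, 5, 7⟩ ⟨20, 7, 3⟩) (block (.arith .div (sc 5) (sc 5) (sc 7))
    [.arith .mul (sc 5) (sc 5) (sc 2), .arith .mul (sc 6) ⟨0, 5, 3⟩ ⟨1, 5, 3⟩,
      .arith .div ⟨25, 5, 3⟩ (sc 5) (sc 6)]))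

lemma Runs.weights {ε : ℝ} {n : ℕ} {σ : Store S.Wire} (h : InputStore S ε σ)
    (h7 : σ.num 7 0 0 = n) :
    ∃ σ', Runs weights σ (S.R * (6 * S.R + 16) + 3) σ' ∧ Agree [5, 7] [5, 6, 25] σ σ' ∧
      ∀ i : Fin S.R, σ'.num 25 i 0 = (matOf σ 22 S.R S.R *ᵥ fun j => σ.num 20 j 0) i / n *
        S.rhsNorm / normProd S i := by
  refine Runs.rowLoop h.base (Or.inl ⟨rfl, rfl⟩) _ fun τ i hA h5 hd => ?_
  refine ⟨_, Runs.block τ _ _ (by simp [Instr.IsDet]),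
    ((((Agree.refl τ).set (by simp) _).set (by simp) _).set (by simp) _).set (by simp) _,
    fun i' => ?_⟩
  have hτ := h.agree hA
  have e7 : τ.num 7 0 0 = n := by rw [hA.num 7 (by decide), h7]
  simp [execDet, Store.set_num, Store.get, hτ.base.zero, h5, hd, e7, Op.eval, hτ.col i, hτ.row i,
    hτ.rhs, normProd]

/-- The output becomes the solution for the second factor. -/
def writeOutput : Program :=
  forLoop 5 0 (.seq (dot ⟨22, 5, 7⟩ ⟨25, 7, 3⟩)
    (block (.intConst (sc 6) 0) [.arith .add ⟨4, 5, 3⟩ (sc 5) (sc 6)]))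

lemma Runs.writeOutput {σ : Store S.Wire} (hB : Base σ) :
    ∃ σ', Runs writeOutput σ (S.R * (6 * S.R + 12) + 3) σ' ∧
      readOutput S σ' = matOf σ 22 S.R S.R *ᵥ fun j => σ.num 25 j 0 := by
  obtain ⟨σ', r, -, h⟩ := Runs.rowLoop hB (Or.inr ⟨rfl, rfl⟩) (tb := 3)
    (P := HybridLS.block (.intConst (sc 6) 0) [.arith .add ⟨4, 5, 3⟩ (sc 5) (sc 6)])
    (fun i => (matOf σ 22 S.R S.R *ᵥ fun j => σ.num 25 j 0) i) fun τ i hA h5 hd => by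
      refine ⟨_, Runs.block τ _ _ (by simp [Instr.IsDet]),
        ((Agree.refl τ).set (by simp) _).set (by simp) _, fun i' => ?_⟩
      have hτ := hB.agree hA
      simp [execDet, Store.set_num, Store.get, hτ.zero, h5, hd, Op.eval]
  exact ⟨σ', r.mono (le_of_eq (by ring)), funext h⟩

end

/-! ### The complete program and its failure probability. -/

section

variable {S : FactorizedSystem}

/-- The part of the algorithm after the number of samples has been found. -/
def finalProgram : Program :=
  -- The offset 2R with a single column selects the overlaps with |b⟩; later the offsets R, R select
  -- the rows. Adding variable `3`, which is zero, copies a variable.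
  seqs solveGram [block (.natAdd 12 0 0) [.natConst 13 1], estimate, weights,
    block (.natAdd 11 0 3) [.natAdd 12 0 3, .natAdd 13 0 3], solveGram, writeOutput]

/-- A bound for the running time of `finalProgram` with `n` samples. -/
def finalTime (L R n : ℕ) : ℕ :=
  2 * solveTime L R n + estimateTime L R 1 n + 12 * R * R + 28 * R + 20

/-- Three estimates, of U*U, U*b/‖b‖ and V*V, share the same sample number, and each of them fails
with probability at most δ. -/
lemma tri_finalProgram {K L n : ℕ} {δ ε ku kv D E s : ℝ} (hδ : 0 < δ) (hK : GoodFactor K δ)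
    (hε : 0 < ε) (hR : 0 < S.R) (hL : ∀ c, (S.inputGates c).length ≤ L) (hku : 1 ≤ ku)
    (hkv : 1 ≤ kv) (hu : SpectralBound S 0 ku) (hv : SpectralBound S S.R kv)
    (hd : ∀ j, 0 < normProd S j ∧ normProd S j ≤ D ∧ (normProd S j)⁻¹ ≤ E)
    (hs : s = sampleTarget S K (accuracy S ε ku kv D E)) (hn : n = ⌊s⌋₊ + 1)
    {σ : Store S.Wire} (hI : InputStore S ε σ) (hE : EstimateInput σ s 0 0)
    (h13 : σ.nat 13 = S.R) :
    Tri finalProgram σ (finalTime L S.R n) (3 * δ) fun σ' => S.IsSolution ε (readOutput S σ') := by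
  set y := accuracy S ε ku kv D E with hy
  have hβ0 : 0 < S.rhsNorm := S.rhsNorm_pos
  have hD : 0 < D := (hd ⟨0, hR⟩).1.trans_le (hd ⟨0, hR⟩).2.1
  have hE0 : 0 < E := (inv_pos.2 (hd ⟨0, hR⟩).1).trans_le (hd ⟨0, hR⟩).2.2
  have hDE : 1 ≤ D * E := by
    rw [← mul_inv_cancel₀ (hd ⟨0, hR⟩).1.ne']
    exact mul_le_mul (hd ⟨0, hR⟩).2.1 (hd ⟨0, hR⟩).2.2 (inv_pos.2 (hd ⟨0, hR⟩).1).le hD.le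
  have hβε : 1 ≤ (S.rhsNorm + ε) / ε := by rw [le_div_iff₀ hε]; linarith
  have hy1 : ku ≤ y ∧ kv ≤ y := by
    have h1 : 1 ≤ D * E * ((S.rhsNorm + ε) / ε) := one_le_mul_of_one_le_of_one_le hDE hβε
    have e : y = ku * kv * (D * E * ((S.rhsNorm + ε) / ε)) := by rw [hy, accuracy]; ring
    constructor
    · have := one_le_mul_of_one_le_of_one_le hkv h1
      rw [e]; nlinarith
    · have := one_le_mul_of_one_le_of_one_le hku h1
      rw [e]; nlinarith
  have hy0 : 0 < y := by linarith [hy1.1]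
  set t : ℝ := 1 / (16 * y) with ht
  have ht0 : 0 ≤ t := by positivity
  have htu : t ≤ 1 / (16 * ku) := one_div_le_one_div_of_le (by positivity) (by linarith [hy1.1])
  have htv : t ≤ 1 / (16 * kv) := one_div_le_one_div_of_le (by positivity) (by linarith [hy1.2])
  have hs0 : 0 ≤ s := by rw [hs, sampleTarget]; positivity
  have hdev : deviationProb S.R n t ≤ δ := by
    have := hK S.R n 1 t hR le_rfl ?_
    · simpa using this
    · have hsn : s ≤ n := by rw [hn]; push_cast; exact (Nat.lt_floor_add_one s).le
      calc (K * S.R * 1 / 16 : ℝ) = s * t ^ 2 := by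
            rw [hs, sampleTarget, ht]; field_simp
        _ ≤ _ := mul_le_mul_of_nonneg_right hsn (sq_nonneg _)
  refine (Tri.seq (η₁ := δ) (η₂ := 2 * δ) (t₂ := solveTime L S.R n + estimateTime L S.R 1 n +
    12 * S.R * S.R + 28 * S.R + 19) ((tri_solveGram hE hs0 hn h13 hL hR ht0 hku hu htu).mono le_rfl
      hdev fun _ h => h) (by positivity) fun σ₁ h1 => ?_).mono
    (by simp only [finalTime]; omega) (by linarith) (fun _ h => h)
  obtain ⟨A1, Gu, hGu, hXu⟩ := h1
  have hI1 := hI.agree A1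
  have r2 := Runs.block (S := S) σ₁ (.natAdd 12 0 0) [.natConst 13 1] (by simp [Instr.IsDet])
  set σ₂ := ([.natAdd 12 0 0, .natConst 13 1] : List Instr).foldl (execDet S) σ₁ with hσ₂
  have A2 : Agree [12, 13] [] σ₁ σ₂ := ((Agree.refl σ₁).setNat (by simp) _).setNat (by simp) _
  have hI2 := hI1.agree A2
  have hE2 : EstimateInput σ₂ s 0 (2 * S.R) := by
    refine ⟨hI2.base, ?_, ?_, ?_⟩
    · rw [A2.num 8 (by decide), A1.num 8 (by decide), hE.target]
    · rw [A2.nat 11 (by decide), A1.nat 11 (by decide), hE.row]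
    · simp [hσ₂, execDet, hI1.base.size, two_mul]
  refine (Tri.seq_runs r2 (Tri.seq (η₁ := δ) (η₂ := δ) (t₂ := solveTime L S.R n +
    12 * S.R * S.R + 28 * S.R + 14) ((tri_estimate (m := 1) hE2 hs0 hn (by simp [hσ₂, execDet]) hL hR
      one_pos hR ht0).mono le_rfl hdev fun _ h => h) hδ.le fun σ₃ h3 => ?_)).mono
    (by simp only [List.length_cons, List.length_nil]; omega) (by linarith) (fun _ h => h)
  obtain ⟨A3, n3, d3⟩ := h3
  have hI3 := hI2.agree A3
  obtain ⟨σ₄, r4, A4, w4⟩ := Runs.weights hI3 n3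
  have hI4 := hI3.agree A4
  have r5 := Runs.block (S := S) σ₄ (.natAdd 11 0 3) [.natAdd 12 0 3, .natAdd 13 0 3]
    (by simp [Instr.IsDet])
  set σ₅ := ([.natAdd 11 0 3, .natAdd 12 0 3, .natAdd 13 0 3] : List Instr).foldl
    (execDet S) σ₄ with hσ₅
  have A5 : Agree [11, 12, 13] [] σ₄ σ₅ :=
    (((Agree.refl σ₄).setNat (by simp) _).setNat (by simp) _).setNat (by simp) _
  have hI5 := hI4.agree A5
  have hE5 : EstimateInput σ₅ s S.R S.R := by
    refine ⟨hI5.base, ?_, ?_, ?_⟩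
    · rw [A5.num 8 (by decide), A4.num 8 (by decide), A3.num 8 (by decide), hE2.target]
    · simp [hσ₅, execDet, hI4.base.size, hI4.base.zero]
    · simp [hσ₅, execDet, hI4.base.size, hI4.base.zero]
  have h513 : σ₅.nat 13 = S.R := by simp [hσ₅, execDet, hI4.base.size, hI4.base.zero]
  refine (Tri.seq_runs r4 (Tri.seq_runs r5 (Tri.seq (η₁ := δ) (η₂ := 0) (t₂ := S.R * (6 * S.R + 12) + 3)
    ((tri_solveGram hE5 hs0 hn h513 hL hR ht0 hkv hv htv).mono le_rfl hdev fun _ h => h) le_rfl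
      fun σ₆ h6 => ?_))).mono
    (by simp only [List.length_cons, List.length_nil]; ring_nf; omega) (by linarith) (fun _ h => h)
  obtain ⟨A6, Gv, hGv, hXv⟩ := h6
  obtain ⟨σ₇, r7, o7⟩ := Runs.writeOutput (hI5.agree A6).base
  refine r7.tri ?_
  have hn0 : (n : ℂ) ≠ 0 := Nat.cast_ne_zero.2 (by omega)
  have hnr : (0 : ℝ) < n := by rw [hn]; positivity
  -- Estimating the right-hand side does not touch the inverse of the first Gram matrix.
  have e22 : matOf σ₃ 22 S.R S.R = matOf σ₁ 22 S.R S.R := by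
    rw [matOf, A3.num 22 (by decide), A2.num 22 (by decide)]; rfl
  have e25 : σ₆.num 25 = σ₄.num 25 := by rw [A6.num 25 (by decide), A5.num 25 (by decide)]
  refine isSolution_of_estimates hε hR hku hkv hu hv hd ht hGu hXu
    (g := (n : ℂ)⁻¹ • matOf σ₃ 20 S.R 1) ?_ hGv hXv (τ := fun i => σ₆.num 25 i 0) (fun i => ?_) o7
  · have e : (n : ℂ)⁻¹ • matOf σ₃ 20 S.R 1 - overlapMat S 0 (2 * S.R) S.R 1 =
        (n : ℂ)⁻¹ • (matOf σ₃ 20 S.R 1 - (n : ℂ) • overlapMat S 0 (2 * S.R) S.R 1) := by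
      rw [smul_sub, smul_smul, inv_mul_cancel₀ hn0, one_smul]
    rw [e, norm_smul, norm_inv, Complex.norm_natCast, inv_mul_le_iff₀ hnr]
    exact d3
  · have e : (fun j => ((n : ℂ)⁻¹ • matOf σ₃ 20 S.R 1) j 0) =
        (n : ℂ)⁻¹ • fun j : Fin S.R => σ₃.num 20 j 0 := by
      funext j; simp [matOf]
    change σ₆.num 25 i 0 = _
    rw [e25, w4, e22, e, Matrix.mulVec_smul, Pi.smul_apply, smul_eq_mul]
    ring

/-- The hybrid algorithm. -/
def leastSquares (K : ℕ) : Program :=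
  seqs (block (.natConst 4 1) [.intConst (sc 13) 1, .imagUnit (sc 14), .intConst (sc 6) 0,
    -- Scalar `14` becomes 0 − i, that is `testUnit true`.
    .arith .sub (sc 14) (sc 6) (sc 14), .natAdd 13 0 3])
    [calibrate K 9, block (.natAdd 11 0 3) [.natAdd 12 0 3], calibrate K 10, normExtremes,
      setTarget K, finalProgram]

/-- A bound for the running time of the algorithm. -/
def totalTime (K L R Mu Mv n : ℕ) : ℕ :=
  calibrateTime K L R Mu + calibrateTime K L R Mv + 12 * R + finalTime L R n + 52

lemma finalTime_mono (L R : ℕ) {n n' : ℕ} (h : n ≤ n') : finalTime L R n ≤ finalTime L R n' := by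
  unfold finalTime solveTime estimateTime
  gcongr

/-- Two calibrations and three estimates account for 5δ. The actual sample number depends on the
random results `ku`, `kv`; `n` bounds it deterministically through ku ≤ 2^Mu, kv ≤ 2^Mv and D·E ≤ q.
-/
lemma tri_leastSquares {K L Mu Mv n : ℕ} {δ ε qu qv q : ℝ} (hδ : 0 < δ) (hK : GoodFactor K δ)
    (hε : 0 < ε) (hR : 0 < S.R) (hL : ∀ c, (S.inputGates c).length ≤ L)
    (hqu : 0 < qu) (hMu : 2 * qu ≤ 2 ^ Mu) (hMu1 : 1 ≤ Mu)
    (hu : ∀ x, qu⁻¹ * nsq x ≤ qform (overlapMat S 0 0 S.R S.R) x ∧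
      qform (overlapMat S 0 0 S.R S.R) x ≤ qu * nsq x)
    (hqv : 0 < qv) (hMv : 2 * qv ≤ 2 ^ Mv) (hMv1 : 1 ≤ Mv)
    (hv : ∀ x, qv⁻¹ * nsq x ≤ qform (overlapMat S S.R S.R S.R S.R) x ∧
      qform (overlapMat S S.R S.R S.R S.R) x ≤ qv * nsq x)
    (hd : ∀ j, 0 < normProd S j) (hq : ∀ i j, normProd S i ≤ q * normProd S j)
    (hn : n = ⌊16 * K * S.R * (2 ^ Mu * 2 ^ Mv * q * ((S.rhsNorm + ε) / ε)) ^ 2⌋₊ + 1) :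
    Tri (leastSquares K) (startStore S ε) (totalTime K L S.R Mu Mv n) (5 * δ)
      fun σ' => S.IsSolution ε (readOutput S σ') := by
  set σ := startStore S ε with hσ
  have z3 : σ.nat 3 = 0 := by simp [hσ, startStore]
  have r1 := Runs.block (S := S) σ (.natConst 4 1) [.intConst (sc 13) 1, .imagUnit (sc 14),
    .intConst (sc 6) 0, .arith .sub (sc 14) (sc 6) (sc 14), .natAdd 13 0 3]
    (by simp [Instr.IsDet])
  set σ₁ := ([.natConst 4 1, .intConst (sc 13) 1, .imagUnit (sc 14), .intConst (sc 6) 0,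
    .arith .sub (sc 14) (sc 6) (sc 14), .natAdd 13 0 3] : List Instr).foldl (execDet S) σ with hσ₁
  have A1 : Agree [4, 13] [6, 13, 14] σ σ₁ := ((((((Agree.refl σ).setNat (by simp) _).set
    (by simp) _).set (by simp) _).set (by simp) _).set (by simp) _).setNat (by simp) _
  have hI1 : InputStore S ε σ₁ := by
    refine ⟨⟨?_, ?_, ?_, ?_, ?_⟩, fun j => ?_, fun j => ?_, ?_, ?_⟩
    · rw [A1.nat 0 (by decide)]; simp [hσ, startStore]
    · rw [A1.nat 3 (by decide), z3]
    · simp [hσ₁, execDet]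
    · intro ph
      cases ph <;> simp [hσ₁, execDet, Store.set_num, Store.get, z3, Op.eval, testUnit]
    · rw [A1.q]; rfl
    · rw [A1.num 0 (by decide)]; simp [hσ, startStore]
    · rw [A1.num 1 (by decide)]; simp [hσ, startStore]
    · rw [A1.num 2 (by decide)]; simp [hσ, startStore]
    · rw [A1.num 3 (by decide)]; simp [hσ, startStore]
  have hC1 : CalibrateInput σ₁ 0 := by
    refine ⟨hI1.base, ?_, ?_, ?_⟩
    · rw [A1.nat 11 (by decide)]; simp [hσ, startStore]
    · rw [A1.nat 12 (by decide)]; simp [hσ, startStore]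
    · simp [hσ₁, execDet, hσ, startStore]
  refine (Tri.seq_runs r1 (Tri.seq (η₁ := δ) (η₂ := 4 * δ) (t₂ := calibrateTime K L S.R Mv +
    12 * S.R + finalTime L S.R n + 39) (tri_calibrate hδ hK (Or.inl rfl) hR hL hC1 hqu hMu hMu1 hu)
      (by positivity) fun σ₂ h2 => ?_)).mono
    (by simp only [totalTime, List.length_cons, List.length_nil]; omega) (by linarith)
    (fun _ h => h)
  obtain ⟨A2, ku, hku, hku2, e9, hsu⟩ := h2
  have hI2 := hI1.agree A2
  have hC2 := hC1.agree A2
  have r3 := Runs.block (S := S) σ₂ (.natAdd 11 0 3) [.natAdd 12 0 3] (by simp [Instr.IsDet])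
  set σ₃ := ([.natAdd 11 0 3, .natAdd 12 0 3] : List Instr).foldl (execDet S) σ₂ with hσ₃
  have A3 : Agree [11, 12] [] σ₂ σ₃ := ((Agree.refl σ₂).setNat (by simp) _).setNat (by simp) _
  have hI3 := hI2.agree A3
  have hC3 : CalibrateInput σ₃ S.R := by
    refine ⟨hI3.base, ?_, ?_, ?_⟩
    · simp [hσ₃, execDet, hI2.base.size, hI2.base.zero]
    · simp [hσ₃, execDet, hI2.base.size, hI2.base.zero]
    · rw [A3.nat 13 (by decide), hC2.cols]
  refine (Tri.seq_runs r3 (Tri.seq (η₁ := δ) (η₂ := 3 * δ) (t₂ := 12 * S.R + finalTime L S.R n + 34)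
    (tri_calibrate hδ hK (Or.inr rfl) hR hL hC3 hqv hMv hMv1 hv)
      (by positivity) fun σ₄ h4 => ?_)).mono
    (by simp only [List.length_cons, List.length_nil]; omega) (by linarith) (fun _ h => h)
  obtain ⟨A4, kv, hkv, hkv2, e10, hsv⟩ := h4
  have hI4 := hI3.agree A4
  have hC4 := hC3.agree A4
  obtain ⟨σ₅, r5, A5, D, E, e16, e17, hX⟩ := Runs.normExtremes hI4
  have hI5 := hI4.agree A5
  have e9' : σ₅.num 9 0 0 = (ku : ℂ) := by
    rw [A5.num 9 (by decide), A4.num 9 (by decide), A3.num 9 (by decide), e9]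
  have e10' : σ₅.num 10 0 0 = (kv : ℂ) := by rw [A5.num 10 (by decide), e10]
  obtain ⟨σ₆, r6, A6, hE6⟩ := Runs.setTarget (K := K) hI5 e9' e10' e16 e17
  have hI6 := hI5.agree A6
  have h13 : σ₆.nat 13 = S.R := by
    rw [A6.nat 13 (by decide), A5.nat 13 (by decide), hC4.cols]
  have hd' : ∀ j, 0 < normProd S j ∧ normProd S j ≤ D ∧ (normProd S j)⁻¹ ≤ E := fun j =>
    ⟨hd j, hX.le j j.2⟩
  have hβ0 : 0 < S.rhsNorm := S.rhsNorm_pos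
  have hD0 : 0 < D := (hd' ⟨0, hR⟩).1.trans_le (hd' ⟨0, hR⟩).2.1
  have hE0 : 0 < E := (inv_pos.2 (hd' ⟨0, hR⟩).1).trans_le (hd' ⟨0, hR⟩).2.2
  have hDE : D * E ≤ q := by
    obtain ⟨i, hi⟩ := hX.fst.resolve_left hD0.ne'
    obtain ⟨j, hj⟩ := hX.snd.resolve_left hE0.ne'
    rw [hi, hj, ← div_eq_mul_inv, div_le_iff₀ (hd j)]
    exact hq i j
  set s := sampleTarget S K (accuracy S ε ku kv D E) with hs
  have hle : ⌊s⌋₊ + 1 ≤ n := by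
    rw [hn, hs, sampleTarget]
    refine Nat.add_le_add_right (Nat.floor_le_floor ?_) 1
    refine mul_le_mul_of_nonneg_left ?_ (by positivity)
    have hq0 : 0 < q := lt_of_lt_of_le (by positivity) hDE
    refine pow_le_pow_left₀ (by rw [accuracy]; positivity) ?_ 2
    rw [accuracy, mul_assoc (ku * kv)]
    gcongr
  refine (Tri.seq_runs r5 (Tri.seq_runs r6 (tri_finalProgram hδ hK hε hR hL hku hkv hsu hsv hd'
    hs rfl hI6 hE6 h13))).mono ?_ le_rfl (fun _ h => h)
  have := finalTime_mono L S.R hle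
  omega

end

/-! ### Singular values and the conditioning of normalized columns. -/

section

/-! ### Singular values -/

section Singular
variable {E F : Type*} [NormedAddCommGroup E] [InnerProductSpace ℂ E] [FiniteDimensional ℂ E]
  [NormedAddCommGroup F] [InnerProductSpace ℂ F] [FiniteDimensional ℂ F] (T : E →ₗ[ℂ] F)

/-- The coordinates with respect to the right singular vectors. -/
def singCoord (x : E) (i : Fin (Module.finrank ℂ E)) : ℂ :=
  (T.isSymmetric_adjoint_comp_self.eigenvectorBasis rfl).repr x i

lemma singCoord_gram (x : E) (i : Fin (Module.finrank ℂ E)) :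
    singCoord T (LinearMap.adjoint T (T x)) i = (T.singularValues i : ℂ) ^ 2 * singCoord T x i := by
  have := T.isSymmetric_adjoint_comp_self.eigenvectorBasis_apply_self_apply rfl x i
  rw [singCoord, singCoord]
  refine this.trans ?_
  rw [← T.sq_singularValues_fin rfl i]
  push_cast; rfl

lemma sq_norm_eq_sum_singCoord (x : E) : ‖x‖ ^ 2 = ∑ i, ‖singCoord T x i‖ ^ 2 := by
  rw [← (T.isSymmetric_adjoint_comp_self.eigenvectorBasis rfl).repr.norm_map x,
    EuclideanSpace.norm_sq_eq]
  rfl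

lemma sq_norm_apply_eq_sum (x : E) :
    ‖T x‖ ^ 2 = ∑ i : Fin (Module.finrank ℂ E), T.singularValues i ^ 2 * ‖singCoord T x i‖ ^ 2 := by
  have h : (inner ℂ (T x) (T x) : ℂ) = inner ℂ x (LinearMap.adjoint T (T x)) := by
    rw [LinearMap.adjoint_inner_right]
  rw [← Complex.ofReal_inj, Complex.ofReal_pow]
  refine (inner_self_eq_norm_sq_to_K (𝕜 := ℂ) (T x)).symm.trans ?_
  rw [h, ← (T.isSymmetric_adjoint_comp_self.eigenvectorBasis rfl).repr.inner_map_map,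
    PiLp.inner_apply, Complex.ofReal_sum]
  refine Finset.sum_congr rfl fun i _ => ?_
  have e := singCoord_gram T x i
  rw [RCLike.inner_apply]
  change singCoord T _ i * (starRingEnd ℂ) (singCoord T x i) = _
  rw [e, mul_assoc, Complex.mul_conj']
  push_cast; rfl

lemma sq_norm_adjoint_apply_eq_sum (x : E) : ‖LinearMap.adjoint T (T x)‖ ^ 2 =
    ∑ i : Fin (Module.finrank ℂ E), T.singularValues i ^ 4 * ‖singCoord T x i‖ ^ 2 := by
  rw [sq_norm_eq_sum_singCoord T]
  refine Finset.sum_congr rfl fun i _ => ?_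
  rw [singCoord_gram, norm_mul, norm_pow, Complex.norm_real, mul_pow, Real.norm_eq_abs, sq_abs]
  ring

lemma norm_apply_le_singularValues (x : E) : ‖T x‖ ≤ T.singularValues 0 * ‖x‖ := by
  refine le_of_sq_le_sq ?_ (mul_nonneg (T.singularValues_nonneg 0) (norm_nonneg x))
  rw [mul_pow, sq_norm_apply_eq_sum, sq_norm_eq_sum_singCoord T x, Finset.mul_sum]
  refine Finset.sum_le_sum fun i _ => mul_le_mul_of_nonneg_right ?_ (by positivity)
  exact pow_le_pow_left₀ (T.singularValues_nonneg i) (T.singularValues_antitone (Nat.zero_le i)) 2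

/-- Directions with singular value zero drop out on both sides, so injectivity is not needed; this
is what makes the bound applicable to the wide matrix `A₂`. -/
lemma singularValues_mul_norm_le_adjoint (x : E) :
    T.singularValues (Module.finrank ℂ (LinearMap.range T) - 1) * ‖T x‖ ≤
      ‖LinearMap.adjoint T (T x)‖ := by
  set r := Module.finrank ℂ (LinearMap.range T) with hr
  refine le_of_sq_le_sq ?_ (norm_nonneg _)
  rw [mul_pow, sq_norm_adjoint_apply_eq_sum, sq_norm_apply_eq_sum, Finset.mul_sum]
  refine Finset.sum_le_sum fun i _ => ?_
  rw [← mul_assoc]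
  refine mul_le_mul_of_nonneg_right ?_ (by positivity)
  by_cases hi : (i : ℕ) < r
  · have := T.singularValues_antitone (show (i : ℕ) ≤ r - 1 by omega)
    have h0 := T.singularValues_nonneg (r - 1)
    calc _ ≤ T.singularValues i ^ 2 * T.singularValues i ^ 2 :=
          mul_le_mul_of_nonneg_right (pow_le_pow_left₀ h0 this 2) (sq_nonneg _)
      _ = _ := by ring
  · rw [T.singularValues_eq_zero_iff_le_finrank_range.2 (not_lt.1 hi)]; simp

lemma singularValues_mul_norm_le (h : Module.finrank ℂ (LinearMap.range T) = Module.finrank ℂ E)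
    (x : E) : T.singularValues (Module.finrank ℂ (LinearMap.range T) - 1) * ‖x‖ ≤ ‖T x‖ := by
  refine le_of_sq_le_sq ?_ (norm_nonneg _)
  rw [mul_pow, sq_norm_apply_eq_sum, sq_norm_eq_sum_singCoord T x, Finset.mul_sum]
  refine Finset.sum_le_sum fun i _ => mul_le_mul_of_nonneg_right ?_ (by positivity)
  refine pow_le_pow_left₀ (T.singularValues_nonneg _) (T.singularValues_antitone ?_) 2
  have := i.2
  omega

end Singular

section Matrices
variable {m n : ℕ}

lemma rank_eq_finrank_toEuclideanLin (B : Matrix (Fin m) (Fin n) ℂ) :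
    Module.finrank ℂ (LinearMap.range (Matrix.toEuclideanLin B)) = B.rank := by
  rw [Matrix.rank_eq_finrank_range_toLin B (EuclideanSpace.basisFun (Fin m) ℂ).toBasis
    (EuclideanSpace.basisFun (Fin n) ℂ).toBasis, Matrix.toEuclideanLin_eq_toLin_orthonormal]

/-- The largest singular value of a matrix. -/
def maxSing (B : Matrix (Fin m) (Fin n) ℂ) : ℝ := (Matrix.toEuclideanLin B).singularValues 0

/-- The smallest nonzero singular value of a matrix. -/
def minSing (B : Matrix (Fin m) (Fin n) ℂ) : ℝ :=
  (Matrix.toEuclideanLin B).singularValues (B.rank - 1)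

lemma condNumber_eq (B : Matrix (Fin m) (Fin n) ℂ) : condNumber B = maxSing B / minSing B := rfl

lemma minSing_pos {B : Matrix (Fin m) (Fin n) ℂ} (h : 0 < B.rank) : 0 < minSing B := by
  rw [minSing, LinearMap.singularValues_pos_iff_lt_finrank_range, rank_eq_finrank_toEuclideanLin]
  omega

lemma minSing_le_maxSing (B : Matrix (Fin m) (Fin n) ℂ) : minSing B ≤ maxSing B :=
  LinearMap.singularValues_antitone _ (Nat.zero_le _)

lemma enorm2_mulVec_le_maxSing (B : Matrix (Fin m) (Fin n) ℂ) (x : Fin n → ℂ) :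
    enorm2 (B *ᵥ x) ≤ maxSing B * enorm2 x :=
  norm_apply_le_singularValues (Matrix.toEuclideanLin B) (WithLp.toLp 2 x)

lemma norm_le_maxSing (B : Matrix (Fin m) (Fin n) ℂ) : ‖B‖ ≤ maxSing B := by
  rw [Matrix.l2_opNorm_def]
  exact ContinuousLinearMap.opNorm_le_bound _ (LinearMap.singularValues_nonneg _ _) fun x =>
    norm_apply_le_singularValues (Matrix.toEuclideanLin B) x

lemma minSing_mul_le {B : Matrix (Fin m) (Fin n) ℂ} (h : B.rank = n) (x : Fin n → ℂ) :
    minSing B * enorm2 x ≤ enorm2 (B *ᵥ x) := by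
  have := singularValues_mul_norm_le (Matrix.toEuclideanLin B)
    (by rw [rank_eq_finrank_toEuclideanLin, h, finrank_euclideanSpace_fin]) (WithLp.toLp 2 x)
  rw [rank_eq_finrank_toEuclideanLin] at this
  exact this

lemma conjTranspose_mulVec_le_maxSing (B : Matrix (Fin m) (Fin n) ℂ) (x : Fin m → ℂ) :
    enorm2 (Bᴴ *ᵥ x) ≤ maxSing B * enorm2 x := by
  refine (enorm2_mulVec_le Bᴴ x).trans (mul_le_mul_of_nonneg_right ?_ (enorm2_nonneg x))
  rw [Matrix.l2_opNorm_conjTranspose]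
  exact norm_le_maxSing B

/-- Full row rank makes `B` surjective. Writing x = B y reduces the claim to
`singularValues_mul_norm_le_adjoint`, and the singular values of `Bᴴ` never have to be related to
those of `B`. -/
lemma minSing_mul_le_conjTranspose {B : Matrix (Fin m) (Fin n) ℂ} (h : B.rank = m)
    (x : Fin m → ℂ) : minSing B * enorm2 x ≤ enorm2 (Bᴴ *ᵥ x) := by
  have hr : LinearMap.range (Matrix.toEuclideanLin B) = ⊤ :=
    Submodule.eq_top_of_finrank_eq
      (by rw [rank_eq_finrank_toEuclideanLin, h, finrank_euclideanSpace_fin])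
  obtain ⟨y, hy⟩ := LinearMap.range_eq_top.1 hr (WithLp.toLp 2 x)
  have := singularValues_mul_norm_le_adjoint (Matrix.toEuclideanLin B) y
  rw [rank_eq_finrank_toEuclideanLin, hy, ← Matrix.toEuclideanLin_conjTranspose_eq_adjoint] at this
  exact this

/-- Conditioning of a matrix after normalization of its columns. -/
lemma normalized_columns {R : ℕ} {W : Matrix (Fin n) (Fin R) ℂ} {d : Fin R → ℝ} {lo hi : ℝ}
    (hlo : 0 < lo) (hW : ∀ j, enorm2 (W *ᵥ Pi.single j 1) = 1) (hd : ∀ j, 0 ≤ d j)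
    (hl : ∀ z : Fin R → ℂ, lo * enorm2 z ≤ enorm2 (W *ᵥ fun j => (d j : ℂ) * z j))
    (hh : ∀ z : Fin R → ℂ, enorm2 (W *ᵥ fun j => (d j : ℂ) * z j) ≤ hi * enorm2 z) :
    (∀ j, lo ≤ d j ∧ d j ≤ hi) ∧ ∀ x, ((hi / lo) ^ 2)⁻¹ * nsq x ≤ qform (Wᴴ * W) x ∧
      qform (Wᴴ * W) x ≤ (hi / lo) ^ 2 * nsq x := by
  -- The two bounds at the `j`-th basis vector: its image is a unit column times `d j`.
  have b : ∀ j, lo ≤ d j ∧ d j ≤ hi := fun j => by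
    have e : (fun i => (d i : ℂ) * (Pi.single j 1 : Fin R → ℂ) i) =
        (d j : ℂ) • (Pi.single j 1 : Fin R → ℂ) := by
      funext i
      by_cases h : i = j
      · subst h; simp
      · simp [h]
    have e1 : enorm2 (Pi.single j 1 : Fin R → ℂ) = 1 := by
      have : enorm2 (Pi.single j 1 : Fin R → ℂ) ^ 2 = 1 := by
        rw [enorm2_sq, ← Pi.single_star, star_one, single_dotProduct]; simp
      nlinarith [enorm2_nonneg (Pi.single j 1 : Fin R → ℂ)]
    have h1 := hl (Pi.single j 1)
    have h2 := hh (Pi.single j 1)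
    rw [e, Matrix.mulVec_smul, enorm2_smul, hW, e1, Complex.norm_real,
      Real.norm_of_nonneg (hd j), mul_one, mul_one] at h1 h2
    exact ⟨h1, h2⟩
  refine ⟨b, fun x => ?_⟩
  have dpos : ∀ j, 0 < d j := fun j => hlo.trans_le (b j).1
  rcases Nat.eq_zero_or_pos R with hR | hR
  · subst hR
    have : x = 0 := Subsingleton.elim _ _
    simp [this, qform, nsq]
  have hhi : 0 < hi := (dpos ⟨0, hR⟩).trans_le (b ⟨0, hR⟩).2
  -- `z` undoes the scaling by `d`, so ‖z‖ lies between ‖x‖/hi and ‖x‖/lo; only one factor hi/lo is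
  -- lost on each side.
  set z : Fin R → ℂ := fun j => (((d j)⁻¹ : ℝ) : ℂ) * x j with hz
  have ex : (fun j => (d j : ℂ) * z j) = x := by
    funext j
    have : (d j : ℂ) ≠ 0 := by exact_mod_cast (dpos j).ne'
    simp only [hz]; push_cast; field_simp
  have z1 : enorm2 z ≤ lo⁻¹ * enorm2 x := enorm2_mul_le (inv_pos.2 hlo).le (fun j => by
    rw [Complex.norm_real, Real.norm_of_nonneg (inv_pos.2 (dpos j)).le]
    exact inv_anti₀ hlo (b j).1) x
  have z2 : enorm2 x ≤ hi * enorm2 z := by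
    rw [← ex]
    exact enorm2_mul_le hhi.le (fun j => by
      rw [Complex.norm_real, Real.norm_of_nonneg (dpos j).le]; exact (b j).2) z
  have l1 := hl z
  have u1 := hh z
  rw [ex] at l1 u1
  have x0 := enorm2_nonneg x
  have w0 := enorm2_nonneg (W *ᵥ x)
  rw [nsq_eq, qform_gram]
  constructor
  · rw [← inv_pow, ← mul_pow]
    refine pow_le_pow_left₀ (by positivity) ?_ 2
    rw [inv_div, div_mul_eq_mul_div, div_le_iff₀ hhi]
    have := mul_le_mul_of_nonneg_left z2 hlo.le
    nlinarith
  · rw [← mul_pow]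
    refine pow_le_pow_left₀ w0 (u1.trans ?_) 2
    have := mul_le_mul_of_nonneg_left z1 hhi.le
    calc _ ≤ _ := this
      _ = _ := by ring

end Matrices

variable {S : FactorizedSystem}

lemma mulVec_single_eq {n R : ℕ} (f : Fin R → Fin n → ℂ) (j : Fin R) :
    (Matrix.of fun i j => f j i : Matrix (Fin n) (Fin R) ℂ) *ᵥ Pi.single j 1 = f j := by
  ext i; simp

lemma enorm2_u (j : Fin S.R) : enorm2 (S.u j) = 1 := by
  have : enorm2 (S.u j) ^ 2 = 1 := by
    rw [← nsq_eq]; exact sum_norm_sq_prepared (S.prepares_col j)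
  nlinarith [enorm2_nonneg (S.u j)]

lemma enorm2_v (j : Fin S.R) : enorm2 (S.v j) = 1 := by
  have : enorm2 (S.v j) ^ 2 = 1 := by
    rw [← nsq_eq]; exact sum_norm_sq_prepared (S.prepares_row j)
  nlinarith [enorm2_nonneg (S.v j)]

lemma conjTranspose_A₂_mulVec (S : FactorizedSystem) (z : Fin S.R → ℂ) :
    S.A₂ᴴ *ᵥ z = rowMat S *ᵥ fun j => (S.rowNorm j : ℂ) * z j := by
  ext i
  simp only [Matrix.mulVec, dotProduct, FactorizedSystem.A₂, rowMat, Matrix.of_apply,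
    Matrix.conjTranspose_apply]
  exact Finset.sum_congr rfl fun j _ => by simp; ring

lemma col_bounds (h : S.A₁.rank = S.R) (hR : 0 < S.R) :
    (∀ j, minSing S.A₁ ≤ S.colNorm j ∧ S.colNorm j ≤ maxSing S.A₁) ∧
    ∀ x, (condNumber S.A₁ ^ 2)⁻¹ * nsq x ≤ qform (overlapMat S 0 0 S.R S.R) x ∧
      qform (overlapMat S 0 0 S.R S.R) x ≤ condNumber S.A₁ ^ 2 * nsq x := by
  rw [overlapMat_col, condNumber_eq]
  refine normalized_columns (minSing_pos (by omega)) (fun j => ?_) S.colNorm_nonneg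
    (fun z => ?_) (fun z => ?_)
  · rw [colMat, mulVec_single_eq, enorm2_u]
  · rw [← A₁_mulVec]; exact minSing_mul_le h z
  · rw [← A₁_mulVec]; exact enorm2_mulVec_le_maxSing _ z

/-- The vectors ‖v_j‖|v_j⟩ are the columns of `A₂ᴴ`, so the bounds are applied to the conjugate
transpose. -/
lemma row_bounds (h : S.A₂.rank = S.R) (hR : 0 < S.R) :
    (∀ j, minSing S.A₂ ≤ S.rowNorm j ∧ S.rowNorm j ≤ maxSing S.A₂) ∧
    ∀ x, (condNumber S.A₂ ^ 2)⁻¹ * nsq x ≤ qform (overlapMat S S.R S.R S.R S.R) x ∧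
      qform (overlapMat S S.R S.R S.R S.R) x ≤ condNumber S.A₂ ^ 2 * nsq x := by
  rw [overlapMat_row, condNumber_eq]
  refine normalized_columns (minSing_pos (by omega)) (fun j => ?_) S.rowNorm_nonneg
    (fun z => ?_) (fun z => ?_)
  · rw [rowMat, mulVec_single_eq, enorm2_v]
  · rw [← conjTranspose_A₂_mulVec]; exact minSing_mul_le_conjTranspose h z
  · rw [← conjTranspose_A₂_mulVec]; exact conjTranspose_mulVec_le_maxSing _ z

lemma one_le_condNumber {m n : ℕ} {B : Matrix (Fin m) (Fin n) ℂ} (h : 0 < B.rank) :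
    1 ≤ condNumber B := by
  rw [condNumber_eq, one_le_div (minSing_pos h)]; exact minSing_le_maxSing B

lemma sq_norms_le_Γ (S : FactorizedSystem) (j : Fin S.R) :
    S.colNorm j ^ 2 ≤ S.Γ ∧ S.rowNorm j ^ 2 ≤ S.Γ := by
  have h : max (max (S.colNorm j ^ 2) (S.colNorm j * S.rhsNorm)) (S.rowNorm j ^ 2) ≤ S.Γ :=
    le_ciSup (f := fun j : Fin S.R =>
      max (max (S.colNorm j ^ 2) (S.colNorm j * S.rhsNorm)) (S.rowNorm j ^ 2))
      (Set.finite_range _).bddAbove j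
  exact ⟨((le_max_left _ _).trans (le_max_left _ _)).trans h, (le_max_right _ _).trans h⟩

/-- For each factor the largest singular value is the condition number times the smallest one, and
the smallest is at most any column (row) norm; AM–GM bounds the product of two norms by Γ. This is
how Γ and the lower bound for ‖A‖ enter the running time. -/
lemma norm_A_le (h₁ : S.A₁.rank = S.R) (h₂ : S.A₂.rank = S.R) (hR : 0 < S.R) :
    ‖S.A‖ ≤ condNumber S.A₁ * condNumber S.A₂ * S.Γ := by
  set j : Fin S.R := ⟨0, hR⟩
  have p₁ := minSing_pos (B := S.A₁) (by omega)
  have p₂ := minSing_pos (B := S.A₂) (by omega)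
  have c₁ := ((col_bounds h₁ hR).1 j).1
  have c₂ := ((row_bounds h₂ hR).1 j).1
  have g := sq_norms_le_Γ S j
  have hΓ : minSing S.A₁ * minSing S.A₂ ≤ S.Γ := by
    have := mul_le_mul c₁ c₂ p₂.le (S.colNorm_nonneg j)
    nlinarith [sq_nonneg (S.colNorm j - S.rowNorm j)]
  calc ‖S.A‖ ≤ ‖S.A₁‖ * ‖S.A₂‖ := Matrix.l2_opNorm_mul _ _
    _ ≤ maxSing S.A₁ * maxSing S.A₂ := mul_le_mul (norm_le_maxSing _) (norm_le_maxSing _)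
        (norm_nonneg _) (p₁.le.trans (minSing_le_maxSing _))
    _ = condNumber S.A₁ * condNumber S.A₂ * (minSing S.A₁ * minSing S.A₂) := by
        rw [condNumber_eq, condNumber_eq]; field_simp
    _ ≤ _ := mul_le_mul_of_nonneg_left hΓ (mul_nonneg
        (zero_le_one.trans (one_le_condNumber (by omega)))
        (zero_le_one.trans (one_le_condNumber (by omega))))

lemma normProd_bounds (h₁ : S.A₁.rank = S.R) (h₂ : S.A₂.rank = S.R) (hR : 0 < S.R) :
    (∀ j, 0 < normProd S j) ∧
      ∀ i j, normProd S i ≤ condNumber S.A₁ * condNumber S.A₂ * normProd S j := by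
  have p₁ := minSing_pos (B := S.A₁) (by omega)
  have p₂ := minSing_pos (B := S.A₂) (by omega)
  have c₁ := (col_bounds h₁ hR).1
  have c₂ := (row_bounds h₂ hR).1
  refine ⟨fun j => mul_pos (p₁.trans_le (c₁ j).1) (p₂.trans_le (c₂ j).1), fun i j => ?_⟩
  calc normProd S i ≤ maxSing S.A₁ * maxSing S.A₂ :=
        mul_le_mul (c₁ i).2 (c₂ i).2 (S.rowNorm_nonneg i) ((S.colNorm_nonneg i).trans (c₁ i).2)
    _ = condNumber S.A₁ * condNumber S.A₂ * (minSing S.A₁ * minSing S.A₂) := by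
        rw [condNumber_eq, condNumber_eq]; field_simp
    _ ≤ _ := mul_le_mul_of_nonneg_left
        (mul_le_mul (c₁ j).1 (c₂ j).1 p₂.le (S.colNorm_nonneg j)) (mul_nonneg
        (zero_le_one.trans (one_le_condNumber (by omega)))
        (zero_le_one.trans (one_le_condNumber (by omega))))

end

/-! ### Collecting the running time. -/

section

/-! ### The running time -/

lemma polynomial_eval_le (p : Polynomial ℕ) {x : ℕ} {y : ℝ} (hy : 1 ≤ y) (hx : (x : ℝ) ≤ y) :
    ((p.eval x : ℕ) : ℝ) ≤ p.eval 1 * y ^ p.natDegree := by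
  rw [Polynomial.eval_eq_sum_range, Polynomial.eval_eq_sum_range]
  push_cast
  rw [Finset.sum_mul]
  refine Finset.sum_le_sum fun i hi => ?_
  rw [one_pow, mul_one]
  refine mul_le_mul_of_nonneg_left ?_ (Nat.cast_nonneg _)
  exact (pow_le_pow_left₀ (Nat.cast_nonneg x) hx i).trans
    (pow_le_pow_right₀ hy (Nat.lt_succ_iff.1 (Finset.mem_range.1 hi)))

/-- The factor 2 covers the change of base, as log 2 ≥ 1/2, and the summand 1 covers the rounding
up. -/
lemma qubits_le (N : ℕ) : (qubits N : ℝ) ≤ 2 * (1 + Real.log N) := by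
  have hlog : 0 ≤ Real.log N := Real.log_natCast_nonneg N
  rcases Nat.lt_or_ge 1 N with h | h
  · have h1 : 2 ^ (qubits N - 1) < N := Nat.pow_pred_clog_lt_self (by norm_num) h
    have h2 : ((2 : ℝ) ^ (qubits N - 1)) ≤ N := by exact_mod_cast h1.le
    have h3 := Real.log_le_log (by positivity) h2
    rw [Real.log_pow] at h3
    have h4 : ((qubits N : ℕ) : ℝ) ≤ ((qubits N - 1 : ℕ) : ℝ) + 1 := by
      exact_mod_cast (by omega : qubits N ≤ qubits N - 1 + 1)
    have h5 : (1 / 2 : ℝ) ≤ Real.log 2 := by linarith [Real.log_two_gt_d9]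
    have h6 : (0 : ℝ) ≤ ((qubits N - 1 : ℕ) : ℝ) := Nat.cast_nonneg _
    nlinarith
  · have : qubits N = 0 := Nat.clog_of_right_le_one h 2
    rw [this]; push_cast; linarith

variable {S : FactorizedSystem}

/-- A bound for the numbers of gates. -/
def gateBound (S : FactorizedSystem) (p : Polynomial ℕ) : ℕ :=
  p.eval (qubits S.N) * qubits S.N + p.eval (qubits S.M) * qubits S.M

/-- Gates are counted as depth times number of qubits, whence the degree of `p` plus one. The `+ 1`
on the left keeps the gate factor positive even for empty circuits. -/
lemma gateBound_le (p : Polynomial ℕ) {w : ℝ}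
    (hw : 1 + Real.log S.M + Real.log S.N ≤ w) :
    (gateBound S p : ℝ) + 1 ≤
      (2 * p.eval 1 * 2 ^ (p.natDegree + 1) + 1) * w ^ (p.natDegree + 1) := by
  have hM : 0 ≤ Real.log S.M := Real.log_natCast_nonneg _
  have hN : 0 ≤ Real.log S.N := Real.log_natCast_nonneg _
  have hw1 : 1 ≤ w := by linarith
  have hw2 : 1 ≤ 2 * w := by linarith
  have key : ∀ n : ℕ, (n : ℝ) ≤ 2 * w →
      ((p.eval n : ℕ) : ℝ) * n ≤ p.eval 1 * (2 * w) ^ (p.natDegree + 1) := fun n hn => by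
    calc _ ≤ p.eval 1 * (2 * w) ^ p.natDegree * (2 * w) :=
          mul_le_mul (polynomial_eval_le p hw2 hn) hn (Nat.cast_nonneg _) (by positivity)
      _ = _ := by ring
  have h1 := key (qubits S.N) ((qubits_le S.N).trans (by linarith))
  have h2 := key (qubits S.M) ((qubits_le S.M).trans (by linarith))
  have h3 : (1 : ℝ) ≤ w ^ (p.natDegree + 1) := one_le_pow₀ hw1
  rw [gateBound]
  push_cast
  rw [mul_pow] at h1 h2
  nlinarith

lemma exists_two_pow {q : ℝ} (hq : 1 ≤ q) : ∃ M : ℕ, 1 ≤ M ∧ 2 * q ≤ 2 ^ M ∧ (2 : ℝ) ^ M ≤ 4 * q := by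
  obtain ⟨n, h1, h2⟩ := exists_nat_pow_near (by linarith : 1 ≤ 2 * q) (one_lt_two (α := ℝ))
  refine ⟨n + 1, by omega, h2.le, ?_⟩
  rw [pow_succ]; linarith

/-- At most R² entries, at most R·X samples for each, O(L + 1) steps per sample: the source of R³.
-/
lemma estimateTime_le {L R m n : ℕ} {X : ℝ} (hR : 1 ≤ R) (hm : m ≤ R) (hX : 1 ≤ X)
    (hn : (n : ℝ) ≤ R * X) :
    (estimateTime L R m n : ℝ) ≤ 100 * ((L + 1) * R ^ 3 * X) := by
  have hR' : (1 : ℝ) ≤ R := by exact_mod_cast hR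
  have hm' : (m : ℝ) ≤ R := by exact_mod_cast hm
  have hL : (1 : ℝ) ≤ (L : ℝ) + 1 := by linarith [Nat.cast_nonneg (α := ℝ) L]
  have hRX : (1 : ℝ) ≤ R * X := one_le_mul_of_one_le_of_one_le hR' hX
  have hP : (1 : ℝ) ≤ (L + 1) * (R * X) := one_le_mul_of_one_le_of_one_le hL hRX
  have e1 : (n : ℝ) * (16 * L + 52) + 14 ≤ 66 * ((L + 1) * (R * X)) := by
    have : (n : ℝ) * (16 * L + 52) ≤ R * X * (52 * (L + 1)) :=
      mul_le_mul hn (by linarith [Nat.cast_nonneg (α := ℝ) L]) (by positivity) (by positivity)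
    nlinarith
  have e2 : (m : ℝ) * (n * (16 * L + 52) + 14) ≤ R * (66 * ((L + 1) * (R * X))) :=
    mul_le_mul hm' e1 (by positivity) (by positivity)
  have e3 : (1 : ℝ) ≤ R * ((L + 1) * (R * X)) := one_le_mul_of_one_le_of_one_le hR' hP
  have e4 : (1 : ℝ) ≤ R * (R * ((L + 1) * (R * X))) := one_le_mul_of_one_le_of_one_le hR' e3
  have e5 : (R : ℝ) * (m * (n * (16 * L + 52) + 14) + 12) ≤
      R * (78 * (R * ((L + 1) * (R * X)))) :=
    mul_le_mul_of_nonneg_left (by linarith) (by positivity)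
  have e6 : (R : ℝ) * (R * ((L + 1) * (R * X))) = (L + 1) * R ^ 3 * X := by ring
  rw [estimateTime]
  push_cast
  linarith

lemma fillTime_le {R : ℕ} (hR : 1 ≤ R) : (fillTime R : ℝ) ≤ 25 * (R : ℝ) ^ 3 := by
  have : fillTime R ≤ 25 * R ^ 3 := by
    unfold fillTime
    have h1 : R ≤ R ^ 3 := Nat.le_self_pow (by norm_num) R
    have h2 : R ^ 2 ≤ R ^ 3 := Nat.pow_le_pow_right hR (by norm_num)
    nlinarith
  exact_mod_cast this

lemma invertTime_le {R : ℕ} (hR : 1 ≤ R) : (invertTime R : ℝ) ≤ 82 * (R : ℝ) ^ 3 := by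
  have : invertTime R ≤ 82 * R ^ 3 := by
    unfold invertTime
    have h1 : R ≤ R ^ 3 := Nat.le_self_pow (by norm_num) R
    have h2 : R ^ 2 ≤ R ^ 3 := Nat.pow_le_pow_right hR (by norm_num)
    nlinarith
  exact_mod_cast this

/-- Since 8^M = (2^M)³, the cost is cubic in q; it is later used with q = κ₁² and q = κ₂², which is
no worse than the κ⁶ of the final estimates. -/
lemma calibrateTime_le {K L R M : ℕ} {q : ℝ} (hR : 1 ≤ R) (hM : (2 : ℝ) ^ M ≤ 4 * q)
    (hq : 1 ≤ q) :
    (calibrateTime K L R M : ℝ) ≤ 200000 * (K + 1) * ((L + 1) * R ^ 3 * q ^ 3) := by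
  have hR' : (1 : ℝ) ≤ R := by exact_mod_cast hR
  have hR3 : (1 : ℝ) ≤ (R : ℝ) ^ 3 := one_le_pow₀ hR'
  have hL : (0 : ℝ) ≤ L := Nat.cast_nonneg L
  have hK : (0 : ℝ) ≤ K := Nat.cast_nonneg K
  have e1 := estimateTime_le (L := L) (n := K * R + 1) (X := K + 1) hR le_rfl (by linarith)
    (by push_cast; nlinarith)
  have e2 : (R : ℝ) ^ 3 ≤ (L + 1) * R ^ 3 * (K + 1) := by
    have : (1 : ℝ) ≤ (L + 1) * (K + 1) := by nlinarith
    nlinarith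
  have e3 : (roundTime L R (K * R + 1) + 1 : ℝ) ≤ 351 * ((L + 1) * R ^ 3 * (K + 1)) := by
    rw [roundTime]; push_cast
    linarith [fillTime_le hR, invertTime_le hR]
  have e4 : (8 : ℝ) ^ (M + 1) ≤ 512 * q ^ 3 := by
    have : (8 : ℝ) ^ M = (2 ^ M) ^ 3 := by rw [← pow_mul, mul_comm, pow_mul]; norm_num
    rw [pow_succ, this]
    have := pow_le_pow_left₀ (by positivity) hM 3
    nlinarith
  have e5 : (roundTime L R (K * R + 1) + 1 : ℝ) * 8 ^ (M + 1) ≤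
      351 * ((L + 1) * R ^ 3 * (K + 1)) * (512 * q ^ 3) :=
    mul_le_mul e3 e4 (by positivity) (by positivity)
  have e6 : (1 : ℝ) ≤ (L + 1) * R ^ 3 * (K + 1) * q ^ 3 :=
    one_le_mul_of_one_le_of_one_le (by linarith) (one_le_pow₀ hq)
  rw [calibrateTime]; push_cast
  nlinarith

lemma finalTime_le {L R n : ℕ} {X : ℝ} (hR : 1 ≤ R) (hX : 1 ≤ X) (hn : (n : ℝ) ≤ R * X) :
    (finalTime L R n : ℝ) ≤ 700 * ((L + 1) * R ^ 3 * X) := by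
  have hR' : (1 : ℝ) ≤ R := by exact_mod_cast hR
  have hL : (0 : ℝ) ≤ L := Nat.cast_nonneg L
  have h1 : (R : ℝ) ≤ (R : ℝ) ^ 3 := le_self_pow₀ hR' (by norm_num)
  have h2 : (R : ℝ) * R ≤ (R : ℝ) ^ 3 := by
    rw [← sq]; exact pow_le_pow_right₀ hR' (by norm_num)
  have e2 : (R : ℝ) ^ 3 ≤ (L + 1) * R ^ 3 * X := by
    have : (1 : ℝ) ≤ (L + 1) * X := by nlinarith
    have h0 : (0 : ℝ) ≤ (R : ℝ) ^ 3 := by positivity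
    nlinarith
  rw [finalTime, solveTime]; push_cast
  linarith [fillTime_le hR, invertTime_le hR, estimateTime_le (L := L) hR le_rfl hX hn,
    estimateTime_le (L := L) hR hR hX hn]

lemma totalTime_le {K L R Mu Mv n : ℕ} {qu qv q X : ℝ} (hR : 1 ≤ R) (hMu : (2 : ℝ) ^ Mu ≤ 4 * qu)
    (hqu : 1 ≤ qu) (hMv : (2 : ℝ) ^ Mv ≤ 4 * qv) (hqv : 1 ≤ qv) (hq1 : qu ≤ q) (hq2 : qv ≤ q)
    (hX : q ^ 3 ≤ X) (hn : (n : ℝ) ≤ R * ((4097 * (K + 1)) * X)) :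
    (totalTime K L R Mu Mv n : ℝ) ≤ 10000000 * (K + 1) * ((L + 1) * R ^ 3 * X) := by
  have hK : (0 : ℝ) ≤ K := Nat.cast_nonneg K
  have hL : (0 : ℝ) ≤ L := Nat.cast_nonneg L
  have hR' : (1 : ℝ) ≤ R := by exact_mod_cast hR
  have hX1 : 1 ≤ X := (one_le_pow₀ (hqu.trans hq1)).trans hX
  set Y := ((L : ℝ) + 1) * R ^ 3 with hY
  have h1 : (R : ℝ) ≤ (R : ℝ) ^ 3 := le_self_pow₀ hR' (by norm_num)
  have hRY : (R : ℝ) ≤ Y := by nlinarith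
  have hY1 : 1 ≤ Y := hR'.trans hRY
  have c1 := calibrateTime_le (K := K) (L := L) hR hMu hqu
  have c2 := calibrateTime_le (K := K) (L := L) hR hMv hqv
  have f := finalTime_le (L := L) hR (X := (4097 * (K + 1)) * X) (by nlinarith) hn
  have q1 : Y * qu ^ 3 ≤ Y * X :=
    mul_le_mul_of_nonneg_left ((pow_le_pow_left₀ (by linarith) hq1 3).trans hX) (by linarith)
  have q2 : Y * qv ^ 3 ≤ Y * X :=
    mul_le_mul_of_nonneg_left ((pow_le_pow_left₀ (by linarith) hq2 3).trans hX) (by linarith)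
  have hYX : Y ≤ Y * X := le_mul_of_one_le_right (by linarith) hX1
  have r1 : (K + 1) * (Y * qu ^ 3) ≤ (K + 1) * (Y * X) :=
    mul_le_mul_of_nonneg_left q1 (by linarith)
  have r2 : (K + 1) * (Y * qv ^ 3) ≤ (K + 1) * (Y * X) :=
    mul_le_mul_of_nonneg_left q2 (by linarith)
  have r3 : Y ≤ (K + 1) * (Y * X) := by nlinarith
  rw [totalTime]; push_cast
  nlinarith

/-- The constant in the running time, up to the factor that depends on the accuracy. -/
def timeConst (K : ℕ) (p : Polynomial ℕ) : ℝ :=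
  10000000 * (K + 1) * (2 * p.eval 1 * 2 ^ (p.natDegree + 1) + 1)

lemma combine_bounds {a r l G w w₁ w₂ k₆ g k₈ c z e ε : ℝ} (ha : 0 ≤ a) (hr : 0 ≤ r)
    (hl0 : 0 ≤ G * w₁) (hk0 : 0 ≤ k₆) (hz0 : 0 ≤ z) (hg0 : 0 ≤ g * k₈ / c) (hl : l ≤ G * w₁)
    (hk : k₆ ≤ g * k₈ / c) (hz : z ≤ w₂ * e / ε) (hw : w₁ * w₂ = w) :
    a * (l * r * (k₆ * z)) ≤ a * G * e / c * (r * g * k₈ * w) / ε := by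
  calc a * (l * r * (k₆ * z)) ≤ a * (G * w₁ * r * (g * k₈ / c * (w₂ * e / ε))) :=
        mul_le_mul_of_nonneg_left (mul_le_mul (mul_le_mul_of_nonneg_right hl hr)
          (mul_le_mul hk hz hz0 hg0) (mul_nonneg hk0 hz0) (mul_nonneg hl0 hr)) ha
    _ = _ := by rw [← hw]; ring

lemma exists_running_time {K : ℕ} {δ c ε ε₀ : ℝ} {p : Polynomial ℕ} (hδ : 0 < δ)
    (hK : GoodFactor K δ) (hc : 0 < c) (hε : 0 < ε) (hε₀ : ε ≤ ε₀) (hp : S.DepthAtMost p)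
    (h₁ : S.A₁.rank = S.R) (h₂ : S.A₂.rank = S.R) (hA : c ≤ ‖S.A‖) :
    ∃ T : ℕ, (T : ℝ) ≤ timeConst K p * (1 + ε₀) ^ 2 / c ^ 2 * ((S.R : ℝ) ^ 3 * S.Γ ^ 2 *
        (condNumber S.A₁ * condNumber S.A₂) ^ 8 *
          (1 + Real.log S.M + Real.log S.N + S.rhsNorm) ^ (p.natDegree + 3)) / ε ^ 2 ∧
      ENNReal.ofReal (1 - 5 * δ) ≤ successProb (leastSquares K) S ε T := by
  -- For R = 0 the matrix `A` would vanish, against ‖A‖ ≥ c.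
  have hR : 0 < S.R := by
    rcases Nat.eq_zero_or_pos S.R with h | h
    · have h0 : S.A = 0 := by
        have : IsEmpty (Fin S.R) := by rw [h]; infer_instance
        ext i j
        simp [FactorizedSystem.A, Matrix.mul_apply]
      rw [h0, norm_zero] at hA
      linarith
    · exact h
  set κ₁ := condNumber S.A₁ with hκ₁
  set κ₂ := condNumber S.A₂ with hκ₂
  have k₁ : 1 ≤ κ₁ := one_le_condNumber (by omega)
  have k₂ : 1 ≤ κ₂ := one_le_condNumber (by omega)
  have k1 : 1 ≤ κ₁ * κ₂ := one_le_mul_of_one_le_of_one_le k₁ k₂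
  have s₁ : 1 ≤ κ₁ ^ 2 := one_le_pow₀ k₁
  have s₂ : 1 ≤ κ₂ ^ 2 := one_le_pow₀ k₂
  obtain ⟨Mu, hMu1, hMu, hMu'⟩ := exists_two_pow s₁
  obtain ⟨Mv, hMv1, hMv, hMv'⟩ := exists_two_pow s₂
  set β := S.rhsNorm with hβ
  have hβ0 : 0 < β := S.rhsNorm_pos
  set n := ⌊16 * K * S.R * (2 ^ Mu * 2 ^ Mv * (κ₁ * κ₂) * ((β + ε) / ε)) ^ 2⌋₊ + 1 with hn
  obtain ⟨d₁, d₂⟩ := normProd_bounds h₁ h₂ hR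
  have hL : ∀ x, (S.inputGates x).length ≤ gateBound S p := S.length_inputGates_le hp
  have tri := tri_leastSquares hδ hK hε hR hL (by linarith) hMu hMu1 (col_bounds h₁ hR).2
    (by linarith) hMv hMv1 (row_bounds h₂ hR).2 d₁ d₂ hn
  refine ⟨_, ?_, successProb_of_tri (by positivity) tri⟩
  set κ := κ₁ * κ₂ with hκ
  set L := gateBound S p with hLdef
  set w := 1 + Real.log S.M + Real.log S.N + β with hw
  set Z := ((1 + β) * (1 + ε₀) / ε) ^ 2 with hZ
  have hR' : (1 : ℝ) ≤ S.R := by exact_mod_cast hR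
  have hβε : (β + ε) / ε ≤ (1 + β) * (1 + ε₀) / ε := by
    gcongr; nlinarith
  have hβε1 : 1 ≤ (β + ε) / ε := by rw [le_div_iff₀ hε]; linarith
  have hZ1 : 1 ≤ Z := one_le_pow₀ (hβε1.trans hβε)
  have hX1 : 1 ≤ κ ^ 6 * Z := one_le_mul_of_one_le_of_one_le (one_le_pow₀ k1) hZ1
  -- The square of (4κ₁²)(4κ₂²) contributes 256, and 16·256 = 4096; the one sample added to the
  -- floor makes it 4097.
  have hnle : (n : ℝ) ≤ S.R * ((4097 * (K + 1)) * (κ ^ 6 * Z)) := by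
    have hK' : (0 : ℝ) ≤ K := Nat.cast_nonneg K
    have e1 : (n : ℝ) ≤ 16 * K * S.R * (2 ^ Mu * 2 ^ Mv * κ * ((β + ε) / ε)) ^ 2 + 1 := by
      rw [hn]; push_cast
      exact add_le_add (Nat.floor_le (by positivity)) le_rfl
    have e2 : 2 ^ Mu * 2 ^ Mv * κ * ((β + ε) / ε) ≤
        (4 * κ₁ ^ 2) * (4 * κ₂ ^ 2) * κ * ((1 + β) * (1 + ε₀) / ε) := by
      gcongr
    have e3 : (2 ^ Mu * 2 ^ Mv * κ * ((β + ε) / ε)) ^ 2 ≤ 256 * (κ ^ 6 * Z) := by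
      refine (pow_le_pow_left₀ (by positivity) e2 2).trans (le_of_eq ?_)
      rw [hZ, hκ]; ring
    have e4 : 16 * K * S.R * (2 ^ Mu * 2 ^ Mv * κ * ((β + ε) / ε)) ^ 2 ≤
        16 * K * S.R * (256 * (κ ^ 6 * Z)) := mul_le_mul_of_nonneg_left e3 (by positivity)
    have e5 : 1 ≤ S.R * (κ ^ 6 * Z) := one_le_mul_of_one_le_of_one_le hR' hX1
    nlinarith
  have total := totalTime_le (L := L) (q := κ ^ 2) (X := κ ^ 6 * Z) hR hMu' s₁ hMv' s₂
    (by rw [hκ, mul_pow]; nlinarith) (by rw [hκ, mul_pow]; nlinarith)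
    (by rw [← pow_mul]; exact le_mul_of_one_le_right (by positivity) hZ1) hnle
  have hM0 : 0 ≤ Real.log S.M := Real.log_natCast_nonneg _
  have hN0 : 0 ≤ Real.log S.N := Real.log_natCast_nonneg _
  have gate := gateBound_le (S := S) p (w := w) (by rw [hw]; linarith)
  have hΓ : c ^ 2 ≤ (κ * S.Γ) ^ 2 :=
    pow_le_pow_left₀ hc.le (hA.trans (norm_A_le h₁ h₂ hR)) 2
  -- The exchange of κ⁶ for κ⁸Γ²/c².
  have hκ6 : κ ^ 6 ≤ S.Γ ^ 2 * κ ^ 8 / c ^ 2 := by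
    rw [le_div_iff₀ (by positivity)]
    calc κ ^ 6 * c ^ 2 ≤ κ ^ 6 * (κ * S.Γ) ^ 2 := mul_le_mul_of_nonneg_left hΓ (by positivity)
      _ = _ := by ring
  have hw1 : 1 + β ≤ w := by rw [hw]; linarith
  -- Two more powers of `w`, besides those from the gates, make up the exponent `p.natDegree + 3`.
  have hZw : Z ≤ w ^ 2 * (1 + ε₀) ^ 2 / ε ^ 2 := by
    rw [hZ, div_pow, mul_pow]
    have : 0 < 1 + ε₀ := by linarith
    gcongr
  have hw0 : 0 < w := by linarith
  set G : ℝ := 2 * p.eval 1 * 2 ^ (p.natDegree + 1) + 1 with hG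
  have hG0 : 0 < G := by positivity
  refine total.trans ?_
  rw [timeConst, ← hG]
  exact combine_bounds (by positivity) (by positivity) (by positivity) (by positivity)
    (by positivity) (by positivity) gate hκ6 hZw (by rw [← pow_add])

end

end HybridLS

end

open HybridLS in
theorem mainTheorem3 :
    ∀ δ : ℝ, 0 < δ → δ < 1 →
      ∃ P : HybridLS.Program, ∀ p : Polynomial ℕ, ∃ k : ℕ,
        ∀ c ε₀ : ℝ, 0 < c → 0 < ε₀ →
          ∃ C : ℝ, 0 < C ∧
            ∀ (S : HybridLS.FactorizedSystem) (ε : ℝ),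
              S.DepthAtMost p → S.A₁.rank = S.R → S.A₂.rank = S.R →
              c ≤ ‖S.A‖ → 0 < ε → ε ≤ ε₀ →
              ∃ T : ℕ,
                (T : ℝ) ≤
                  C * ((S.R : ℝ) ^ 3 * S.Γ ^ 2 * (condNumber S.A₁ * condNumber S.A₂) ^ 8 *
                    (1 + Real.log S.M + Real.log S.N + S.rhsNorm) ^ k) / ε ^ 2 ∧
                ENNReal.ofReal (1 - δ) ≤ HybridLS.successProb P S ε T := by
  intro δ hδ _
  -- Each of the five random phases may fail with probability δ/5. The program depends on `K` alone,
  -- hence only on δ.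
  obtain ⟨K, hK⟩ := exists_goodFactor (δ := δ / 5) (by positivity)
  refine ⟨leastSquares K, fun p => ⟨p.natDegree + 3, fun c ε₀ hc hε₀ =>
    ⟨timeConst K p * (1 + ε₀) ^ 2 / c ^ 2, ?_, fun S ε hp h₁ h₂ hA hε hεε => ?_⟩⟩⟩
  · unfold timeConst
    positivity
  · have := exists_running_time (by positivity) hK hc hε hεε hp h₁ h₂ hA
    rwa [mul_div_cancel₀ δ (by norm_num : (5 : ℝ) ≠ 0)] at this
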